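/- Let $\mathfrak M$ be a complex manifold of complex dimension $n\ge 1$, countable at infinity, with a metric compatible with its topology that is locally, in holomorphic coordinates, bi-Lipschitz equivalent to the Euclidean metric (for example the distance of a Riemannian metric). Let $\Omega=\bigcap_{j=1}^N\Omega_j$ be a relatively compact domain in $\mathfrak M$ with generic corners, that is, each $\Omega_j$ is a domain in $\mathfrak M$ with $\mathcal C^\infty$ boundary, and for each $S\subset\{1,\dots,N\}$ the set $B_S=\bigcap_{j\in S}\partial\Omega_j$, if non-empty, is a generic CR manifold of CR-dimension $n-|S|$; equivalently, $\bigwedge_{j\in S}\overline\partial r_j\neq 0$ at every point of $B_S$ for local defining functions $r_j$ of $\Omega_j$. Let $f\in\mathcal A^{-\infty}(\Omega)$, i.e. $f$ is holomorphic on $\Omega$ and there are $C>0$ and $k\ge 0$ with $|f(z)|\le C\,\mathrm{dist}(z,\partial\Omega)^{-k}$ for all $z\in\Omega$. Then there is a unique distribution $\mathsf{ce} f\in\mathcal D'_0(\mathfrak M)$, the canonical extension of $f$, such that: (1) $(\mathsf{ce} f)|_\Omega=f$; (2) if $U$ is a coordinate neighborhood, $\phi$ is a smooth $(n,n)$-form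 with compact support in $U$, and $v\in\mathbb C^n$ is a vector that, in the coordinates on $U$, points outward from $\Omega_j$ at each point of $\partial\Omega_j\cap\operatorname{supp}\phi$ for every $j$, then $$\langle \mathsf{ce} f,\phi\rangle=\lim_{\epsilon\downarrow 0}\int_\Omega f(z-\epsilon v)\,\phi(z);$$ (3) if $f$ extends continuously to $\overline\Omega$, then $\mathsf{ce} f$ is integration of $f$ over $\overline\Omega$. Moreover, the boundary current $\mathsf{bc} f:=-\overline\partial(\mathsf{ce} f)\in\mathcal D'_{0,1}(\mathfrak M)$, i.e. $\langle\mathsf{bc} f,\omega\rangle=\langle\mathsf{ce} f,\overline\partial\omega\rangle$, satisfies the Weinstock orthogonality condition with respect to $\Omega$: for every smooth compactly supported $(n,n-1)$-form $\omega$ on $\mathfrak M$ with $\overline\partial\omega=0$ on $\overline\Omega$, one has $\langle\mathsf{bc} f,\omega\rangle=0$. -/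

import Mathlib

open Set Filter Topology MeasureTheory
open scoped Manifold ContDiff

namespace BoundaryCurrents

noncomputable section

/-- The model space `ℂⁿ`. Its `volume` is the Lebesgue measure `dx₁ dy₁ … dxₙ dyₙ`. -/
abbrev Cn (n : ℕ) : Type := Fin n → ℂ

section Flat

variable {E F : Type*} [NormedAddCommGroup E] [NormedSpace ℝ E] [NormedAddCommGroup F]
  [NormedSpace ℝ F]

lemma two_le_infty : (2 : WithTop ℕ∞) ≤ ∞ := by
  exact WithTop.coe_le_coe.2 (le_top : (2 : ℕ∞) ≤ ⊤)

lemma contDiffOn_extDeriv {k : ℕ} {α : E → E [⋀^Fin k]→L[ℝ] F} {s : Set E} (hs : IsOpen s)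
    (hα : ContDiffOn ℝ ∞ α s) : ContDiffOn ℝ ∞ (extDeriv α) s :=
  (ContinuousAlternatingMap.alternatizeUncurryFinCLM ℝ E F).contDiff.comp_contDiffOn
    (hα.fderiv_of_isOpen hs (by simp))

lemma norm_iteratedFDeriv_extDeriv_le {k : ℕ} {α : E → E [⋀^Fin k]→L[ℝ] F} {s : Set E}
    (hs : IsOpen s) (hα : ContDiffOn ℝ ∞ α s) {y : E} (hy : y ∈ s) (m : ℕ) :
    ‖iteratedFDeriv ℝ m (extDeriv α) y‖ ≤ (k + 1) * ‖iteratedFDeriv ℝ (m + 1) α y‖ := by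
  have hcd : ContDiffAt ℝ m (fderiv ℝ α) y := by
    have h1 : ContDiffOn ℝ ∞ (fderiv ℝ α) s := hα.fderiv_of_isOpen hs (by simp)
    exact (h1.contDiffAt (hs.mem_nhds hy)).of_le (by exact_mod_cast le_top)
  have hle := (ContinuousAlternatingMap.alternatizeUncurryFinCLM
    (n := k) ℝ E F).norm_iteratedFDeriv_comp_left hcd (n := m) le_rfl
  rw [norm_iteratedFDeriv_fderiv] at hle
  refine hle.trans ?_
  gcongr
  exact ContinuousAlternatingMap.norm_alternatizeUncurryFinCLM_le

end Flat

section Forms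

variable (n : ℕ) (M : Type*) [TopologicalSpace M] [ChartedSpace (Cn n) M]

/-- The holomorphic charts of `M` (coordinate neighbourhoods with their coordinates). -/
abbrev holoCharts : Set (OpenPartialHomeomorph M (Cn n)) :=
  IsManifold.maximalAtlas 𝓘(ℂ, Cn n) ω M

/-- Complex valued (not necessarily continuous) differential `k`-forms on `M`. As always in
Mathlib, the tangent space of `M` at `x` is identified with `ℂⁿ` through the preferred chart
`chartAt _ x`; the value at `x` is an `ℝ`-multilinear alternating map on the tangent space. -/
abbrev DiffForm (k : ℕ) : Type _ := M → Cn n [⋀^Fin k]→L[ℝ] ℂ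

variable {n M}

/-- The expression `(e⁻¹)^* α` of a form `α` in the chart `e`. Since `α x` is written in the chart
`chartAt _ x`, the derivative of the coordinate change from `e` to `chartAt _ x` enters. -/
def inChart {k : ℕ} (α : DiffForm n M k) (e : OpenPartialHomeomorph M (Cn n)) (y : Cn n) :
    Cn n [⋀^Fin k]→L[ℝ] ℂ :=
  (α (e.symm y)).compContinuousLinearMap
    (fderiv ℝ (chartAt (Cn n) (e.symm y) ∘ e.symm) y)

/-- `α` is `C^∞` : its expression in every holomorphic chart is `C^∞` (over `ℝ`). -/
def IsSmoothForm {k : ℕ} (α : DiffForm n M k) : Prop :=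
  ∀ e ∈ holoCharts n M, ContDiffOn ℝ ∞ (inChart α e) e.target

/-- `α` is of bidegree `(p, q)`. For a form of degree `p + q` this is equivalent to
being a combination of terms `dz_I ∧ dz̄_J` with `|I| = p`, `|J| = q`. -/
def IsOfType {k : ℕ} (p q : ℕ) (α : DiffForm n M k) : Prop :=
  ∀ (x : M) (c : ℂ) (v : Fin k → Cn n),
    α x (fun i => c • v i) = c ^ p * (starRingEnd ℂ c) ^ q * α x v

lemma inChart_add {k : ℕ} (α β : DiffForm n M k) (e : OpenPartialHomeomorph M (Cn n)) :
    inChart (α + β) e = inChart α e + inChart β e := by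
  funext y; ext v; simp [inChart]

lemma inChart_smul {k : ℕ} (c : ℂ) (α : DiffForm n M k) (e : OpenPartialHomeomorph M (Cn n)) :
    inChart (c • α) e = c • inChart α e := by
  funext y; ext v; simp [inChart]

variable (n M)

/-- `𝒟^k(M)`: the smooth compactly supported `k`-forms. -/
def testForms (k : ℕ) : Submodule ℂ (DiffForm n M k) where
  carrier := {α | IsSmoothForm α ∧ ∃ K : Set M, IsCompact K ∧ ∀ x ∉ K, α x = 0}
  zero_mem' := by
    refine ⟨fun e _ => ?_, ∅, isCompact_empty, fun x _ => rfl⟩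
    have : inChart (0 : DiffForm n M k) e = 0 := by funext y; ext v; simp [inChart]
    rw [this]; exact contDiffOn_const
  add_mem' := by
    rintro α β ⟨hα, K, hK, hαK⟩ ⟨hβ, L, hL, hβL⟩
    refine ⟨fun e he => ?_, K ∪ L, hK.union hL, fun x hx => ?_⟩
    · rw [inChart_add]; exact (hα e he).add (hβ e he)
    · simp only [mem_union, not_or] at hx
      simp [hαK x hx.1, hβL x hx.2]
  smul_mem' := by
    rintro c α ⟨hα, K, hK, hαK⟩
    refine ⟨fun e he => ?_, K, hK, fun x hx => by simp [hαK x hx]⟩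
    rw [inChart_smul]; exact (hα e he).const_smul c

/-- `𝒟^{p,q}(M)`: the smooth compactly supported `(p,q)`-forms. -/
def testFormsOfType (p q : ℕ) : Submodule ℂ (DiffForm n M (p + q)) where
  carrier := {α | α ∈ testForms n M (p + q) ∧ IsOfType p q α}
  zero_mem' := ⟨Submodule.zero_mem _, fun x c v => by simp⟩
  add_mem' := by
    rintro α β ⟨hα, tα⟩ ⟨hβ, tβ⟩
    refine ⟨Submodule.add_mem _ hα hβ, fun x c v => ?_⟩
    have h1 := tα x c v
    have h2 := tβ x c v
    simp only [Pi.add_apply, ContinuousAlternatingMap.add_apply, h1, h2]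
    ring
  smul_mem' := by
    rintro a α ⟨hα, tα⟩
    refine ⟨Submodule.smul_mem _ _ hα, fun x c v => ?_⟩
    have h1 := tα x c v
    simp only [Pi.smul_apply, ContinuousAlternatingMap.smul_apply, h1, smul_eq_mul]
    ring

variable {n M}

/-- Convergence to `0` in the space of test forms: the supports lie in a common compact set and, in
every chart, all derivatives tend to `0` uniformly on compact sets. -/
def TendstoZero {k : ℕ} (α : ℕ → DiffForm n M k) : Prop :=
  (∃ K : Set M, IsCompact K ∧ ∀ ν, ∀ x ∉ K, α ν x = 0) ∧
  ∀ e ∈ holoCharts n M, ∀ L ⊆ e.target, IsCompact L → ∀ m : ℕ,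
    TendstoUniformlyOn (fun ν => iteratedFDeriv ℝ m (inChart (α ν) e)) 0 atTop L

/-- The continuous linear functionals on a space `V` of test forms. (Spaces of test forms being
inductive limits of Fréchet spaces, continuity is sequential continuity.) -/
structure Current {k : ℕ} (V : Submodule ℂ (DiffForm n M k)) where
  toLinearMap : V →ₗ[ℂ] ℂ
  seqContinuous : ∀ α : ℕ → V, TendstoZero (fun ν => (α ν : DiffForm n M k)) →
    Tendsto (fun ν => toLinearMap (α ν)) atTop (𝓝 0)

/-- The exterior derivative of a form, computed at `x` in the chart `chartAt _ x`. -/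
def extDer {k : ℕ} (α : DiffForm n M k) : DiffForm n M (k + 1) := fun x =>
  extDeriv (inChart α (chartAt (Cn n) x)) (chartAt (Cn n) x x)

lemma contDiffOn_transition {e e' : OpenPartialHomeomorph M (Cn n)}
    (he : e ∈ holoCharts n M) (he' : e' ∈ holoCharts n M) :
    ContDiffOn ℝ ∞ (e' ∘ e.symm) (e.symm.trans e').source := by
  have h := StructureGroupoid.compatible_of_mem_maximalAtlas he he'
  have h1 := (mem_groupoid_of_pregroupoid.1 h).1
  have h2 : ContDiffOn ℂ ω (e' ∘ e.symm) (e.symm.trans e').source := by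
    simpa [contDiffPregroupoid] using h1
  exact (h2.restrict_scalars ℝ).of_le le_top

lemma inChart_eq_pullback [IsManifold 𝓘(ℂ, Cn n) ω M] {k : ℕ} (α : DiffForm n M k) {e e' : OpenPartialHomeomorph M (Cn n)}
    (he : e ∈ holoCharts n M) (he' : e' ∈ holoCharts n M) {y : Cn n}
    (hy : y ∈ (e.symm.trans e').source) :
    inChart α e y = (inChart α e' ((e' ∘ e.symm) y)).compContinuousLinearMap
      (fderiv ℝ (e' ∘ e.symm) y) := by
  have hy1 : y ∈ e.target := by simpa using hy.1
  have hy2 : e.symm y ∈ e'.source := by simpa using hy.2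
  have hx : e'.symm ((e' ∘ e.symm) y) = e.symm y := e'.left_inv hy2
  have hc : chartAt (Cn n) (e.symm y) ∈ holoCharts n M := IsManifold.chart_mem_maximalAtlas _
  have hg : DifferentiableAt ℝ (e' ∘ e.symm) y :=
    ((contDiffOn_transition he he').contDiffAt
      ((e.symm.trans e').open_source.mem_nhds hy)).differentiableAt (by simp)
  have hs : (e' ∘ e.symm) y ∈ (e'.symm.trans (chartAt (Cn n) (e.symm y))).source := by
    have h1 : e' (e.symm y) ∈ e'.target := e'.map_source hy2
    have h2 : e'.symm (e' (e.symm y)) = e.symm y := e'.left_inv hy2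
    simp [h1, h2]
  have hf : DifferentiableAt ℝ (chartAt (Cn n) (e.symm y) ∘ e'.symm) ((e' ∘ e.symm) y) :=
    ((contDiffOn_transition he' hc).contDiffAt
      ((e'.symm.trans _).open_source.mem_nhds hs)).differentiableAt (by simp)
  have heq : (chartAt (Cn n) (e.symm y) ∘ e.symm) =ᶠ[𝓝 y]
      ((chartAt (Cn n) (e.symm y) ∘ e'.symm) ∘ (e' ∘ e.symm)) := by
    filter_upwards [(e.symm.trans e').open_source.mem_nhds hy] with z hz
    have hz2 : e.symm z ∈ e'.source := by simpa using hz.2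
    simp [e'.left_inv hz2]
  have hd : fderiv ℝ (chartAt (Cn n) (e.symm y) ∘ e.symm) y =
      (fderiv ℝ (chartAt (Cn n) (e.symm y) ∘ e'.symm) ((e' ∘ e.symm) y)).comp
        (fderiv ℝ (e' ∘ e.symm) y) := by
    rw [heq.fderiv_eq, fderiv_comp _ hf hg]
  ext v
  simp only [inChart, hx]
  rw [hd]
  rfl

lemma inChart_extDer [IsManifold 𝓘(ℂ, Cn n) ω M] {k : ℕ} {α : DiffForm n M k} (hα : IsSmoothForm α)
    {e : OpenPartialHomeomorph M (Cn n)} (he : e ∈ holoCharts n M) {y : Cn n}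
    (hy : y ∈ e.target) : inChart (extDer α) e y = extDeriv (inChart α e) y := by
  set c := chartAt (Cn n) (e.symm y) with hcdef
  have hc : c ∈ holoCharts n M := IsManifold.chart_mem_maximalAtlas _
  have hs : y ∈ (e.symm.trans c).source := by
    simp [hy, hcdef]
  have hcs : (c ∘ e.symm) y ∈ c.target := c.map_source (mem_chart_source _ _)
  have heq : inChart α e =ᶠ[𝓝 y] fun z => (inChart α c ((c ∘ e.symm) z)).compContinuousLinearMap
      (fderiv ℝ (c ∘ e.symm) z) := by
    filter_upwards [(e.symm.trans c).open_source.mem_nhds hs] with z hz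
    exact inChart_eq_pullback α he hc hz
  have hd : DifferentiableAt ℝ (inChart α c) ((c ∘ e.symm) y) :=
    ((hα c hc).contDiffAt (c.open_target.mem_nhds hcs)).differentiableAt (by simp)
  have hg : ContDiffAt ℝ ∞ (c ∘ e.symm) y :=
    (contDiffOn_transition he hc).contDiffAt ((e.symm.trans c).open_source.mem_nhds hs)
  rw [heq.extDeriv_eq, extDeriv_pullback hd hg (by simpa using two_le_infty)]
  rfl

lemma extDer_apply_eq_zero {k : ℕ} {α : DiffForm n M k} {K : Set M} (hK : IsClosed K)
    (hα : ∀ x ∉ K, α x = 0) {x : M} (hx : x ∉ K) : extDer α x = 0 := by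
  have h1 : inChart α (chartAt (Cn n) x) =ᶠ[𝓝 (chartAt (Cn n) x x)] fun _ => 0 := by
    have hc : ContinuousAt (chartAt (Cn n) x).symm (chartAt (Cn n) x x) :=
      (chartAt (Cn n) x).continuousAt_symm (mem_chart_target _ x)
    have hm : Kᶜ ∈ 𝓝 ((chartAt (Cn n) x).symm (chartAt (Cn n) x x)) := by
      rw [(chartAt (Cn n) x).left_inv (mem_chart_source _ x)]
      exact hK.isOpen_compl.mem_nhds hx
    filter_upwards [hc hm] with y hy
    ext v
    simp [inChart, hα _ hy]
  rw [extDer, h1.extDeriv_eq, extDeriv]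
  ext v
  simp [ContinuousAlternatingMap.alternatizeUncurryFin_apply]

lemma extDer_mem [IsManifold 𝓘(ℂ, Cn n) ω M] [T2Space M] {k : ℕ} {α : DiffForm n M k} (hα : α ∈ testForms n M k) :
    extDer α ∈ testForms n M (k + 1) := by
  obtain ⟨hs, K, hK, hαK⟩ := hα
  refine ⟨fun e he => ?_, K, hK, fun x hx => extDer_apply_eq_zero hK.isClosed hαK hx⟩
  exact (contDiffOn_extDeriv e.open_target (hs e he)).congr fun _ hy => inChart_extDer hs he hy

lemma differentiableAt_inChart [IsManifold 𝓘(ℂ, Cn n) ω M] {k : ℕ} {α : DiffForm n M k} (hα : IsSmoothForm α) (x : M) :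
    DifferentiableAt ℝ (inChart α (chartAt (Cn n) x)) (chartAt (Cn n) x x) :=
  ((hα _ (IsManifold.chart_mem_maximalAtlas x)).contDiffAt
    ((chartAt (Cn n) x).open_target.mem_nhds (mem_chart_target _ x))).differentiableAt (by simp)

lemma TendstoZero.extDer [IsManifold 𝓘(ℂ, Cn n) ω M] [T2Space M] {k : ℕ} {α : ℕ → DiffForm n M k} (hs : ∀ ν, IsSmoothForm (α ν))
    (hα : TendstoZero α) : TendstoZero (fun ν => extDer (α ν)) := by
  obtain ⟨⟨K, hK, hαK⟩, hu⟩ := hα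
  refine ⟨⟨K, hK, fun ν x hx => extDer_apply_eq_zero hK.isClosed (hαK ν) hx⟩, ?_⟩
  intro e he L hL hLc m
  have h := hu e he L hL hLc (m + 1)
  rw [Metric.tendstoUniformlyOn_iff] at h ⊢
  intro ε hε
  filter_upwards [h (ε / (k + 1)) (by positivity)] with ν hν y hy
  have hy' := hν y hy
  simp only [Pi.zero_apply, dist_zero_left] at hy' ⊢
  have heq : inChart (BoundaryCurrents.extDer (α ν)) e =ᶠ[𝓝 y] extDeriv (inChart (α ν) e) := by
    filter_upwards [e.open_target.mem_nhds (hL hy)] with z hz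
    exact inChart_extDer (hs ν) he hz
  rw [(Filter.EventuallyEq.iteratedFDeriv ℝ heq m).self_of_nhds]
  calc _ ≤ (k + 1) * ‖iteratedFDeriv ℝ (m + 1) (inChart (α ν) e) y‖ :=
        norm_iteratedFDeriv_extDeriv_le e.open_target (hs ν e he) (hL hy) m
    _ < (k + 1) * (ε / (k + 1)) := by gcongr
    _ = ε := by field_simp

end Forms

section Operators

variable (n : ℕ) (M : Type*) [TopologicalSpace M] [ChartedSpace (Cn (n + 1)) M]

/-- `𝒟'_0(M)`, the distributions (`0`-currents) on a manifold of complex dimension `n + 1`: the dual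
of the space of test forms of top degree `2(n + 1)`. -/
abbrev Distribution0 : Type _ := Current (testForms (n + 1) M (n + 1 + n + 1))

/-- `𝒟'_{0,1}(M)`, the `(0,1)`-currents on a manifold of complex dimension `n + 1`: the dual of the
space of test forms of bidegree `(n + 1, n)`. -/
abbrev Current01 : Type _ := Current (testFormsOfType (n + 1) M (n + 1) n)

variable [IsManifold 𝓘(ℂ, Cn (n + 1)) ω M] [T2Space M]

/-- The operator `∂̄` from `(n + 1, n)`-forms to `(n + 1, n + 1)`-forms on a manifold of complex
dimension `n + 1`. Here `∂̄ = d`, as `∂` vanishes on forms of bidegree `(n + 1, n)`; and all forms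
of top degree are of bidegree `(n + 1, n + 1)`. -/
def dbar :
    testFormsOfType (n + 1) M (n + 1) n →ₗ[ℂ] testForms (n + 1) M (n + 1 + n + 1) where
  toFun α := ⟨extDer α.1, extDer_mem α.2.1⟩
  map_add' := by
    rintro ⟨α, hα, _⟩ ⟨β, hβ, _⟩
    apply Subtype.ext
    funext x
    simp only [extDer, inChart_add, Submodule.coe_add, Pi.add_apply]
    exact extDeriv_add (differentiableAt_inChart hα.1 x) (differentiableAt_inChart hβ.1 x)
  map_smul' := by
    rintro c ⟨α, hα, _⟩
    apply Subtype.ext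
    funext x
    simp only [extDer, inChart_smul, Submodule.coe_smul, Pi.smul_apply, RingHom.id_apply]
    rw [extDeriv, extDeriv, fderiv_const_smul (differentiableAt_inChart hα.1 x)]
    ext v
    simp [ContinuousAlternatingMap.alternatizeUncurryFin_apply, Finset.mul_sum]

variable {n M}

/-- `∂̄` of a `0`-current `T`, the `(0,1)`-current given by `⟨∂̄T, ψ⟩ = -⟨T, ∂̄ψ⟩`. -/
def dbarCurrent (T : Distribution0 n M) : Current01 n M where
  toLinearMap := -(T.toLinearMap ∘ₗ dbar n M)
  seqContinuous := by
    intro α hα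
    have h := T.seqContinuous (fun ν => dbar n M (α ν)) (hα.extDer fun ν => (α ν).2.1.1)
    simpa using h.neg

/-- The boundary current `bc f = -∂̄ (ce f)` obtained from the canonical extension `T = ce f`. -/
def boundaryCurrent (T : Distribution0 n M) : Current01 n M where
  toLinearMap := -(dbarCurrent T).toLinearMap
  seqContinuous := fun α hα => by simpa using ((dbarCurrent T).seqContinuous α hα).neg

/-- The Weinstock orthogonality condition for `γ` with respect to `Ω`: one has `⟨γ, ψ⟩ = 0` for all
`(n + 1, n)`-test forms `ψ` on `M` with `∂̄ψ = 0` on the closure of `Ω`. -/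
def WeinstockCondition (Ω : Set M) (γ : Current01 n M) : Prop :=
  ∀ ψ : testFormsOfType (n + 1) M (n + 1) n,
    (∀ x ∈ closure Ω, (dbar n M ψ : DiffForm (n + 1) M (n + 1 + n + 1)) x = 0) →
      γ.toLinearMap ψ = 0

end Operators

section Domains

variable (n : ℕ) {M : Type*}

/-- The metric of `M` is, locally and in holomorphic coordinates, bi-Lipschitz equivalent to the
Euclidean one. Distances of Riemannian metrics have this property. -/
def IsLocallyEuclideanMetric (M : Type*) [MetricSpace M] [ChartedSpace (Cn n) M] : Prop :=
  ∀ p : M, ∃ U ∈ 𝓝 p, ∃ K : ℝ, ∀ x ∈ U, ∀ y ∈ U,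
    dist (chartAt (Cn n) p x) (chartAt (Cn n) p y) ≤ K * dist x y ∧
    dist x y ≤ K * dist (chartAt (Cn n) p x) (chartAt (Cn n) p y)

/-- `f ∈ 𝒜^{-∞}(Ω)`: the function `f` is holomorphic on `Ω` and of polynomial growth,
`|f(z)| ≤ C / dist(z, ∂Ω)^k` on `Ω` for some `C` and `k`. (Values off `Ω` are irrelevant.) -/
def HolomorphicOfPolynomialGrowth [MetricSpace M] [ChartedSpace (Cn n) M]
    (Ω : Set M) (f : M → ℂ) : Prop :=
  MDifferentiableOn 𝓘(ℂ, Cn n) 𝓘(ℂ, ℂ) f Ω ∧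
  ∃ (C : ℝ) (k : ℕ), ∀ z ∈ Ω, ‖f z‖ * Metric.infDist z (frontier Ω) ^ k ≤ C

variable [TopologicalSpace M] [ChartedSpace (Cn n) M]

/-- `r` is a local defining function of `D` at `p` : near `p` it is a real `C^∞` function with
`D = {r < 0}`, and `dr ≠ 0` at `p`. -/
def IsLocalDefiningFunction (D : Set M) (p : M) (r : M → ℝ) : Prop :=
  (∃ U : Set M, IsOpen U ∧ p ∈ U ∧ ContMDiffOn 𝓘(ℝ, Cn n) 𝓘(ℝ, ℝ) ∞ r U ∧
    ∀ x ∈ U, x ∈ D ↔ r x < 0) ∧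
  fderiv ℝ (r ∘ (chartAt (Cn n) p).symm) (chartAt (Cn n) p p) ≠ 0

/-- A smoothly bounded domain: open, connected, non-empty, with a local defining function at each
boundary point. It need not be relatively compact. -/
structure IsSmoothDomain (D : Set M) : Prop where
  isOpen : IsOpen D
  isConnected : IsConnected D
  smooth : ∀ p ∈ frontier D, ∃ r : M → ℝ, IsLocalDefiningFunction n D p r

/-- The complex tangent space at `p` of the hypersurface `∂D`, i.e. the largest complex subspace of
its real tangent space `ker dr`, where `r` is a local defining function. (The kernel does
not depend on `r`.) It is written in the chart `chartAt _ p`. -/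
def complexTangentSpace (D : Set M) (p : M) : Submodule ℂ (Cn n) where
  carrier := {w | ∀ r : M → ℝ, IsLocalDefiningFunction n D p r → ∀ c : ℂ,
    fderiv ℝ (r ∘ (chartAt (Cn n) p).symm) (chartAt (Cn n) p p) (c • w) = 0}
  zero_mem' := fun r _ c => by simp
  add_mem' := fun {a b} ha hb r hr c => by
    rw [smul_add, map_add, ha r hr c, hb r hr c, add_zero]
  smul_mem' := fun a w hw r hr c => by
    rw [smul_smul]; exact hw r hr (c * a)

/-- `Ω = D₁ ∩ … ∩ D_N` is a (relatively compact) domain with generic corners in the manifold `M` of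
complex dimension `n`: the `D_j` are smoothly bounded domains, and each non-empty intersection
`B_S` of the boundaries `∂D_j`, `j ∈ S`, is a generic CR manifold of CR dimension `n - |S|`.

The latter means that at each point of `B_S` the intersection of the complex tangent spaces of the
`∂D_j`, `j ∈ S`, has complex dimension `n - |S|`, in other words that the `∂̄r_j` are linearly
independent over `ℂ` for local defining functions `r_j`. (Then the `dr_j` are linearly
independent over `ℝ`, so `B_S` is a submanifold of real codimension `|S|`, and this intersection is
its complex tangent space.) -/
structure IsDomainWithGenericCorners {N : ℕ} (D : Fin N → Set M) (Ω : Set M) : Prop where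
  eq_iInter : Ω = ⋂ j, D j
  isConnected : IsConnected Ω
  isCompact_closure : IsCompact (closure Ω)
  isSmoothDomain : ∀ j, IsSmoothDomain n (D j)
  generic : ∀ (S : Finset (Fin N)) (p : M), (∀ j ∈ S, p ∈ frontier (D j)) →
    Module.finrank ℂ (⨅ j ∈ S, complexTangentSpace n (D j) p : Submodule ℂ (Cn n)) + S.card = n

/-- The vector `v`, in the coordinates of `e`, points outward from `D` at `p ∈ ∂D`: one has
`dr(v) > 0` for a local defining function `r` of `D` at `p`. -/
def PointsOutward (D : Set M) (e : OpenPartialHomeomorph M (Cn n)) (v : Cn n) (p : M) : Prop :=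
  ∃ r : M → ℝ, IsLocalDefiningFunction n D p r ∧ 0 < fderiv ℝ (r ∘ e.symm) (e p) v

end Domains

section CanonicalExtension

variable {n : ℕ} {M : Type*} [TopologicalSpace M] [ChartedSpace (Cn (n + 1)) M]

/-- The frame `∂/∂x₁, ∂/∂y₁, ∂/∂x₂, ∂/∂y₂, …` of `ℂⁿ⁺¹`. -/
def realFrame (n : ℕ) (i : Fin (n + 1 + n + 1)) : Cn (n + 1) :=
  Pi.single ⟨i.val / 2, by omega⟩ (if i.val % 2 = 0 then 1 else Complex.I)

/-- The coefficient `φ₀` in `φ = φ₀ dx₁ ∧ dy₁ ∧ dx₂ ∧ dy₂ ∧ …` of a form of top degree in the chart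
`e`. Thus if `φ` has support in the domain of `e`, then the integral of `φ` over `M` (with the
orientation given by the complex structure) is the Lebesgue integral of `φ₀` over `e.target`. -/
def topCoeff (φ : DiffForm (n + 1) M (n + 1 + n + 1)) (e : OpenPartialHomeomorph M (Cn (n + 1)))
    (y : Cn (n + 1)) : ℂ :=
  inChart φ e y (realFrame n)

/-- `T` is the canonical extension `ce f` of the function `f` on the domain `Ω = ⋂ D_j`. -/
structure IsCanonicalExtension {N : ℕ} (D : Fin N → Set M) (Ω : Set M) (f : M → ℂ)
    (T : Distribution0 n M) : Prop where
  /-- `T` restricted to `Ω` is `f`. (Equality of distributions on `Ω` being a local property, it is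
  tested on forms with support in `Ω` and in a coordinate neighbourhood.) -/
  restrict_eq : ∀ e ∈ holoCharts (n + 1) M, ∀ φ : testForms (n + 1) M (n + 1 + n + 1),
    tsupport φ.1 ⊆ Ω ∩ e.source →
    T.toLinearMap φ = ∫ y in e.target, f (e.symm y) * topCoeff φ.1 e y
  /-- `⟨T, φ⟩ = lim_{ε ↓ 0} ∫_Ω f(z - εv) φ(z)` if `φ` is supported in the coordinate neighbourhood
  of `e` and, in its coordinates, `v` points outward from `D_j` along `∂D_j ∩ supp φ` for
  all `j`. -/
  tendsto : ∀ e ∈ holoCharts (n + 1) M, ∀ φ : testForms (n + 1) M (n + 1 + n + 1),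
    ∀ v : Cn (n + 1), tsupport φ.1 ⊆ e.source →
    (∀ j, ∀ p ∈ frontier (D j) ∩ tsupport φ.1,
      PointsOutward (n + 1) (D j) e v p) →
    Tendsto (fun ε : ℝ => ∫ y in e.target ∩ e.symm ⁻¹' Ω,
      f (e.symm (y - ε • v)) * topCoeff φ.1 e y) (𝓝[>] 0) (𝓝 (T.toLinearMap φ))
  /-- If `f` extends continuously to the closure of `Ω`, then `T` is integration of (the extension
  of) `f` over the closure of `Ω`. -/
  eq_of_continuousOn : ∀ g : M → ℂ, ContinuousOn g (closure Ω) → EqOn g f Ω →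
    ∀ e ∈ holoCharts (n + 1) M, ∀ φ : testForms (n + 1) M (n + 1 + n + 1),
    tsupport φ.1 ⊆ e.source →
    T.toLinearMap φ = ∫ y in e.target ∩ e.symm ⁻¹' (closure Ω), g (e.symm y) * topCoeff φ.1 e y

end CanonicalExtension

end

end BoundaryCurrents

/-! Consider a point of the closure of `Ω` where the faces `r_j = 0`, `j ∈ S`, meet. Genericity says
that the `∂̄r_j` are linearly independent there, so near the point there are vector fields `L_j` of
type `(0,1)` with `L_j r_i = δ_ij`. These fields annihilate holomorphic functions, and `L_j` is
tangent to every face except its own, where a factor `r_j` removes the boundary term. For `h`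
holomorphic and bounded and `u` a test function near the point, integration by parts therefore turns
`∫ h r_j ^ k u` into `-(k + 1)⁻¹ ∫ h r_j ^ (k + 1) Dt_j u`, with no boundary contribution, and
powers of the other `r_i` pass through unharmed. Iterating over `k` and over the faces gives, for
each `K`, a differential operator `Q` with `∫ h u = ∫ h (∏ r_i ^ K) Q u`
(`CornerModel.exists_operator`).

Near a boundary point `∏ |r_i|` is at most a constant times the distance to the boundary of `Ω`
(`exists_bound_of_frontier`). Hence `f ∏ r_i ^ K` is bounded if `K` is the exponent of growth of
`f`, and `∫ f (∏ r_i ^ K) Q u` is a continuous functional of `u` although `∫ f u` may diverge. The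
sum of these functionals over a finite partition of unity is the canonical extension
(`CornerAtlas.extension`).

For property (2), the shifted function `f(z - εv)` is holomorphic near the part of the closure of
`Ω` in the support of the form, and bounded there for fixed small `ε`, so the identity with `Q`
applies to it. The shift at least preserves half of each `|r_j|` (`LocalCorner.eventually_shift`),
so that the weighted shifted functions are bounded uniformly in `ε`, and dominated convergence gives
the limit (`CornerAtlas.tendsto_extension`). If `f` is bounded on the support, the identity applies
to `f` itself (`CornerAtlas.extension_eq_of_bounded`); this yields (1) and, as the boundary of `Ω`
is a null set, (3).

Near every point of the manifold some vector points outward from all `D j`, so a partition of unity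
writes any test form as a sum of forms covered by (2). Thus (2) alone determines the extension. It
also shows that the extension annihilates forms vanishing on `Ω`; applied to `∂̄ω`, this is the
Weinstock condition. -/

namespace BoundaryCurrents

noncomputable section

/-! ### Antiholomorphic directional derivatives and weak holomorphy. -/

section AntilinearDerivative

variable {d : ℕ}

/-- Twice the antilinear part of the real derivative of `u` at `y`, applied to `w`. -/
def dbarDir (w : Cn d) (u : Cn d → ℂ) (y : Cn d) : ℂ :=
  fderiv ℝ u y w + Complex.I * fderiv ℝ u y (Complex.I • w)

lemma dbarDir_add {w : Cn d} {u v : Cn d → ℂ} {y : Cn d} (hu : DifferentiableAt ℝ u y)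
    (hv : DifferentiableAt ℝ v y) :
    dbarDir w (fun z => u z + v z) y = dbarDir w u y + dbarDir w v y := by
  simp only [dbarDir]
  rw [fderiv_fun_add hu hv]
  simp only [add_apply]
  ring

lemma dbarDir_mul {w : Cn d} {u v : Cn d → ℂ} {y : Cn d} (hu : DifferentiableAt ℝ u y)
    (hv : DifferentiableAt ℝ v y) :
    dbarDir w (fun z => u z * v z) y = u y * dbarDir w v y + v y * dbarDir w u y := by
  simp only [dbarDir]
  rw [fderiv_fun_mul hu hv]
  simp only [add_apply, smul_apply, smul_eq_mul]
  ring

lemma dbarDir_const_mul {w : Cn d} {v : Cn d → ℂ} {y : Cn d} (a : ℂ)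
    (hv : DifferentiableAt ℝ v y) :
    dbarDir w (fun z => a * v z) y = a * dbarDir w v y := by
  rw [dbarDir_mul (differentiableAt_const a) hv]
  simp [dbarDir]

lemma dbarDir_congr {w : Cn d} {u v : Cn d → ℂ} {y : Cn d} (h : u =ᶠ[𝓝 y] v) :
    dbarDir w u y = dbarDir w v y := by
  simp only [dbarDir, h.fderiv_eq]

lemma dbarDir_eq_zero_of_eventuallyEq_const {w : Cn d} {u : Cn d → ℂ} {y : Cn d} {a : ℂ}
    (h : u =ᶠ[𝓝 y] fun _ => a) : dbarDir w u y = 0 := by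
  rw [dbarDir_congr h]; simp [dbarDir]

lemma dbarDir_eq_zero_of_differentiableAt {w : Cn d} {h : Cn d → ℂ} {y : Cn d}
    (hh : DifferentiableAt ℂ h y) : dbarDir w h y = 0 := by
  have h1 := (hh.hasFDerivAt.restrictScalars ℝ).fderiv
  simp only [dbarDir, h1, ContinuousLinearMap.coe_restrictScalars', map_smul, smul_eq_mul]
  rw [← mul_assoc, Complex.I_mul_I]; ring

lemma dbarDir_real_comp {w : Cn d} {r : Cn d → ℝ} {k : ℝ → ℝ} {y : Cn d}
    (hr : DifferentiableAt ℝ r y) (hk : DifferentiableAt ℝ k (r y)) :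
    dbarDir w (fun z => ((k (r z) : ℝ) : ℂ)) y =
      ((deriv k (r y) : ℝ) : ℂ) * dbarDir w (fun z => (r z : ℂ)) y := by
  have h1 : HasFDerivAt (fun z => (r z : ℂ)) (Complex.ofRealCLM.comp (fderiv ℝ r y)) y :=
    Complex.ofRealCLM.hasFDerivAt.comp y hr.hasFDerivAt
  have h2 : HasFDerivAt (fun z => ((k (r z) : ℝ) : ℂ))
      (Complex.ofRealCLM.comp (deriv k (r y) • fderiv ℝ r y)) y :=
    Complex.ofRealCLM.hasFDerivAt.comp y (hk.hasDerivAt.comp_hasFDerivAt y hr.hasFDerivAt)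
  simp only [dbarDir, h1.fderiv, h2.fderiv]
  simp
  ring

lemma contDiff_dbarDir {w : Cn d} {u : Cn d → ℂ} (hu : ContDiff ℝ ∞ u) :
    ContDiff ℝ ∞ (dbarDir w u) := by
  have h : ContDiff ℝ ∞ (fderiv ℝ u) := hu.fderiv_right (by simp)
  unfold dbarDir
  exact (h.clm_apply contDiff_const).add (contDiff_const.mul (h.clm_apply contDiff_const))

lemma tsupport_dbarDir_subset {w : Cn d} {u : Cn d → ℂ} :
    tsupport (dbarDir w u) ⊆ tsupport u := by
  refine closure_minimal (fun y hy => ?_) (isClosed_tsupport u)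
  by_contra h
  exact hy (dbarDir_eq_zero_of_eventuallyEq_const (notMem_tsupport_iff_eventuallyEq.1 h))

/-- The derivative of a holomorphic function is bounded on compact sets. -/
lemma exists_bound_fderiv {h : Cn d → ℂ} {O L : Set (Cn d)} (hO : IsOpen O)
    (hh : DifferentiableOn ℂ h O) (hL : IsCompact L) (hLO : L ⊆ O) :
    ∃ C, ∀ y ∈ L, ‖fderiv ℂ h y‖ ≤ C := by
  obtain ⟨ρ, hρ, hρO⟩ := hL.exists_cthickening_subset_open hO hLO
  have hc : IsCompact (Metric.cthickening ρ L) := hL.cthickening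
  obtain ⟨C, hC⟩ := hc.exists_bound_of_continuousOn (hh.continuousOn.mono hρO)
  refine ⟨(2 * C) / ρ, fun y hy => ?_⟩
  have hb : Metric.ball y ρ ⊆ Metric.cthickening ρ L :=
    Metric.ball_subset_closedBall.trans (Metric.closedBall_subset_cthickening hy ρ)
  refine Complex.norm_fderiv_le_div_of_mapsTo_ball (hh.mono (hb.trans hρO)) (fun z hz => ?_) hρ
  rw [Metric.mem_closedBall, dist_eq_norm]
  have h1 := hC z (hb hz)
  have h2 := hC y (hb (Metric.mem_ball_self hρ))
  calc ‖h z - h y‖ ≤ ‖h z‖ + ‖h y‖ := norm_sub_le _ _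
    _ ≤ 2 * C := by linarith

lemma fderiv_real_eq {h : Cn d → ℂ} {y : Cn d} (hh : DifferentiableAt ℂ h y) (w : Cn d) :
    fderiv ℝ h y w = fderiv ℂ h y w := by
  rw [(hh.hasFDerivAt.restrictScalars ℝ).fderiv]; rfl

lemma integrable_of_bounded_on_tsupport {F g : Cn d → ℂ} {C : ℝ} (hF : AEStronglyMeasurable F volume)
    (hg : Continuous g) (hgc : HasCompactSupport g) (hC : ∀ y ∈ tsupport g, ‖F y‖ ≤ C) :
    Integrable fun y => F y * g y := by
  refine (hg.integrable_of_hasCompactSupport hgc).norm.const_mul C |>.mono'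
    (hF.mul hg.aestronglyMeasurable) (Eventually.of_forall fun y => ?_)
  by_cases hy : y ∈ tsupport g
  · rw [norm_mul]; exact mul_le_mul_of_nonneg_right (hC y hy) (norm_nonneg _)
  · simp [image_eq_zero_of_notMem_tsupport hy]

lemma integrable_of_continuousOn_tsupport {F g : Cn d → ℂ} {O : Set (Cn d)} (hO : IsOpen O)
    (hF : ContinuousOn F O)
    (hg : Continuous g) (hgc : HasCompactSupport g) (hgO : tsupport g ⊆ O) :
    Integrable fun y => F y * g y := by
  obtain ⟨C, hC⟩ := hgc.exists_bound_of_continuousOn (hF.mono hgO)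
  have h1 : (fun y => F y * g y) = fun y => O.indicator F y * g y := by
    funext y
    by_cases hy : y ∈ O
    · simp [hy]
    · simp [image_eq_zero_of_notMem_tsupport fun h => hy (hgO h)]
  rw [h1]
  refine integrable_of_bounded_on_tsupport (C := C) ?_ hg hgc fun y hy => ?_
  · exact (aestronglyMeasurable_indicator_iff hO.measurableSet).2
      (hF.aestronglyMeasurable hO.measurableSet)
  · rw [indicator_of_mem (hgO hy)]; exact hC y hy

lemma hasCompactSupport_fderiv_apply {g : Cn d → ℂ} (hgc : HasCompactSupport g) (w : Cn d) :
    HasCompactSupport fun y => fderiv ℝ g y w :=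
  (hgc.fderiv ℝ).comp_left (g := fun A : Cn d →L[ℝ] ℂ => A w) rfl

/-- The compact support of `g` rules out boundary terms. Cauchy's estimate bounds the derivative of
`h` on that support, which supplies the integrability that integration by parts requires. -/
lemma integral_mul_fderiv_of_holomorphic {h g : Cn d → ℂ} {O : Set (Cn d)} (hO : IsOpen O)
    (hh : DifferentiableOn ℂ h O) (hg : ContDiff ℝ ∞ g) (hgc : HasCompactSupport g)
    (hgO : tsupport g ⊆ O) (w : Cn d) :
    Integrable (fun y => h y * fderiv ℝ g y w) ∧
    Integrable (fun y => fderiv ℝ h y w * g y) ∧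
    ∫ y, h y * fderiv ℝ g y w = - ∫ y, fderiv ℝ h y w * g y := by
  have hgw : Continuous fun y => fderiv ℝ g y w :=
    (hg.continuous_fderiv (by simp)).clm_apply continuous_const
  have hd : ∀ y ∈ tsupport g, DifferentiableAt ℂ h y := fun y hy =>
    hh.differentiableAt (hO.mem_nhds (hgO hy))
  obtain ⟨C, hC⟩ := exists_bound_fderiv hO hh hgc hgO
  have i1 : Integrable fun y => h y * fderiv ℝ g y w :=
    integrable_of_continuousOn_tsupport hO hh.continuousOn hgw
      (hasCompactSupport_fderiv_apply hgc w)
      ((tsupport_fderiv_apply_subset ℝ w).trans hgO)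
  have i2 : Integrable fun y => fderiv ℝ h y w * g y := by
    refine integrable_of_bounded_on_tsupport (C := C * ‖w‖)
      (measurable_fderiv_apply_const ℝ h w).aestronglyMeasurable hg.continuous hgc fun y hy => ?_
    rw [fderiv_real_eq (hd y hy)]
    exact ((fderiv ℂ h y).le_opNorm w).trans
      (mul_le_mul_of_nonneg_right (hC y hy) (norm_nonneg w))
  refine ⟨i1, i2, integral_mul_fderiv_eq_neg_fderiv_mul_of_integrable i2 i1
    (integrable_of_continuousOn_tsupport hO hh.continuousOn hg.continuous hgc hgO)
    (fun y hy => (hd y hy).restrictScalars ℝ) fun y _ => (hg.differentiable (by simp)) y⟩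

/-- Holomorphic functions are annihilated by `∂̄` in the sense of distributions. -/
lemma integral_mul_dbarDir {h g : Cn d → ℂ} {O : Set (Cn d)} (hO : IsOpen O)
    (hh : DifferentiableOn ℂ h O) (hg : ContDiff ℝ ∞ g) (hgc : HasCompactSupport g)
    (hgO : tsupport g ⊆ O) (w : Cn d) : ∫ y, h y * dbarDir w g y = 0 := by
  obtain ⟨a1, a2, a3⟩ := integral_mul_fderiv_of_holomorphic hO hh hg hgc hgO w
  obtain ⟨b1, b2, b3⟩ := integral_mul_fderiv_of_holomorphic hO hh hg hgc hgO (Complex.I • w)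
  have e1 : ∀ y, h y * dbarDir w g y =
      h y * fderiv ℝ g y w + Complex.I * (h y * fderiv ℝ g y (Complex.I • w)) := fun y => by
    rw [dbarDir]; ring
  simp_rw [e1]
  rw [integral_add a1 (b1.const_mul _), integral_const_mul, a3, b3, mul_neg, ← neg_add,
    ← integral_const_mul, ← integral_add a2 (b2.const_mul _), neg_eq_zero]
  -- Both derivatives now fall on `h`, and the integrand is `g` times the antilinear derivative of
  -- `h`.
  refine integral_eq_zero_of_ae (Eventually.of_forall fun y => ?_)
  by_cases hy : y ∈ tsupport g
  · have := dbarDir_eq_zero_of_differentiableAt (w := w)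
      (hh.differentiableAt (hO.mem_nhds (hgO hy)))
    rw [dbarDir] at this
    simp only [Pi.zero_apply]
    linear_combination g y * this
  · simp [image_eq_zero_of_notMem_tsupport hy]

end AntilinearDerivative

/-! ### Cutoff functions of one real variable. -/

section Cutoff

/-- A smooth function on `ℝ` that equals `1` on `(-∞, -2]` and vanishes on `[-1, ∞)`. -/
def negCutoff (t : ℝ) : ℝ := Real.smoothTransition (-1 - t)

lemma contDiff_negCutoff : ContDiff ℝ ∞ negCutoff :=
  Real.smoothTransition.contDiff.comp (contDiff_const.sub contDiff_id)

lemma negCutoff_nonneg (t : ℝ) : 0 ≤ negCutoff t := Real.smoothTransition.nonneg _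

lemma negCutoff_le_one (t : ℝ) : negCutoff t ≤ 1 := Real.smoothTransition.le_one _

lemma negCutoff_of_le {t : ℝ} (ht : t ≤ -2) : negCutoff t = 1 :=
  Real.smoothTransition.one_of_one_le (by linarith)

lemma negCutoff_of_ge {t : ℝ} (ht : -1 ≤ t) : negCutoff t = 0 :=
  Real.smoothTransition.zero_of_nonpos (by linarith)

/-- The identity multiplied with `negCutoff`. -/
def cutId (t : ℝ) : ℝ := t * negCutoff t

lemma contDiff_cutId : ContDiff ℝ ∞ cutId := contDiff_id.mul contDiff_negCutoff

lemma deriv_cutId_of_lt {t : ℝ} (ht : t < -2) : deriv cutId t = 1 := by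
  have h : cutId =ᶠ[𝓝 t] id := by
    filter_upwards [Iio_mem_nhds ht] with s hs
    simp [cutId, negCutoff_of_le (le_of_lt hs)]
  rw [h.deriv_eq, deriv_id]

lemma deriv_cutId_of_gt {t : ℝ} (ht : -1 < t) : deriv cutId t = 0 := by
  have h : cutId =ᶠ[𝓝 t] fun _ => 0 := by
    filter_upwards [Ioi_mem_nhds ht] with s hs
    simp [cutId, negCutoff_of_ge (le_of_lt hs)]
  rw [h.deriv_eq, deriv_const]

/-- The derivative is constant off `[-2, -1]`. The bound enters the dominating function of the
integration by parts. -/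
lemma exists_bound_deriv_cutId : ∃ C, ∀ t, |deriv cutId t| ≤ C := by
  have hc : Continuous (deriv cutId) := contDiff_cutId.continuous_deriv (by simp)
  obtain ⟨C, hC⟩ := (isCompact_Icc (a := (-2 : ℝ)) (b := -1)).exists_bound_of_continuousOn
    hc.continuousOn
  refine ⟨max C 1, fun t => ?_⟩
  rcases lt_or_ge t (-2) with h | h
  · simp [deriv_cutId_of_lt h]
  rcases lt_or_ge (-1) t with h' | h'
  · simp [deriv_cutId_of_gt h']
  · exact (hC t ⟨h, h'⟩).trans (le_max_left _ _)

/-- The rescaling `a⁻¹ · cutId (a t)`. -/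
def cutIdScaled (a t : ℝ) : ℝ := t * negCutoff (a * t)

lemma contDiff_cutIdScaled (a : ℝ) : ContDiff ℝ ∞ (cutIdScaled a) :=
  contDiff_id.mul (contDiff_negCutoff.comp (contDiff_const.mul contDiff_id))

/-- The derivative of `negCutoff (a * t)` grows like `a`, but the factor `t` compensates for this:
by scale invariance the derivative of the product is bounded uniformly in `a`. -/
lemma deriv_cutIdScaled {a : ℝ} (ha : a ≠ 0) (t : ℝ) :
    deriv (cutIdScaled a) t = deriv cutId (a * t) := by
  have h : cutIdScaled a = fun t => a⁻¹ * cutId (a * t) := by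
    funext t; simp [cutIdScaled, cutId]; field_simp
  have hd : HasDerivAt cutId (deriv cutId (a * t)) (a * t) :=
    (contDiff_cutId.differentiable (by simp) _).hasDerivAt
  have h2 := (hd.comp t ((hasDerivAt_id t).const_mul a)).const_mul a⁻¹
  rw [h]
  refine (h2.congr_deriv ?_).deriv
  field_simp

lemma abs_cutIdScaled_le (a t : ℝ) : |cutIdScaled a t| ≤ |t| := by
  rw [cutIdScaled, abs_mul, abs_of_nonneg (negCutoff_nonneg _)]
  exact mul_le_of_le_one_right (abs_nonneg _) (negCutoff_le_one _)

end Cutoff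

/-! ### Corner models and approximation of the face functions from inside. -/

/-- A local model of a corner: smooth functions `r i`, and vector fields of type `(0,1)` (with
coefficients `c j l` with respect to the constant fields given by `w l`) that form, on `W`, a
dual family of the differentials of the `r i`. -/
structure CornerModel (d : ℕ) (ι : Type*) [Fintype ι] [DecidableEq ι] where
  r : ι → Cn d → ℝ
  w : ι → Cn d
  c : ι → ι → Cn d → ℂ
  W : Set (Cn d)
  isOpen_W : IsOpen W
  contDiff_r : ∀ i, ContDiff ℝ ∞ (r i)
  contDiff_c : ∀ j l, ContDiff ℝ ∞ (c j l)
  dual : ∀ y ∈ W, ∀ j i, ∑ l, c j l y * dbarDir (w l) (fun z => (r i z : ℂ)) y =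
    if i = j then 1 else 0

namespace CornerModel

variable {d : ℕ} {ι : Type*} [Fintype ι] [DecidableEq ι] (m : CornerModel d ι)

/-- The set where all `r i` are negative. -/
def region : Set (Cn d) := {y | ∀ i, m.r i y < 0}

lemma isOpen_region : IsOpen m.region := by
  simp only [region, ofPred_forall]
  exact isOpen_iInter_of_finite fun i =>
    isOpen_lt (m.contDiff_r i).continuous continuous_const

/-- The vector field of type `(0,1)` with index `j`, as a derivation. -/
def L (j : ι) (u : Cn d → ℂ) (y : Cn d) : ℂ := ∑ l, m.c j l y * dbarDir (m.w l) u y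

/-- Minus the formal transpose of `m.L j`. -/
def Dt (j : ι) (u : Cn d → ℂ) (y : Cn d) : ℂ := ∑ l, dbarDir (m.w l) (fun z => m.c j l z * u z) y

lemma contDiff_L (j : ι) {u : Cn d → ℂ} (hu : ContDiff ℝ ∞ u) : ContDiff ℝ ∞ (m.L j u) := by
  unfold L
  exact ContDiff.sum fun l _ => (m.contDiff_c j l).mul (contDiff_dbarDir hu)

lemma contDiff_Dt (j : ι) {u : Cn d → ℂ} (hu : ContDiff ℝ ∞ u) : ContDiff ℝ ∞ (m.Dt j u) := by
  unfold Dt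
  exact ContDiff.sum fun l _ => contDiff_dbarDir ((m.contDiff_c j l).mul hu)

lemma Dt_eq_zero_of_notMem {j : ι} {u : Cn d → ℂ} {y : Cn d} (hy : y ∉ tsupport u) :
    m.Dt j u y = 0 := by
  refine Finset.sum_eq_zero fun l _ => dbarDir_eq_zero_of_eventuallyEq_const (a := 0) ?_
  filter_upwards [notMem_tsupport_iff_eventuallyEq.1 hy] with z hz
  simp [hz]

lemma tsupport_Dt_subset (j : ι) (u : Cn d → ℂ) : tsupport (m.Dt j u) ⊆ tsupport u :=
  closure_minimal (fun _ hy => by_contra fun h => hy (m.Dt_eq_zero_of_notMem h))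
    (isClosed_tsupport u)

lemma L_mul {j : ι} {u v : Cn d → ℂ} {y : Cn d} (hu : DifferentiableAt ℝ u y)
    (hv : DifferentiableAt ℝ v y) :
    m.L j (fun z => u z * v z) y = u y * m.L j v y + v y * m.L j u y := by
  simp only [L, dbarDir_mul hu hv, Finset.mul_sum, ← Finset.sum_add_distrib]
  exact Finset.sum_congr rfl fun l _ => by ring

lemma Dt_mul (j : ι) {g u : Cn d → ℂ} {y : Cn d} (hg : DifferentiableAt ℝ g y)
    (hu : DifferentiableAt ℝ u y) :
    m.Dt j (fun z => g z * u z) y = g y * m.Dt j u y + u y * m.L j g y := by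
  simp only [L, Dt, Finset.mul_sum, ← Finset.sum_add_distrib]
  refine Finset.sum_congr rfl fun l _ => ?_
  have hc : DifferentiableAt ℝ (m.c j l) y := (m.contDiff_c j l).differentiable (by simp) y
  have h : (fun z => m.c j l z * (g z * u z)) = fun z => g z * (m.c j l z * u z) := by
    funext z; ring
  rw [h, dbarDir_mul hg (hc.fun_mul hu)]
  ring

/-- Chain rule and duality. In particular `m.L j` annihilates functions of `r i` for `i ≠ j`, which
expresses that it is tangent to the level sets of `r i`. -/
lemma L_real_comp {j i : ι} {k : ℝ → ℝ} (hk : Differentiable ℝ k) {y : Cn d} (hy : y ∈ m.W) :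
    m.L j (fun z => ((k (m.r i z) : ℝ) : ℂ)) y =
      if i = j then ((deriv k (m.r i y) : ℝ) : ℂ) else 0 := by
  have hr : DifferentiableAt ℝ (m.r i) y := (m.contDiff_r i).differentiable (by simp) y
  have h := m.dual y hy j i
  simp only [L, dbarDir_real_comp hr (hk _)]
  calc _ = ((deriv k (m.r i y) : ℝ) : ℂ) *
        ∑ l, m.c j l y * dbarDir (m.w l) (fun z => (m.r i z : ℂ)) y := by
        rw [Finset.mul_sum]; exact Finset.sum_congr rfl fun l _ => by ring
    _ = _ := by rw [h]; split_ifs <;> simp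

lemma L_prod_eq_zero {α : Type*} {j : ι} {F : α → Cn d → ℂ} {y : Cn d} (A : Finset α)
    (hF : ∀ i ∈ A, DifferentiableAt ℝ (F i) y) (h : ∀ i ∈ A, m.L j (F i) y = 0) :
    m.L j (fun z => ∏ i ∈ A, F i z) y = 0 := by
  classical
  suffices DifferentiableAt ℝ (fun z => ∏ i ∈ A, F i z) y ∧
    m.L j (fun z => ∏ i ∈ A, F i z) y = 0 from this.2
  induction A using Finset.induction_on with
  | empty =>
    refine ⟨by simp, Finset.sum_eq_zero fun l _ => ?_⟩
    rw [dbarDir_eq_zero_of_eventuallyEq_const (a := 1) (by simp), mul_zero]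
  | insert a A ha ih =>
    obtain ⟨hd, h0⟩ := ih (fun i hi => hF i (Finset.mem_insert_of_mem hi))
      (fun i hi => h i (Finset.mem_insert_of_mem hi))
    have hda := hF a (Finset.mem_insert_self _ _)
    simp only [Finset.prod_insert ha]
    refine ⟨hda.fun_mul hd, ?_⟩
    rw [m.L_mul hda hd, h0, h a (Finset.mem_insert_self _ _)]
    simp

lemma integral_mul_Dt {h g : Cn d → ℂ} {O : Set (Cn d)} (hO : IsOpen O)
    (hh : DifferentiableOn ℂ h O) (hg : ContDiff ℝ ∞ g) (hgc : HasCompactSupport g)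
    (hgO : tsupport g ⊆ O) (j : ι) : ∫ y, h y * m.Dt j g y = 0 := by
  simp only [Dt, Finset.mul_sum]
  have hs : ∀ l, tsupport (fun z => m.c j l z * g z) ⊆ tsupport g := fun l =>
    tsupport_mul_subset_right
  have hc : ∀ l, ContDiff ℝ ∞ (fun z => m.c j l z * g z) := fun l => (m.contDiff_c j l).mul hg
  have hcc : ∀ l, HasCompactSupport (fun z => m.c j l z * g z) := fun l => hgc.mul_left
  rw [integral_finsetSum]
  · exact Finset.sum_eq_zero fun l _ =>
      integral_mul_dbarDir hO hh (hc l) (hcc l) ((hs l).trans hgO) _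
  · intro l _
    exact integrable_of_continuousOn_tsupport hO hh.continuousOn
      (contDiff_dbarDir (hc l)).continuous
      ((hcc l).mono' (subset_tsupport _ |>.trans tsupport_dbarDir_subset))
      (tsupport_dbarDir_subset.trans ((hs l).trans hgO))

/-- The cutoff function of `m.region`, without the factor that belongs to `j`. -/
def cut (j : ι) (a : ℝ) (y : Cn d) : ℂ :=
  ∏ i ∈ Finset.univ.erase j, ((negCutoff (a * m.r i y) : ℝ) : ℂ)

lemma contDiff_cut (j : ι) (a : ℝ) : ContDiff ℝ ∞ (m.cut j a) := by
  unfold cut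
  exact contDiff_prod fun i _ => Complex.ofRealCLM.contDiff.comp
    (contDiff_negCutoff.comp (contDiff_const.mul (m.contDiff_r i)))

lemma norm_cut_le (j : ι) (a : ℝ) (y : Cn d) : ‖m.cut j a y‖ ≤ 1 := by
  rw [cut, norm_prod]
  refine Finset.prod_le_one (fun _ _ => norm_nonneg _) fun i _ => ?_
  rw [Complex.norm_real, Real.norm_of_nonneg (negCutoff_nonneg _)]
  exact negCutoff_le_one _

/-- Each factor is a function of some `r i` with `i ≠ j`, and the field is tangential there. So the
derivatives of these cutoffs, which are of size `a`, never enter the estimates. -/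
lemma L_cut_eq_zero (j : ι) (a : ℝ) {y : Cn d} (hy : y ∈ m.W) : m.L j (m.cut j a) y = 0 := by
  refine m.L_prod_eq_zero _ (fun i _ => ?_) fun i hi => ?_
  · exact (Complex.ofRealCLM.contDiff.comp (contDiff_negCutoff.comp (contDiff_const.mul
      (m.contDiff_r i)))).differentiable (n := ∞) (by simp) y
  · have hk : Differentiable ℝ fun t => negCutoff (a * t) :=
      (contDiff_negCutoff.comp (contDiff_const.mul contDiff_id)).differentiable (n := ∞) (by simp)
    rw [m.L_real_comp (k := fun t => negCutoff (a * t)) hk hy,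
      if_neg (Finset.ne_of_mem_erase hi)]

/-- A smooth approximation of `r j` on `m.region`, supported in `m.region`. -/
def approx (j : ι) (a : ℝ) (y : Cn d) : ℂ := ((cutIdScaled a (m.r j y) : ℝ) : ℂ) * m.cut j a y

lemma contDiff_approx (j : ι) (a : ℝ) : ContDiff ℝ ∞ (m.approx j a) :=
  (Complex.ofRealCLM.contDiff.comp ((contDiff_cutIdScaled a).comp (m.contDiff_r j))).mul
    (m.contDiff_cut j a)

lemma norm_approx_le (j : ι) (a : ℝ) (y : Cn d) : ‖m.approx j a y‖ ≤ |m.r j y| := by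
  rw [approx, norm_mul, Complex.norm_real, Real.norm_eq_abs]
  exact (mul_le_of_le_one_right (abs_nonneg _) (m.norm_cut_le j a y)).trans
    (abs_cutIdScaled_le _ _)

lemma L_approx (j : ι) {a : ℝ} (ha : a ≠ 0) {y : Cn d} (hy : y ∈ m.W) :
    m.L j (m.approx j a) y = ((deriv cutId (a * m.r j y) : ℝ) : ℂ) * m.cut j a y := by
  have h1 : DifferentiableAt ℝ (fun z => ((cutIdScaled a (m.r j z) : ℝ) : ℂ)) y :=
    (Complex.ofRealCLM.contDiff.comp
      ((contDiff_cutIdScaled a).comp (m.contDiff_r j))).differentiable (n := ∞) (by simp) y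
  have h2 : DifferentiableAt ℝ (m.cut j a) y := (m.contDiff_cut j a).differentiable (by simp) y
  have h3 : Differentiable ℝ (cutIdScaled a) := (contDiff_cutIdScaled a).differentiable (by simp)
  have h4 := m.L_mul (j := j) h1 h2
  rw [m.L_cut_eq_zero j a hy, m.L_real_comp h3 hy, if_pos rfl, deriv_cutIdScaled ha] at h4
  rw [show m.approx j a = fun z => ((cutIdScaled a (m.r j z) : ℝ) : ℂ) * m.cut j a z from rfl, h4]
  ring

lemma approx_eq_zero {j : ι} {a : ℝ} {y : Cn d} {i : ι} (hi : -1 ≤ a * m.r i y) :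
    m.approx j a y = 0 := by
  by_cases hij : i = j
  · subst hij
    simp [approx, cutIdScaled, negCutoff_of_ge hi]
  · rw [approx, cut, Finset.prod_eq_zero (Finset.mem_erase.2 ⟨hij, Finset.mem_univ i⟩)
      (by simp [negCutoff_of_ge hi]), mul_zero]

/-- Where the function is not zero, all `a * r i` are at most `-1`. This condition is closed and
keeps a positive distance from the values on the faces. -/
lemma tsupport_approx_subset (j : ι) {a : ℝ} (ha : 0 < a) : tsupport (m.approx j a) ⊆ m.region := by
  have h1 : tsupport (m.approx j a) ⊆ ⋂ i, {y | a * m.r i y ≤ -1} := by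
    refine closure_minimal (fun y hy => ?_) (isClosed_iInter fun i => isClosed_le
      (continuous_const.mul (m.contDiff_r i).continuous) continuous_const)
    simp only [mem_iInter, mem_ofPred_eq]
    intro i
    by_contra h
    exact hy (m.approx_eq_zero (i := i) (by linarith))
  intro y hy i
  have := mem_iInter.1 (h1 hy) i
  simp only [mem_ofPred_eq] at this
  by_contra h
  have : 0 ≤ a * m.r i y := mul_nonneg ha.le (not_lt.1 h)
  linarith

/-- At a fixed point of the region all cutoffs are equal to `1` once `a` is large, so the pointwise
limits are attained at a finite stage. -/
lemma eventually_approx {j : ι} {y : Cn d} (hy : y ∈ m.region) :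
    ∀ᶠ ν : ℕ in atTop, m.approx j (ν + 1) y = m.r j y ∧
      ((deriv cutId ((ν + 1) * m.r j y) : ℝ) : ℂ) * m.cut j (ν + 1) y = 1 := by
  have h : ∀ᶠ ν : ℕ in atTop, ∀ i, ((ν : ℝ) + 1) * m.r i y < -2 := by
    refine eventually_all.2 fun i => ?_
    have h1 : Tendsto (fun ν : ℕ => ((ν : ℝ) + 1) * m.r i y) atTop atBot :=
      (tendsto_atTop_add_const_right _ _ tendsto_natCast_atTop_atTop).atTop_mul_const_of_neg (hy i)
    exact h1.eventually_lt_atBot _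
  filter_upwards [h] with ν hν
  have hc : m.cut j (ν + 1) y = 1 :=
    Finset.prod_eq_one fun i _ => by simp [negCutoff_of_le (hν i).le]
  constructor
  · simp [approx, hc, cutIdScaled, negCutoff_of_le (hν j).le]
  · simp [hc, deriv_cutId_of_lt (hν j)]

end CornerModel

/-! ### Integration by parts up to the corner. -/

namespace CornerModel

variable {d : ℕ} {ι : Type*} [Fintype ι] [DecidableEq ι] (m : CornerModel d ι)

lemma hasCompactSupport_Dt (j : ι) {u : Cn d → ℂ} (hu : HasCompactSupport u) :
    HasCompactSupport (m.Dt j u) :=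
  hu.mono' (subset_tsupport _ |>.trans (m.tsupport_Dt_subset j u))

/-- Integration by parts on the region of a corner model; no boundary terms occur, as
`m.r j` vanishes on one face and the field `m.L j` is tangential to the others. -/
lemma integral_region_eq_zero {h u P : Cn d → ℂ} {O : Set (Cn d)} {C : ℝ} (hO : IsOpen O)
    (hh : DifferentiableOn ℂ h O) (hu : ContDiff ℝ ∞ u) (huc : HasCompactSupport u)
    (huW : tsupport u ⊆ m.W) (huO : m.region ∩ tsupport u ⊆ O)
    (hC : ∀ y ∈ m.region ∩ tsupport u, ‖h y‖ ≤ C) (hP : ContDiff ℝ ∞ P) (j : ι) :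
    ∫ y in m.region, h y *
      (m.r j y * P y * m.Dt j u y + u y * (P y + m.r j y * m.L j P y)) = 0 := by
  obtain ⟨C₀, hC₀⟩ := exists_bound_deriv_cutId
  -- If the region misses the support, the given bound may be negative; the dominating function
  -- needs a nonnegative one.
  obtain ⟨C, hCpos, hC⟩ : ∃ C', 0 ≤ C' ∧ ∀ y ∈ m.region ∩ tsupport u, ‖h y‖ ≤ C' :=
    ⟨|C|, abs_nonneg _, fun y hy => (hC y hy).trans (le_abs_self _)⟩
  have hdiff : ∀ {g : Cn d → ℂ}, ContDiff ℝ ∞ g → ∀ y, DifferentiableAt ℝ g y :=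
    fun hg y => hg.differentiable (by simp) y
  have hr : ContDiff ℝ ∞ fun y => (m.r j y : ℂ) :=
    Complex.ofRealCLM.contDiff.comp (m.contDiff_r j)
  -- With `r j` replaced by its approximation the test function has compact support in the domain of
  -- holomorphy, so that the integral vanishes exactly for each `ν`. It remains to let `ν` tend to
  -- infinity.
  set g : ℕ → Cn d → ℂ := fun ν y => m.approx j (ν + 1) y * P y with hgdef
  have hg : ∀ ν, ContDiff ℝ ∞ (g ν) := fun ν => (m.contDiff_approx j _).mul hP
  have hgu : ∀ ν, ContDiff ℝ ∞ fun y => g ν y * u y := fun ν => (hg ν).mul hu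
  have hguc : ∀ ν, HasCompactSupport fun y => g ν y * u y := fun ν => huc.mul_left
  have hguO : ∀ ν, tsupport (fun y => g ν y * u y) ⊆ O := fun ν => by
    refine Subset.trans (subset_inter ?_ tsupport_mul_subset_right) huO
    exact (tsupport_mul_subset_left.trans tsupport_mul_subset_left).trans
      (m.tsupport_approx_subset j (by positivity))
  have hzero : ∀ ν, ∫ y, h y * m.Dt j (fun y => g ν y * u y) y = 0 := fun ν =>
    m.integral_mul_Dt hO hh (hgu ν) (hguc ν) (hguO ν) j
  have hint : ∀ ν, Integrable fun y => h y * m.Dt j (fun y => g ν y * u y) y := fun ν =>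
    integrable_of_continuousOn_tsupport hO hh.continuousOn (m.contDiff_Dt j (hgu ν)).continuous
      (m.hasCompactSupport_Dt j (hguc ν)) ((m.tsupport_Dt_subset j _).trans (hguO ν))
  have hform : ∀ ν, ∀ y ∈ m.W, m.Dt j (fun y => g ν y * u y) y =
      m.approx j (ν + 1) y * P y * m.Dt j u y + u y *
        (((deriv cutId ((ν + 1) * m.r j y) : ℝ) : ℂ) * m.cut j (ν + 1) y * P y
          + m.approx j (ν + 1) y * m.L j P y) := fun ν y hy => by
    rw [m.Dt_mul j (hdiff (hg ν) y) (hdiff hu y)]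
    have h1 := m.L_mul (j := j) (hdiff (m.contDiff_approx j (ν + 1)) y) (hdiff hP y)
    rw [m.L_approx j (by positivity) hy] at h1
    simp only [hgdef]
    rw [h1]
    ring
  have hout : ∀ ν, ∀ y ∉ m.region ∩ tsupport u, m.Dt j (fun y => g ν y * u y) y = 0 := by
    intro ν y hy
    refine m.Dt_eq_zero_of_notMem fun h' => hy ⟨?_, tsupport_mul_subset_right h'⟩
    exact m.tsupport_approx_subset j (by positivity)
      (tsupport_mul_subset_left (tsupport_mul_subset_left h'))
  -- A dominating function independent of `ν`: the approximation is bounded by `|r j|` and its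
  -- derivative along `m.L j` by `C₀`.
  set B : Cn d → ℝ := fun y => C * (‖(m.r j y : ℂ)‖ * ‖P y‖ * ‖m.Dt j u y‖ +
    ‖u y‖ * (C₀ * ‖P y‖ + ‖(m.r j y : ℂ)‖ * ‖m.L j P y‖)) with hB
  have hBc : Continuous B := by
    have := hr.continuous
    have := hP.continuous
    have := (m.contDiff_Dt j hu).continuous
    have := (m.contDiff_L j hP).continuous
    have := hu.continuous
    fun_prop
  have hBs : HasCompactSupport B := by
    refine HasCompactSupport.intro huc fun y hy => ?_
    simp [hB, m.Dt_eq_zero_of_notMem hy, image_eq_zero_of_notMem_tsupport hy]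
  have hlim := tendsto_integral_of_dominated_convergence
    (F := fun (ν : ℕ) y => h y * m.Dt j (fun y => g ν y * u y) y)
    (f := m.region.indicator fun y => h y *
      (m.r j y * P y * m.Dt j u y + u y * (P y + m.r j y * m.L j P y))) B
    (fun ν => (hint ν).aestronglyMeasurable) (hBc.integrable_of_hasCompactSupport hBs)
    (fun ν => Eventually.of_forall fun y => ?_) (Eventually.of_forall fun y => ?_)
  · simp only [hzero] at hlim
    rw [← integral_indicator m.isOpen_region.measurableSet]
    exact (tendsto_nhds_unique hlim tendsto_const_nhds)
  · by_cases hy : y ∈ m.region ∩ tsupport u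
    · rw [hform ν y (huW hy.2), norm_mul, hB]
      have hC' := hC y hy
      have h1 := m.norm_approx_le j (ν + 1) y
      rw [← Real.norm_eq_abs, ← Complex.norm_real] at h1
      have h2 : ‖((deriv cutId ((ν + 1) * m.r j y) : ℝ) : ℂ) * m.cut j (ν + 1) y‖ ≤ C₀ := by
        rw [norm_mul, Complex.norm_real, Real.norm_eq_abs]
        calc _ ≤ C₀ * 1 := mul_le_mul (hC₀ _) (m.norm_cut_le j _ y) (norm_nonneg _)
              ((abs_nonneg _).trans (hC₀ 0))
          _ = C₀ := mul_one _
      refine mul_le_mul hC' ?_ (norm_nonneg _) ((norm_nonneg _).trans hC')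
      refine (norm_add_le _ _).trans (add_le_add ?_ ?_)
      · rw [norm_mul, norm_mul]; gcongr
      · rw [norm_mul]
        refine mul_le_mul_of_nonneg_left ((norm_add_le _ _).trans (add_le_add ?_ ?_))
          (norm_nonneg _)
        · rw [norm_mul]; gcongr
        · rw [norm_mul]; gcongr
    · rw [hout ν y hy, mul_zero, norm_zero]
      have : 0 ≤ C₀ := (abs_nonneg _).trans (hC₀ 0)
      positivity
  · by_cases hy : y ∈ m.region
    · rw [indicator_of_mem hy]
      refine tendsto_const_nhds.congr' ?_
      by_cases hy' : y ∈ tsupport u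
      · filter_upwards [m.eventually_approx (j := j) hy] with ν hν
        rw [hform ν y (huW hy'), hν.1, hν.2, one_mul]
      · filter_upwards with ν
        rw [hout ν y fun h' => hy' h'.2, m.Dt_eq_zero_of_notMem hy',
          image_eq_zero_of_notMem_tsupport hy']
        simp
    · rw [indicator_of_notMem hy]
      refine tendsto_const_nhds.congr fun ν => ?_
      rw [hout ν y fun h' => hy h'.1, mul_zero]

end CornerModel

/-! ### Convergence of all derivatives on compact sets. -/

section SmoothConvergence

variable {E F G : Type*} [NormedAddCommGroup E] [NormedSpace ℝ E] [NormedAddCommGroup F]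
  [NormedSpace ℝ F] [NormedAddCommGroup G] [NormedSpace ℝ G]

/-- All derivatives of `u ν` tend to `0`, uniformly on `L`. -/
def SmoothlyTendstoZero (L : Set E) (u : ℕ → E → F) : Prop :=
  ∀ k : ℕ, TendstoUniformlyOn (fun ν => iteratedFDeriv ℝ k (u ν)) 0 atTop L

lemma smoothlyTendstoZero_iff {L : Set E} {u : ℕ → E → F} : SmoothlyTendstoZero L u ↔
    ∀ k : ℕ, ∀ ε > 0, ∀ᶠ ν in atTop, ∀ y ∈ L, ‖iteratedFDeriv ℝ k (u ν) y‖ < ε := by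
  simp [SmoothlyTendstoZero, Metric.tendstoUniformlyOn_iff, dist_zero_left]

/-- The continuity criterion for operators: each derivative of the output is controlled, uniformly
in `ν`, by finitely many derivatives of the input. -/
lemma SmoothlyTendstoZero.of_bound {L : Set E} {u : ℕ → E → F} {v : ℕ → E → G}
    (hu : SmoothlyTendstoZero L u)
    (h : ∀ k, ∃ C : ℝ, ∃ N : ℕ, ∀ ν, ∀ y ∈ L, ‖iteratedFDeriv ℝ k (v ν) y‖ ≤
      C * ∑ i ∈ Finset.range N, ‖iteratedFDeriv ℝ i (u ν) y‖) : SmoothlyTendstoZero L v := by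
  rw [smoothlyTendstoZero_iff] at hu ⊢
  intro k ε hε
  obtain ⟨C, N, hC⟩ := h k
  have h1 : ∀ᶠ ν in atTop, ∀ i ∈ Finset.range N, ∀ y ∈ L,
      ‖iteratedFDeriv ℝ i (u ν) y‖ < ε / ((|C| + 1) * (N + 1)) :=
    -- The added ones in `(|C| + 1) * (N + 1)` keep the quotient meaningful when `C` or `N` is zero
    -- and make the final inequality strict.
    (Finset.eventually_all _).2 fun i _ => hu i _ (by positivity)
  filter_upwards [h1] with ν hν y hy
  calc ‖iteratedFDeriv ℝ k (v ν) y‖ ≤ C * ∑ i ∈ Finset.range N, ‖iteratedFDeriv ℝ i (u ν) y‖ :=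
        hC ν y hy
    _ ≤ |C| * ∑ i ∈ Finset.range N, ‖iteratedFDeriv ℝ i (u ν) y‖ :=
        mul_le_mul_of_nonneg_right (le_abs_self C) (Finset.sum_nonneg fun _ _ => norm_nonneg _)
    _ ≤ |C| * ∑ i ∈ Finset.range N, ε / ((|C| + 1) * (N + 1)) := by
        gcongr with i hi
        exact (hν i hi y hy).le
    _ = ε * ((|C| / (|C| + 1)) * (N / (N + 1))) := by
        rw [Finset.sum_const, Finset.card_range, nsmul_eq_mul]; field_simp
    _ < ε * 1 := by
        refine mul_lt_mul_of_pos_left ?_ hε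
        have h2 : |C| / (|C| + 1) < 1 := by rw [div_lt_one (by positivity)]; linarith
        have h3 : (N : ℝ) / (N + 1) ≤ 1 := by rw [div_le_one (by positivity)]; linarith
        calc _ ≤ |C| / (|C| + 1) * 1 := mul_le_mul_of_nonneg_left h3 (by positivity)
          _ < 1 := by rwa [mul_one]
    _ = ε := mul_one ε

/-- Agreement on an open neighbourhood is required, since values on `L` alone do not determine
derivatives at points of `L`. -/
lemma SmoothlyTendstoZero.congr {L s : Set E} (hs : IsOpen s) (hL : L ⊆ s) {u v : ℕ → E → F}
    (hu : SmoothlyTendstoZero L u) (h : ∀ ν, EqOn (u ν) (v ν) s) : SmoothlyTendstoZero L v := by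
  intro k
  refine (hu k).congr (Eventually.of_forall fun ν y hy => ?_)
  exact (Filter.EventuallyEq.iteratedFDeriv ℝ
    ((h ν).eventuallyEq_of_mem (hs.mem_nhds (hL hy))) k).self_of_nhds

lemma SmoothlyTendstoZero.clm_comp {L s : Set E} (hs : IsOpen s) (hL : L ⊆ s) {u : ℕ → E → F}
    (hu : SmoothlyTendstoZero L u) (hus : ∀ ν, ContDiffOn ℝ ∞ (u ν) s) (A : F →L[ℝ] G) :
    SmoothlyTendstoZero L (fun ν y => A (u ν y)) := by
  refine hu.of_bound fun k => ⟨‖A‖, k + 1, fun ν y hy => ?_⟩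
  have h1 : ContDiffAt ℝ ∞ (u ν) y := (hus ν).contDiffAt (hs.mem_nhds (hL hy))
  refine (A.norm_iteratedFDeriv_comp_left h1 (by exact_mod_cast le_top)).trans ?_
  refine mul_le_mul_of_nonneg_left ?_ (norm_nonneg _)
  exact Finset.single_le_sum (f := fun i => ‖iteratedFDeriv ℝ i (u ν) y‖)
    (fun _ _ => norm_nonneg _) (Finset.mem_range.2 (Nat.lt_succ_self k))

lemma SmoothlyTendstoZero.fderiv {L : Set E} {u : ℕ → E → F} (hu : SmoothlyTendstoZero L u) :
    SmoothlyTendstoZero L (fun ν => fderiv ℝ (u ν)) := by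
  rw [smoothlyTendstoZero_iff] at hu ⊢
  intro k ε hε
  filter_upwards [hu (k + 1) ε hε] with ν hν y hy
  rw [norm_iteratedFDeriv_fderiv]
  exact hν y hy

lemma SmoothlyTendstoZero.add {L : Set E} {u v : ℕ → E → F} (hu : SmoothlyTendstoZero L u)
    (hv : SmoothlyTendstoZero L v) (hus : ∀ ν, ContDiff ℝ ∞ (u ν))
    (hvs : ∀ ν, ContDiff ℝ ∞ (v ν)) : SmoothlyTendstoZero L (fun ν y => u ν y + v ν y) := by
  rw [smoothlyTendstoZero_iff] at *
  intro k ε hε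
  filter_upwards [hu k (ε / 2) (by positivity), hv k (ε / 2) (by positivity)] with ν h1 h2 y hy
  have h3 : ContDiffAt ℝ k (u ν) y := (hus ν).contDiffAt.of_le (by exact_mod_cast le_top)
  have h4 : ContDiffAt ℝ k (v ν) y := (hvs ν).contDiffAt.of_le (by exact_mod_cast le_top)
  rw [fun_iteratedFDeriv_add_apply h3 h4]
  linarith [norm_add_le (iteratedFDeriv ℝ k (u ν) y) (iteratedFDeriv ℝ k (v ν) y), h1 y hy, h2 y hy]

lemma smoothlyTendstoZero_zero (L : Set E) :
    SmoothlyTendstoZero L (fun (_ : ℕ) (_ : E) => (0 : F)) := by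
  rw [smoothlyTendstoZero_iff]
  intro k ε hε
  filter_upwards with ν y _
  have : (fun _ : E => (0 : F)) = 0 := rfl
  rw [this, iteratedFDeriv_zero]
  simpa using hε

lemma SmoothlyTendstoZero.sum {α : Type*} {L : Set E} {u : α → ℕ → E → F} (A : Finset α)
    (hu : ∀ i, SmoothlyTendstoZero L (u i)) (hus : ∀ i ν, ContDiff ℝ ∞ (u i ν)) :
    SmoothlyTendstoZero L (fun ν y => ∑ i ∈ A, u i ν y) := by
  classical
  induction A using Finset.induction_on with
  | empty => simpa using smoothlyTendstoZero_zero L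
  | insert a A ha ih =>
    simp only [Finset.sum_insert ha]
    exact (hu a).add ih (hus a) fun ν => ContDiff.sum fun i _ => hus i ν

/-- Leibniz rule; the derivatives of the fixed factor are bounded on the compact set. -/
lemma SmoothlyTendstoZero.mul {L s : Set E} (hs : IsOpen s) (hL : L ⊆ s) (hLc : IsCompact L)
    {u : ℕ → E → ℂ} (hu : SmoothlyTendstoZero L u) (hus : ∀ ν, ContDiffOn ℝ ∞ (u ν) s)
    {a : E → ℂ} (ha : ContDiffOn ℝ ∞ a s) : SmoothlyTendstoZero L (fun ν y => a y * u ν y) := by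
  refine hu.of_bound fun k => ?_
  have hb : ∀ i : ℕ, ∃ B, ∀ y ∈ L, ‖iteratedFDeriv ℝ i a y‖ ≤ B := fun i => by
    have h1 : ContinuousOn (iteratedFDerivWithin ℝ i a s) s :=
      ha.continuousOn_iteratedFDerivWithin (by exact_mod_cast le_top) hs.uniqueDiffOn
    obtain ⟨B, hB⟩ := hLc.exists_bound_of_continuousOn (h1.mono hL)
    refine ⟨B, fun y hy => ?_⟩
    rw [← iteratedFDerivWithin_of_isOpen i hs (hL hy)]
    exact hB y hy
  choose B hB using hb
  refine ⟨∑ i ∈ Finset.range (k + 1), k.choose i * |B i|, k + 1, fun ν y hy => ?_⟩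
  have h1 := norm_iteratedFDerivWithin_mul_le ha (hus ν) hs.uniqueDiffOn (hL hy) (n := k)
    (by exact_mod_cast le_top)
  simp only [iteratedFDerivWithin_of_isOpen _ hs (hL hy)] at h1
  refine h1.trans ?_
  rw [Finset.sum_mul]
  refine Finset.sum_le_sum fun i hi => ?_
  have h2 : ‖iteratedFDeriv ℝ (k - i) (u ν) y‖ ≤
      ∑ i ∈ Finset.range (k + 1), ‖iteratedFDeriv ℝ i (u ν) y‖ :=
    Finset.single_le_sum (f := fun i => ‖iteratedFDeriv ℝ i (u ν) y‖)
      (fun _ _ => norm_nonneg _) (Finset.mem_range.2 (by omega))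
  have h3 := (hB i y hy).trans (le_abs_self _)
  gcongr

end SmoothConvergence

/-! ### Abstract differential operators with smooth coefficients. -/

variable {d : ℕ}

/-- Linear operators on the smooth functions on `ℂᵈ` with the properties of linear differential
operators with smooth coefficients. -/
structure IsSmoothLocalOperator (Q : (Cn d → ℂ) → Cn d → ℂ) : Prop where
  contDiff : ∀ {u}, ContDiff ℝ ∞ u → ContDiff ℝ ∞ (Q u)
  map_add : ∀ {u v}, ContDiff ℝ ∞ u → ContDiff ℝ ∞ v →
    Q (fun y => u y + v y) = fun y => Q u y + Q v y
  map_const_mul : ∀ (a : ℂ) {u}, ContDiff ℝ ∞ u → Q (fun y => a * u y) = fun y => a * Q u y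
  tsupport_subset : ∀ u, tsupport (Q u) ⊆ tsupport u
  tendsto : ∀ {L}, IsCompact L → ∀ {u : ℕ → Cn d → ℂ}, (∀ ν, ContDiff ℝ ∞ (u ν)) →
    SmoothlyTendstoZero L u → SmoothlyTendstoZero L (fun ν => Q (u ν))

namespace IsSmoothLocalOperator

lemma id : IsSmoothLocalOperator (fun u : Cn d → ℂ => u) :=
  ⟨fun h => h, fun _ _ => rfl, fun _ _ _ => rfl, fun _ => Subset.rfl, fun _ _ _ h => h⟩

lemma comp {Q Q' : (Cn d → ℂ) → Cn d → ℂ} (h : IsSmoothLocalOperator Q)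
    (h' : IsSmoothLocalOperator Q') : IsSmoothLocalOperator fun u => Q (Q' u) where
  contDiff hu := h.contDiff (h'.contDiff hu)
  map_add hu hv := by
    rw [h'.map_add hu hv, h.map_add (h'.contDiff hu) (h'.contDiff hv)]
  map_const_mul a _ hu := by rw [h'.map_const_mul a hu, h.map_const_mul a (h'.contDiff hu)]
  tsupport_subset u := (h.tsupport_subset _).trans (h'.tsupport_subset u)
  tendsto hL _ hu hut := h.tendsto hL (fun ν => h'.contDiff (hu ν)) (h'.tendsto hL hu hut)

lemma const_mul {Q : (Cn d → ℂ) → Cn d → ℂ} (h : IsSmoothLocalOperator Q) (a : ℂ) :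
    IsSmoothLocalOperator fun u y => a * Q u y where
  contDiff hu := contDiff_const.mul (h.contDiff hu)
  map_add hu hv := by
    rw [h.map_add hu hv]; funext y; ring
  map_const_mul b _ hu := by rw [h.map_const_mul b hu]; funext y; ring
  tsupport_subset u := tsupport_mul_subset_right.trans (h.tsupport_subset u)
  tendsto hL _ hu hut := (h.tendsto hL hu hut).mul isOpen_univ (subset_univ _) hL
    (fun ν => (h.contDiff (hu ν)).contDiffOn) contDiffOn_const

end IsSmoothLocalOperator

lemma SmoothlyTendstoZero.dbarDir {L : Set (Cn d)} {u : ℕ → Cn d → ℂ}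
    (hu : SmoothlyTendstoZero L u) (hus : ∀ ν, ContDiff ℝ ∞ (u ν)) (w : Cn d) :
    SmoothlyTendstoZero L (fun ν => dbarDir w (u ν)) := by
  let A : (Cn d →L[ℝ] ℂ) →L[ℝ] ℂ := ContinuousLinearMap.apply ℝ ℂ w +
    Complex.I • ContinuousLinearMap.apply ℝ ℂ (Complex.I • w)
  exact hu.fderiv.clm_comp isOpen_univ (subset_univ _)
    (fun ν => ((hus ν).fderiv_right (by simp)).contDiffOn) A

/-! ### Raising the order of vanishing at the faces. -/

namespace CornerModel

variable {ι : Type*} [Fintype ι] [DecidableEq ι] (m : CornerModel d ι)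

lemma isSmoothLocalOperator_Dt (j : ι) : IsSmoothLocalOperator (m.Dt j) where
  contDiff hu := m.contDiff_Dt j hu
  map_add {u v} hu hv := by
    funext y
    simp only [Dt, mul_add, ← Finset.sum_add_distrib]
    refine Finset.sum_congr rfl fun l _ => dbarDir_add ?_ ?_
    · exact ((m.contDiff_c j l).mul hu).differentiable (by simp) y
    · exact ((m.contDiff_c j l).mul hv).differentiable (by simp) y
  map_const_mul a {u} hu := by
    funext y
    simp only [Dt, Finset.mul_sum]
    refine Finset.sum_congr rfl fun l _ => ?_
    rw [← dbarDir_const_mul a (((m.contDiff_c j l).mul hu).differentiable (by simp) y)]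
    congr 1; funext z; ring
  tsupport_subset := m.tsupport_Dt_subset j
  tendsto hL u hu hut := by
    refine SmoothlyTendstoZero.sum Finset.univ
      (fun l => SmoothlyTendstoZero.dbarDir (hut.mul isOpen_univ (subset_univ _) hL
        (fun ν => (hu ν).contDiffOn) (m.contDiff_c j l).contDiffOn)
        (fun ν => (m.contDiff_c j l).mul (hu ν)) (m.w l))
      fun l ν => contDiff_dbarDir ((m.contDiff_c j l).mul (hu ν))

/-- The functions against which test functions on `m.W` are integrated over `m.region`. -/
structure IsAdmissible (u h : Cn d → ℂ) : Prop where
  exists_isOpen : ∃ O, IsOpen O ∧ DifferentiableOn ℂ h O ∧ m.region ∩ tsupport u ⊆ O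
  exists_bound : ∃ C, ∀ y ∈ m.region ∩ tsupport u, ‖h y‖ ≤ C

variable {m}

lemma IsAdmissible.mono {u v h : Cn d → ℂ} (hh : m.IsAdmissible u h)
    (huv : tsupport v ⊆ tsupport u) : m.IsAdmissible v h := by
  obtain ⟨⟨O, hO, hd, hs⟩, C, hC⟩ := hh
  exact ⟨⟨O, hO, hd, fun y hy => hs ⟨hy.1, huv hy.2⟩⟩, C, fun y hy => hC y ⟨hy.1, huv hy.2⟩⟩

lemma IsAdmissible.integrableOn {u h g : Cn d → ℂ} (hh : m.IsAdmissible u h)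
    (hg : Continuous g) (hgc : HasCompactSupport g) (hgu : tsupport g ⊆ tsupport u) :
    IntegrableOn (fun y => h y * g y) m.region := by
  obtain ⟨⟨O, hO, hd, hs⟩, C, hC⟩ := hh
  rw [← integrable_indicator_iff m.isOpen_region.measurableSet]
  have hm : MeasurableSet (m.region ∩ O) := (m.isOpen_region.inter hO).measurableSet
  have h1 : m.region.indicator (fun y => h y * g y) =
      fun y => (m.region ∩ O).indicator h y * g y := by
    funext y
    by_cases hy : y ∈ m.region
    · by_cases hyO : y ∈ O
      · rw [indicator_of_mem hy, indicator_of_mem (mem_inter hy hyO)]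
      · rw [indicator_of_mem hy, image_eq_zero_of_notMem_tsupport fun h' => hyO (hs ⟨hy, hgu h'⟩)]
        simp
    · rw [indicator_of_notMem hy, indicator_of_notMem fun h' => hy h'.1, zero_mul]
  rw [h1]
  refine integrable_of_bounded_on_tsupport (C := |C|) ?_ hg hgc fun y hy => ?_
  · exact (aestronglyMeasurable_indicator_iff hm).2
      ((hd.continuousOn.mono inter_subset_right).aestronglyMeasurable hm)
  · by_cases hy' : y ∈ m.region ∩ O
    · rw [indicator_of_mem hy']
      exact (hC y ⟨hy'.1, hgu hy⟩).trans (le_abs_self _)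
    · rw [indicator_of_notMem hy', norm_zero]; exact abs_nonneg _

variable (m)

/-- A power of `m.r j` can be raised at the cost of a differential operator. -/
lemma integral_raise_power {h u R : Cn d → ℂ} (hu : ContDiff ℝ ∞ u) (huc : HasCompactSupport u)
    (huW : tsupport u ⊆ m.W) (hh : m.IsAdmissible u h) (hR : ContDiff ℝ ∞ R) (j : ι)
    (hLR : ∀ y ∈ m.W, m.L j R y = 0) (k : ℕ) :
    ∫ y in m.region, h y * (R y * m.r j y ^ k * u y) =
      ∫ y in m.region, h y * (R y * m.r j y ^ (k + 1) * (-((k : ℂ) + 1)⁻¹ * m.Dt j u y)) := by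
  have hr : ContDiff ℝ ∞ fun y => (m.r j y : ℂ) :=
    Complex.ofRealCLM.contDiff.comp (m.contDiff_r j)
  have hrk : ContDiff ℝ ∞ fun y => (m.r j y : ℂ) ^ k := hr.pow k
  have hP : ContDiff ℝ ∞ fun y => R y * (m.r j y : ℂ) ^ k := hR.mul hrk
  obtain ⟨⟨O, hO, hd, hs⟩, C, hC⟩ := id hh
  have h0 := m.integral_region_eq_zero hO hd hu huc huW hs hC hP j
  -- Euler's identity: `r j` times `m.L j` multiplies `R * r j ^ k` by `k`, as `R` is annihilated.
  -- Together with the undifferentiated term this gives the factor `k + 1`.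
  have hLP : ∀ y ∈ m.W, m.r j y * m.L j (fun y => R y * (m.r j y : ℂ) ^ k) y =
      k * (R y * (m.r j y : ℂ) ^ k) := by
    intro y hy
    rw [m.L_mul (hR.differentiable (by simp) y) (hrk.differentiable (by simp) y), hLR y hy]
    have h1 := m.L_real_comp (j := j) (i := j) (k := fun t => t ^ k) (by fun_prop) hy
    simp only [Complex.ofReal_pow, if_true, deriv_pow_field] at h1
    rw [h1]
    -- The exponent `k - 1` of the derivative is a truncated difference, whence the separate case `k
    -- = 0`.
    rcases k with _ | k
    · simp
    · push_cast; simp; ring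
  have e1 : ∀ y, h y * (m.r j y * (R y * (m.r j y : ℂ) ^ k) * m.Dt j u y + u y *
      (R y * (m.r j y : ℂ) ^ k + m.r j y * m.L j (fun y => R y * (m.r j y : ℂ) ^ k) y)) =
      h y * (R y * (m.r j y : ℂ) ^ (k + 1) * m.Dt j u y) +
        (k + 1) * (h y * (R y * (m.r j y : ℂ) ^ k * u y)) := by
    intro y
    by_cases hy : y ∈ tsupport u
    · rw [hLP y (huW hy)]; ring
    · rw [m.Dt_eq_zero_of_notMem hy, image_eq_zero_of_notMem_tsupport hy]; ring
  have i1 : IntegrableOn (fun y => h y * (R y * (m.r j y : ℂ) ^ (k + 1) * m.Dt j u y)) m.region :=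
    hh.integrableOn ((hR.mul (hr.pow (k + 1))).mul (m.contDiff_Dt j hu)).continuous
      (m.hasCompactSupport_Dt j huc).mul_left
      (tsupport_mul_subset_right.trans (m.tsupport_Dt_subset j u))
  have i2 : IntegrableOn (fun y => h y * (R y * (m.r j y : ℂ) ^ k * u y)) m.region :=
    hh.integrableOn (hP.mul hu).continuous huc.mul_left tsupport_mul_subset_right
  simp_rw [e1] at h0
  rw [integral_add i1 (i2.const_mul _), integral_const_mul] at h0
  have hk : (k : ℂ) + 1 ≠ 0 := by exact_mod_cast k.succ_ne_zero
  have e2 : ∀ y, h y * (R y * (m.r j y : ℂ) ^ (k + 1) * (-((k : ℂ) + 1)⁻¹ * m.Dt j u y)) =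
      -((k : ℂ) + 1)⁻¹ * (h y * (R y * (m.r j y : ℂ) ^ (k + 1) * m.Dt j u y)) := fun y => by ring
  simp_rw [e2]
  rw [integral_const_mul]
  have e3 : ∀ {A B a : ℂ}, a ≠ 0 → A + a * B = 0 → B = -a⁻¹ * A := fun {A B a} ha h => by
    field_simp; linear_combination h
  exact e3 hk h0

/-- The faces are treated one at a time. The powers already gained for `A` are annihilated by `m.L
j` for `j ∉ A`, so they can play the role of `R` in `integral_raise_power`. The operators do not
enlarge supports, so `h` stays admissible throughout. -/
lemma exists_operator_aux (K : ℕ) (A : Finset ι) :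
    ∃ Q, IsSmoothLocalOperator Q ∧ ∀ u h : Cn d → ℂ, ContDiff ℝ ∞ u → HasCompactSupport u →
      tsupport u ⊆ m.W → m.IsAdmissible u h →
      ∫ y in m.region, h y * u y =
        ∫ y in m.region, h y * ((∏ i ∈ A, (m.r i y : ℂ) ^ K) * Q u y) := by
  induction A using Finset.induction_on with
  | empty => exact ⟨_, IsSmoothLocalOperator.id, fun u h _ _ _ _ => by simp⟩
  | insert j A hj ih =>
    obtain ⟨Q, hQ, hQi⟩ := ih
    have hsm : ∀ i, ContDiff ℝ ∞ fun y => (m.r i y : ℂ) ^ K := fun i =>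
      (Complex.ofRealCLM.contDiff.comp (m.contDiff_r i)).pow K
    have hR : ContDiff ℝ ∞ fun y => ∏ i ∈ A, (m.r i y : ℂ) ^ K := contDiff_prod fun i _ => hsm i
    have hLR : ∀ y ∈ m.W, m.L j (fun y => ∏ i ∈ A, (m.r i y : ℂ) ^ K) y = 0 := by
      intro y hy
      refine m.L_prod_eq_zero A (fun i _ => (hsm i).differentiable (by simp) y) fun i hi => ?_
      have h1 := m.L_real_comp (j := j) (i := i) (k := fun t => t ^ K) (by fun_prop) hy
      simp only [Complex.ofReal_pow] at h1
      rw [h1, if_neg]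
      rintro rfl
      exact hj hi
    -- For the new face the exponent is raised by one at a time, composing one first-order operator
    -- per step.
    have key : ∀ k : ℕ, ∃ Q', IsSmoothLocalOperator Q' ∧ ∀ u h : Cn d → ℂ, ContDiff ℝ ∞ u →
        HasCompactSupport u → tsupport u ⊆ m.W → m.IsAdmissible u h →
        ∫ y in m.region, h y * u y = ∫ y in m.region,
          h y * ((∏ i ∈ A, (m.r i y : ℂ) ^ K) * (m.r j y : ℂ) ^ k * Q' u y) := by
      intro k
      induction k with
      | zero =>
        refine ⟨Q, hQ, fun u h hu huc huW hh => ?_⟩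
        simpa using hQi u h hu huc huW hh
      | succ k ihk =>
        obtain ⟨Q', hQ', hi'⟩ := ihk
        refine ⟨_, ((m.isSmoothLocalOperator_Dt j).const_mul (-((k : ℂ) + 1)⁻¹)).comp hQ',
          fun u h hu huc huW hh => ?_⟩
        have hs := hQ'.tsupport_subset u
        rw [hi' u h hu huc huW hh]
        exact m.integral_raise_power (hQ'.contDiff hu)
          (huc.mono' ((subset_tsupport _).trans hs)) (hs.trans huW) (hh.mono hs) hR j hLR k
    obtain ⟨Q', hQ', hi'⟩ := key K
    refine ⟨Q', hQ', fun u h hu huc huW hh => ?_⟩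
    rw [hi' u h hu huc huW hh]
    simp only [Finset.prod_insert hj, mul_comm ((m.r j _ : ℂ) ^ K)]

/-- A variant of Bell's operator: an integral against an admissible holomorphic function
is not changed if the test function is replaced by one that vanishes to order `K` on each face. -/
lemma exists_operator (K : ℕ) :
    ∃ Q, IsSmoothLocalOperator Q ∧ ∀ u h : Cn d → ℂ, ContDiff ℝ ∞ u → HasCompactSupport u →
      tsupport u ⊆ m.W → m.IsAdmissible u h →
      ∫ y in m.region, h y * u y =
        ∫ y in m.region, h y * ((∏ i, (m.r i y : ℂ) ^ K) * Q u y) :=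
  m.exists_operator_aux K Finset.univ

end CornerModel

/-! ### Real calculus of defining functions. -/

section Flat

variable {E F : Type*} [NormedAddCommGroup E] [NormedSpace ℝ E] [NormedAddCommGroup F]
  [NormedSpace ℝ F]

/-- A function that is smooth near a point has the same germ as a globally smooth function. -/
lemma exists_contDiff_eventuallyEq [FiniteDimensional ℝ E] {g : E → F} {s : Set E} {p : E}
    (hs : IsOpen s) (hp : p ∈ s) (hg : ContDiffOn ℝ ∞ g s) :
    ∃ G : E → F, ContDiff ℝ ∞ G ∧ G =ᶠ[𝓝 p] g := by
  obtain ⟨ε, hε, hεs⟩ := Metric.nhds_basis_closedBall.mem_iff.1 (hs.mem_nhds hp)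
  let b : ContDiffBump p := ⟨ε / 2, ε, by positivity, by linarith⟩
  refine ⟨fun y => b y • g y, contDiff_iff_contDiffAt.2 fun y => ?_, ?_⟩
  · by_cases hy : y ∈ s
    · exact b.contDiff.contDiffAt.smul (hg.contDiffAt (hs.mem_nhds hy))
    · have h1 : y ∉ tsupport b := by rw [b.tsupport_eq]; exact fun h => hy (hεs h)
      refine (contDiffAt_const (c := (0 : F))).congr_of_eventuallyEq ?_
      filter_upwards [notMem_tsupport_iff_eventuallyEq.1 h1] with z hz
      simp [hz]
  · filter_upwards [b.eventuallyEq_one] with z hz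
    simp [hz]

/-- Where `r y₀ < 0`, continuity suffices. Where `r y₀ = 0`, strict differentiability gives `r (q -
ε v) ≤ r q - ε dr(v) / 2`, and `r q ≤ r q / 2` since `r q ≤ 0`. Strictness makes the estimate
uniform in the base point `q`. -/
lemma eventually_le_half_of_outward {r : E → ℝ} {y₀ v : E} (hr : ContDiffAt ℝ ∞ r y₀)
    (h0 : r y₀ ≤ 0) (hv : r y₀ = 0 → 0 < fderiv ℝ r y₀ v) :
    ∀ᶠ q : E × ℝ in 𝓝 y₀ ×ˢ 𝓝[>] 0, r q.1 ≤ 0 →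
      r (q.1 - q.2 • v) < 0 ∧ r (q.1 - q.2 • v) ≤ r q.1 / 2 := by
  have ht1 : Tendsto (fun q : E × ℝ => q.1) (𝓝 y₀ ×ˢ 𝓝[>] 0) (𝓝 y₀) := tendsto_fst
  have ht2 : Tendsto (fun q : E × ℝ => q.2) (𝓝 y₀ ×ˢ 𝓝[>] 0) (𝓝 0) :=
    tendsto_snd.mono_right nhdsWithin_le_nhds
  have ht3 : Tendsto (fun q : E × ℝ => q.1 - q.2 • v) (𝓝 y₀ ×ˢ 𝓝[>] 0) (𝓝 y₀) := by
    simpa using ht1.sub (ht2.smul_const v)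
  rcases h0.lt_or_eq with h | h
  · have e1 : ∀ᶠ q : E × ℝ in 𝓝 y₀ ×ˢ 𝓝[>] 0, r (q.1 - q.2 • v) < 3 / 4 * r y₀ :=
      (hr.continuousAt.tendsto.comp ht3).eventually_lt_const (by linarith)
    have e2 : ∀ᶠ q : E × ℝ in 𝓝 y₀ ×ˢ 𝓝[>] 0, 3 / 2 * r y₀ < r q.1 :=
      (hr.continuousAt.tendsto.comp ht1).eventually_const_lt (by linarith)
    filter_upwards [e1, e2] with q h1 h2 _
    constructor <;> linarith
  · have hpos := hv h
    have hs := (hr.hasStrictFDerivAt (by simp)).isLittleO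
    -- Chosen so that the linearization error along `v` is at most half of the linear term.
    have hc : 0 < fderiv ℝ r y₀ v / (2 * (‖v‖ + 1)) := by positivity
    have hb := (hs.def hc)
    have e1 := (ht3.prodMk_nhds ht1).eventually hb
    have e2 : ∀ᶠ q : E × ℝ in 𝓝 y₀ ×ˢ 𝓝[>] 0, 0 < q.2 :=
      tendsto_snd.eventually (eventually_mem_nhdsWithin (a := (0 : ℝ)) (s := Ioi 0))
    filter_upwards [e1, e2] with q h1 h2 h3
    have h4 : q.1 - q.2 • v - q.1 = -(q.2 • v) := by abel
    simp only [h4, map_neg, map_smul, smul_eq_mul, norm_neg, norm_smul, Real.norm_eq_abs,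
      abs_of_pos h2] at h1
    have h5 := (le_abs_self _).trans h1
    have h6 : fderiv ℝ r y₀ v / (2 * (‖v‖ + 1)) * (q.2 * ‖v‖) ≤ q.2 * fderiv ℝ r y₀ v / 2 := by
      rw [div_mul_eq_mul_div, div_le_div_iff₀ (by positivity) (by positivity)]
      nlinarith [mul_pos h2 hpos, norm_nonneg v]
    have h7 : 0 < q.2 * fderiv ℝ r y₀ v := mul_pos h2 hpos
    constructor <;> linarith

lemma eventually_neg_of_fderiv_neg {r : E → ℝ} {y w : E} (hr : DifferentiableAt ℝ r y)
    (h0 : r y = 0) (hw : fderiv ℝ r y w < 0) : ∀ᶠ t : ℝ in 𝓝[>] 0, r (y + t • w) < 0 := by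
  have h1 := (hr.hasFDerivAt.hasLineDerivAt w).tendsto_slope_zero_right
  filter_upwards [h1.eventually_lt_const hw, eventually_mem_nhdsWithin] with t ht htp
  rw [h0, sub_zero, smul_eq_mul] at ht
  by_contra h
  exact absurd ht (not_lt.2 (mul_nonneg (inv_nonneg.2 (le_of_lt htp)) (not_lt.1 h)))

/-- Two defining functions of the same set have positively proportional derivatives. -/
lemma fderiv_pos_of_same_sign {r r' : E → ℝ} {y v : E} (hr : DifferentiableAt ℝ r y)
    (hr' : DifferentiableAt ℝ r' y) (h0 : r y = 0) (h0' : r' y = 0)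
    (hrr : ∀ᶠ z in 𝓝 y, r z < 0 ↔ r' z < 0) (hne : fderiv ℝ r y ≠ 0)
    (hv : 0 < fderiv ℝ r' y v) : 0 < fderiv ℝ r y v := by
  -- A direction in which `r'` decreases enters the common set, hence `r` cannot increase along it
  -- to first order.
  have key : ∀ w, fderiv ℝ r' y w < 0 → fderiv ℝ r y w ≤ 0 := by
    intro w hw
    have h1 := (hr.hasFDerivAt.hasLineDerivAt w).tendsto_slope_zero_right
    refine le_of_tendsto h1 ?_
    have ht : Tendsto (fun t : ℝ => y + t • w) (𝓝[>] 0) (𝓝 y) := by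
      have h2 : Continuous fun t : ℝ => y + t • w := by fun_prop
      simpa using (h2.tendsto 0).mono_left nhdsWithin_le_nhds
    filter_upwards [eventually_neg_of_fderiv_neg hr' h0' hw, ht.eventually hrr,
      eventually_mem_nhdsWithin] with t h2 h3 h4
    rw [h0, sub_zero, smul_eq_mul]
    exact mul_nonpos_of_nonneg_of_nonpos (inv_nonneg.2 (le_of_lt h4)) (h3.2 h2).le
  obtain ⟨w, hw⟩ : ∃ w, 0 < fderiv ℝ r y w := by
    by_contra! hcon
    refine hne (ContinuousLinearMap.ext fun w => le_antisymm (hcon w) ?_)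
    have := hcon (-w)
    rw [map_neg] at this
    simpa using this
  -- For small `δ` the direction `-v + δ • w` still decreases `r'`; then `key` bounds `dr(v)` below
  -- by `δ dr(w) > 0`, which gives the strict sign.
  obtain ⟨δ, hδ, hδw⟩ : ∃ δ > 0, δ * fderiv ℝ r' y w < fderiv ℝ r' y v := by
    refine ⟨fderiv ℝ r' y v / (2 * (|fderiv ℝ r' y w| + 1)), by positivity, ?_⟩
    calc _ ≤ fderiv ℝ r' y v / (2 * (|fderiv ℝ r' y w| + 1)) * (|fderiv ℝ r' y w| + 1) := by
          gcongr; linarith [le_abs_self (fderiv ℝ r' y w)]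
      _ = fderiv ℝ r' y v / 2 := by field_simp
      _ < _ := by linarith
  have h1 := key (-v + δ • w) (by simp; linarith)
  simp only [map_add, map_neg, map_smul, smul_eq_mul] at h1
  have := mul_pos hδ hw
  linarith

/-- Near a zero choose `v` with `dr(v) ≠ 0`. No two nearby zeros differ by a nonzero multiple of
`v`, so the local zero set has infinitely many disjoint translates by a bounded sequence of vectors.
This forces measure zero. -/
lemma volume_zeroSet_eq_zero [MeasurableSpace E] [BorelSpace E] [FiniteDimensional ℝ E]
    (μ : Measure E) [μ.IsAddHaarMeasure] {r : E → ℝ} (hr : ContDiff ℝ ∞ r) {s : Set E}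
    (hs : ∀ y ∈ s, r y = 0 → fderiv ℝ r y ≠ 0) : μ {y ∈ s | r y = 0} = 0 := by
  refine measure_null_of_locally_null _ fun y hy => ?_
  obtain ⟨v, hv⟩ : ∃ v, fderiv ℝ r y v ≠ 0 := by
    by_contra! hcon
    exact hs y hy.1 hy.2 (ContinuousLinearMap.ext hcon)
  have hst := (hr.contDiffAt.hasStrictFDerivAt (x := y) (by simp)).isLittleO
  have hc : 0 < |fderiv ℝ r y v| / (2 * (‖v‖ + 1)) := by positivity
  have hb := hst.def hc
  rw [nhds_prod_eq, eventually_prod_self_iff'] at hb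
  obtain ⟨U, hU, hb⟩ := hb
  obtain ⟨V, hVU, hVo, hyV⟩ := mem_nhds_iff.1 (eventually_iff.1 hU)
  refine ⟨V ∩ {z | r z = 0}, mem_nhdsWithin.2 ⟨V, hVo, hyV, fun z hz => ⟨hz.1, hz.2.2⟩⟩, ?_⟩
  refine Measure.addHaar_eq_zero_of_disjoint_translates μ (fun k : ℕ => (1 / ((k : ℝ) + 1)) • v)
    ?_ ?_ (hVo.measurableSet.inter
      (isClosed_eq hr.continuous continuous_const).measurableSet)
  · refine (Metric.isBounded_closedBall (x := (0 : E)) (r := ‖v‖)).subset ?_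
    rintro _ ⟨k, rfl⟩
    have h1 : (1 / ((k : ℝ) + 1)) ≤ 1 := by
      rw [div_le_one (by positivity)]; linarith [(Nat.cast_nonneg k : (0 : ℝ) ≤ k)]
    simp only [Metric.mem_closedBall, dist_zero_right, norm_smul]
    rw [Real.norm_of_nonneg (by positivity)]
    exact mul_le_of_le_one_left (norm_nonneg v) h1
  · intro k l hkl
    refine disjoint_left.2 ?_
    rintro x ⟨a, rfl, b, ⟨hbV, hb0⟩, rfl⟩ ⟨a', rfl, b', ⟨hbV', hb0'⟩, he⟩
    -- A common point of two translates gives zeros `b`, `b'` that differ by a nonzero multiple of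
    -- `v`, contrary to strict differentiability.
    have he' : b' - b = (1 / ((k : ℝ) + 1) - 1 / ((l : ℝ) + 1)) • v := by
      rw [sub_smul]; simp only at he; rw [sub_eq_sub_iff_add_eq_add, add_comm, he]
    have h1 := hb (x := b') (hVU hbV') (y := b) (hVU hbV)
    have hb0 : r b = 0 := hb0
    have hb0' : r b' = 0 := hb0'
    have hne : 0 < |1 / ((k : ℝ) + 1) - 1 / ((l : ℝ) + 1)| := by
      refine abs_pos.2 (sub_ne_zero.2 fun h => hkl ?_)
      rw [div_eq_div_iff (by positivity) (by positivity)] at h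
      have : (k : ℝ) = l := by linarith
      exact_mod_cast this
    simp only [he', hb0, hb0', map_smul, norm_smul, smul_eq_mul, sub_self, zero_sub, norm_neg,
      norm_mul, Real.norm_eq_abs] at h1
    have hA : 0 < |fderiv ℝ r y v| := abs_pos.2 hv
    have h2 : |fderiv ℝ r y v| / (2 * (‖v‖ + 1)) *
        (|1 / ((k : ℝ) + 1) - 1 / ((l : ℝ) + 1)| * ‖v‖) <
        |1 / ((k : ℝ) + 1) - 1 / ((l : ℝ) + 1)| * |fderiv ℝ r y v| := by
      rw [div_mul_eq_mul_div, div_lt_iff₀ (by positivity)]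
      nlinarith [mul_pos hne hA, norm_nonneg v]
    exact absurd h1 (not_le.2 h2)

end Flat

/-! ### Genericity as linear algebra, and construction of corner models. -/

section ComplexLinearAlgebra

variable {d : ℕ}

/-- The largest complex subspace of the kernel of a real functional. -/
def complexKernel (A : Cn d →L[ℝ] ℝ) : Submodule ℂ (Cn d) where
  carrier := {w | ∀ c : ℂ, A (c • w) = 0}
  zero_mem' := fun c => by simp
  add_mem' := fun {a b} ha hb c => by rw [smul_add, map_add, ha c, hb c, add_zero]
  smul_mem' := fun a w hw c => by rw [smul_smul]; exact hw (c * a)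

/-- The complex functional whose real part is a given real functional. -/
def complexify (A : Cn d →L[ℝ] ℝ) : Cn d →ₗ[ℂ] ℂ where
  toFun w := A w - Complex.I * A (Complex.I • w)
  map_add' a b := by simp; ring
  map_smul' c w := by
    have h1 : c • w = c.re • w + c.im • (Complex.I • w) := by
      ext i; simp [Complex.ext_iff, sub_eq_add_neg]
    have h2 : Complex.I • c • w = c.re • (Complex.I • w) - c.im • w := by
      ext i; simp [Complex.ext_iff]; ring
    rw [h2, h1]
    simp only [map_add, map_sub, map_smul, smul_eq_mul, RingHom.id_apply]
    apply Complex.ext <;> simp <;> ring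

lemma complexify_re (A : Cn d →L[ℝ] ℝ) (w : Cn d) : (complexify A w).re = A w := by
  simp [complexify]

lemma complexify_im (A : Cn d →L[ℝ] ℝ) (w : Cn d) :
    (complexify A w).im = -A (Complex.I • w) := by
  simp [complexify]

lemma complexify_eq_zero_iff (A : Cn d →L[ℝ] ℝ) (w : Cn d) :
    complexify A w = 0 ↔ w ∈ complexKernel A := by
  constructor
  · intro h c
    have h3 : complexify A (c • w) = 0 := by rw [map_smul, h, smul_zero]
    rw [← complexify_re, h3, Complex.zero_re]
  · intro h
    apply Complex.ext
    · rw [complexify_re]; simpa using h 1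
    · rw [complexify_im]; simp [h Complex.I]

/-- The intersection is the kernel of the complex linear map whose components are the complexified
functionals. The dimension count makes this map surjective, and the `w l` are preimages of the
standard basis vectors; real and imaginary parts give the two conditions. -/
lemma exists_dual_vectors {ι : Type*} [Fintype ι] [DecidableEq ι] (A : ι → Cn d →L[ℝ] ℝ)
    (h : Module.finrank ℂ (⨅ i, complexKernel (A i) : Submodule ℂ (Cn d)) + Fintype.card ι = d) :
    ∃ w : ι → Cn d, ∀ i l, A i (w l) = (if i = l then 1 else 0) ∧
      A i (Complex.I • w l) = 0 := by
  let T : Cn d →ₗ[ℂ] (ι → ℂ) := LinearMap.pi fun i => complexify (A i)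
  have hk : LinearMap.ker T = ⨅ i, complexKernel (A i) := by
    rw [LinearMap.ker_pi]
    congr 1; funext i; ext w
    rw [LinearMap.mem_ker, complexify_eq_zero_iff]
  have h1 := LinearMap.finrank_range_add_finrank_ker T
  rw [hk, Module.finrank_fin_fun] at h1
  have h2 : LinearMap.range T = ⊤ := by
    apply Submodule.eq_top_of_finrank_eq
    rw [Module.finrank_fintype_fun_eq_card]; omega
  have h3 : ∀ l, ∃ w, T w = Pi.single l 1 := fun l => LinearMap.range_eq_top.1 h2 _
  choose w hw using h3
  refine ⟨w, fun i l => ?_⟩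
  have h4 : complexify (A i) (w l) = if i = l then 1 else 0 := by
    have := congrFun (hw l) i
    rw [Pi.single_apply] at this
    exact this
  have hre := complexify_re (A i) (w l)
  have him := complexify_im (A i) (w l)
  rw [h4] at hre him
  constructor
  · rw [← hre]; split_ifs <;> simp
  · have : A i (Complex.I • w l) = -(if i = l then (1 : ℂ) else 0).im := by rw [him, neg_neg]
    rw [this]; split_ifs <;> simp

lemma dbarDir_ofReal {w : Cn d} {r : Cn d → ℝ} {y : Cn d} (hr : DifferentiableAt ℝ r y) :
    dbarDir w (fun z => (r z : ℂ)) y =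
      fderiv ℝ r y w + Complex.I * fderiv ℝ r y (Complex.I • w) := by
  have h1 : HasFDerivAt (fun z => (r z : ℂ)) (Complex.ofRealCLM.comp (fderiv ℝ r y)) y :=
    Complex.ofRealCLM.hasFDerivAt.comp y hr.hasFDerivAt
  simp [dbarDir, h1.fderiv]

lemma contDiffOn_matrix_det {ι : Type*} [Fintype ι] [DecidableEq ι]
    {A : Cn d → Matrix ι ι ℂ} (hA : ∀ i j, ContDiff ℝ ∞ fun y => A y i j) :
    ContDiff ℝ ∞ fun y => (A y).det := by
  simp only [Matrix.det_apply]
  exact ContDiff.sum fun σ _ => (contDiff_prod fun i _ => hA _ _).const_smul _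

/-- Cramer's rule: the inverse is the adjugate divided by the determinant. -/
lemma contDiffOn_matrix_inv {ι : Type*} [Fintype ι] [DecidableEq ι]
    {A : Cn d → Matrix ι ι ℂ} (hA : ∀ i j, ContDiff ℝ ∞ fun y => A y i j) (i j : ι) :
    ContDiffOn ℝ ∞ (fun y => (A y)⁻¹ i j) {y | (A y).det ≠ 0} := by
  have h1 : (fun y => (A y)⁻¹ i j) = fun y => ((A y).det)⁻¹ * (A y).adjugate i j := by
    funext y; rw [Matrix.inv_def, Ring.inverse_eq_inv']; rfl
  rw [h1]
  refine ContDiffOn.mul ((contDiffOn_matrix_det hA).contDiffOn.inv fun y hy => hy) ?_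
  simp only [Matrix.adjugate_apply]
  refine (contDiffOn_matrix_det fun k l => ?_).contDiffOn
  by_cases hk : k = j
  · subst hk; simp only [Matrix.updateRow_self]; exact contDiff_const
  · simp only [Matrix.updateRow_ne hk]; exact hA k l

/-- A corner model with given faces exists near a point where the faces are generic. -/
lemma exists_cornerModel {ι : Type*} [Fintype ι] [DecidableEq ι] {ρ : ι → Cn d → ℝ} {p : Cn d}
    {s : Set (Cn d)} (hs : IsOpen s) (hp : p ∈ s) (hρ : ∀ i, ContDiffOn ℝ ∞ (ρ i) s)
    {w : ι → Cn d} (hw : ∀ i l, fderiv ℝ (ρ i) p (w l) = (if i = l then 1 else 0) ∧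
      fderiv ℝ (ρ i) p (Complex.I • w l) = 0) :
    ∃ m : CornerModel d ι, p ∈ m.W ∧ m.W ⊆ s ∧ ∀ i, EqOn (m.r i) (ρ i) m.W := by
  choose r hr hrρ using fun i => exists_contDiff_eventuallyEq hs hp (hρ i)
  -- This matrix is the identity at `p`, hence invertible nearby. The fields dual to the `r i` have
  -- as coefficients the entries of the transposed inverse.
  let A : Cn d → Matrix ι ι ℂ := fun y => Matrix.of fun i l =>
    dbarDir (w l) (fun z => (r i z : ℂ)) y
  have hA : ∀ i j, ContDiff ℝ ∞ fun y => A y i j := fun i j =>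
    contDiff_dbarDir (Complex.ofRealCLM.contDiff.comp (hr i))
  have hAp : A p = 1 := by
    ext i l
    have h1 := hw i l
    rw [← (hrρ i).fderiv_eq] at h1
    simp only [A, Matrix.of_apply]
    rw [dbarDir_ofReal ((hr i).differentiable (by simp) p), h1.1, h1.2, Matrix.one_apply]
    split_ifs <;> simp
  have ho : IsOpen {y | (A y).det ≠ 0} :=
    isOpen_ne_fun (contDiffOn_matrix_det hA).continuous continuous_const
  have hpo : p ∈ {y | (A y).det ≠ 0} := by simp [hAp]
  -- The inverse is smooth only where the determinant does not vanish, whereas a corner model has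
  -- globally smooth coefficients. Only the germ at `p` matters.
  choose c hc hcA using fun j l => exists_contDiff_eventuallyEq ho hpo
    (contDiffOn_matrix_inv hA l j)
  have hev : ∀ᶠ y in 𝓝 p, y ∈ s ∧ y ∈ {y | (A y).det ≠ 0} ∧ (∀ i, r i y = ρ i y) ∧
      ∀ j l, c j l y = (A y)⁻¹ l j :=
    (hs.eventually_mem hp).and ((ho.eventually_mem hpo).and ((eventually_all.2 hrρ).and
      (eventually_all.2 fun j => eventually_all.2 fun l => hcA j l)))
  obtain ⟨W, hWs, hWo, hpW⟩ := mem_nhds_iff.1 hev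
  refine ⟨⟨r, w, c, W, hWo, hr, hc, fun y hy j i => ?_⟩, hpW, fun y hy => (hWs hy).1,
    fun i y hy => (hWs hy).2.2.1 i⟩
  obtain ⟨-, hdet, -, hcy⟩ := hWs hy
  have h1 : A y * (A y)⁻¹ = 1 := Matrix.mul_nonsing_inv _ (isUnit_iff_ne_zero.2 hdet)
  have h2 := congrFun (congrFun h1 i) j
  rw [Matrix.mul_apply, Matrix.one_apply] at h2
  rw [← h2]
  exact Finset.sum_congr rfl fun l _ => by rw [hcy, mul_comm]; rfl

namespace CornerModel

variable {ι : Type*} [Fintype ι] [DecidableEq ι] (m : CornerModel d ι)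

/-- Otherwise the duality relation `L_j r_j = 1` would fail. -/
lemma fderiv_r_ne_zero {y : Cn d} (hy : y ∈ m.W) (j : ι) : fderiv ℝ (m.r j) y ≠ 0 := by
  intro h
  have h1 := m.dual y hy j j
  simp only [dbarDir_ofReal ((m.contDiff_r j).differentiable (by simp) y), h] at h1
  simp at h1

lemma volume_face_eq_zero (j : ι) : volume {y ∈ m.W | m.r j y = 0} = 0 :=
  volume_zeroSet_eq_zero volume (m.contDiff_r j) fun _ hy _ => m.fderiv_r_ne_zero hy j

end CornerModel

end ComplexLinearAlgebra

/-! ### Change of holomorphic charts. -/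

section Charts

variable {d : ℕ} {M : Type*} [TopologicalSpace M] [ChartedSpace (Cn d) M]

lemma differentiableOn_transition {e e' : OpenPartialHomeomorph M (Cn d)}
    (he : e ∈ holoCharts d M) (he' : e' ∈ holoCharts d M) :
    DifferentiableOn ℂ (e' ∘ e.symm) (e.symm.trans e').source := by
  have h := StructureGroupoid.compatible_of_mem_maximalAtlas he he'
  have h1 := (mem_groupoid_of_pregroupoid.1 h).1
  have h2 : ContDiffOn ℂ ω (e' ∘ e.symm) (e.symm.trans e').source := by
    simpa [contDiffPregroupoid] using h1
  exact h2.differentiableOn (by simp)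

lemma mem_transition_source {e e' : OpenPartialHomeomorph M (Cn d)} {y : Cn d} :
    y ∈ (e.symm.trans e').source ↔ y ∈ e.target ∧ e.symm y ∈ e'.source := by
  simp

lemma real_compatible {e e' : OpenPartialHomeomorph M (Cn d)}
    (he : e ∈ holoCharts d M) (he' : e' ∈ holoCharts d M) :
    e.symm.trans e' ∈ contDiffGroupoid ∞ 𝓘(ℝ, Cn d) := by
  have h1 := contDiffOn_transition he he'
  have h2 := contDiffOn_transition he' he
  rw [contDiffGroupoid, mem_groupoid_of_pregroupoid]
  constructor
  · simpa [contDiffPregroupoid] using h1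
  · simpa [contDiffPregroupoid] using h2

lemma isManifold_real [IsManifold 𝓘(ℂ, Cn d) ω M] : IsManifold 𝓘(ℝ, Cn d) ∞ M where
  compatible he he' := real_compatible (IsManifold.subset_maximalAtlas he)
    (IsManifold.subset_maximalAtlas he')

lemma mem_real_maximalAtlas [IsManifold 𝓘(ℂ, Cn d) ω M] {e : OpenPartialHomeomorph M (Cn d)}
    (he : e ∈ holoCharts d M) : e ∈ IsManifold.maximalAtlas 𝓘(ℝ, Cn d) ∞ M := by
  rw [IsManifold.mem_maximalAtlas_iff, mem_maximalAtlas_iff]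
  intro e' he'
  exact ⟨real_compatible he (IsManifold.subset_maximalAtlas he'),
    real_compatible (IsManifold.subset_maximalAtlas he') he⟩

lemma contDiffOn_comp_symm [IsManifold 𝓘(ℂ, Cn d) ω M] {r : M → ℝ} {U : Set M}
    (hr : ContMDiffOn 𝓘(ℝ, Cn d) 𝓘(ℝ, ℝ) ∞ r U)
    {e : OpenPartialHomeomorph M (Cn d)} (he : e ∈ holoCharts d M) :
    ContDiffOn ℝ ∞ (r ∘ e.symm) (e.target ∩ e.symm ⁻¹' U) := by
  have : IsManifold 𝓘(ℝ, Cn d) ∞ M := isManifold_real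
  have h1 := contMDiffOn_symm_of_mem_maximalAtlas (mem_real_maximalAtlas he)
  rw [← contMDiffOn_iff_contDiffOn]
  exact hr.comp (h1.mono inter_subset_left) inter_subset_right

lemma differentiableOn_comp_symm [IsManifold 𝓘(ℂ, Cn d) ω M] {f : M → ℂ} {U : Set M}
    (hf : MDifferentiableOn 𝓘(ℂ, Cn d) 𝓘(ℂ, ℂ) f U)
    {e : OpenPartialHomeomorph M (Cn d)} (he : e ∈ holoCharts d M) :
    DifferentiableOn ℂ (f ∘ e.symm) (e.target ∩ e.symm ⁻¹' U) := by
  have h1 := (contMDiffOn_symm_of_mem_maximalAtlas he).mdifferentiableOn (by simp)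
  rw [← mdifferentiableOn_iff_differentiableOn]
  exact hf.comp (h1.mono inter_subset_left) inter_subset_right

lemma fderiv_comp_symm_change {r : M → ℝ}
    {e e' : OpenPartialHomeomorph M (Cn d)} (he : e ∈ holoCharts d M) (he' : e' ∈ holoCharts d M)
    {q : M} (hq : q ∈ e.source) (hq' : q ∈ e'.source)
    (hr : DifferentiableAt ℝ (r ∘ e'.symm) (e' q)) :
    fderiv ℝ (r ∘ e.symm) (e q) =
      (fderiv ℝ (r ∘ e'.symm) (e' q)).comp (fderiv ℝ (e' ∘ e.symm) (e q)) := by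
  have hs : e q ∈ (e.symm.trans e').source :=
    mem_transition_source.2 ⟨e.map_source hq, by rwa [e.left_inv hq]⟩
  have hg : DifferentiableAt ℝ (e' ∘ e.symm) (e q) :=
    ((contDiffOn_transition he he').contDiffAt
      ((e.symm.trans e').open_source.mem_nhds hs)).differentiableAt (by simp)
  have heq : (r ∘ e.symm) =ᶠ[𝓝 (e q)] ((r ∘ e'.symm) ∘ (e' ∘ e.symm)) := by
    filter_upwards [(e.symm.trans e').open_source.mem_nhds hs] with z hz
    have hz2 : e.symm z ∈ e'.source := (mem_transition_source.1 hz).2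
    simp [e'.left_inv hz2]
  have hval : (e' ∘ e.symm) (e q) = e' q := by simp [e.left_inv hq]
  rw [heq.fderiv_eq, fderiv_comp _ (by rwa [hval]) hg, hval]

/-- The differential in the chart `e` factors through that in `e'`, so it would vanish along with
it. -/
lemma differentiableAt_comp_symm_change {r : M → ℝ}
    {e e' : OpenPartialHomeomorph M (Cn d)} (he : e ∈ holoCharts d M) (he' : e' ∈ holoCharts d M)
    {q : M} (hq : q ∈ e.source) (hq' : q ∈ e'.source)
    (hr : fderiv ℝ (r ∘ e.symm) (e q) ≠ 0)
    (hd : DifferentiableAt ℝ (r ∘ e'.symm) (e' q)) :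
    fderiv ℝ (r ∘ e'.symm) (e' q) ≠ 0 := by
  intro h
  rw [fderiv_comp_symm_change he he' hq hq' hd, h] at hr
  exact hr (by ext; simp)

end Charts

/-! ### Forms of top degree: coefficients, integrals, localization. -/

section TopForms

variable {n : ℕ}

lemma finrank_real_Cn (n : ℕ) : Module.finrank ℝ (Cn (n + 1)) = n + 1 + n + 1 := by
  rw [Module.finrank_pi_fintype]
  simp
  ring

/-- Alternating forms of top degree are multiples of the determinant in a basis. -/
lemma alternating_real_comp (α : Cn (n + 1) [⋀^Fin (n + 1 + n + 1)]→ₗ[ℝ] ℝ)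
    (B : Cn (n + 1) →ₗ[ℝ] Cn (n + 1)) (v : Fin (n + 1 + n + 1) → Cn (n + 1)) :
    α (fun i => B (v i)) = LinearMap.det B * α v := by
  let b := Module.finBasisOfFinrankEq ℝ (Cn (n + 1)) (finrank_real_Cn n)
  have h := α.eq_smul_basis_det b
  rw [h]
  simp only [AlternatingMap.smul_apply, smul_eq_mul]
  have := b.det_comp B v
  rw [show (fun i => B (v i)) = B ∘ v from rfl, this]
  ring

lemma top_form_comp (α : Cn (n + 1) [⋀^Fin (n + 1 + n + 1)]→L[ℝ] ℂ)
    (B : Cn (n + 1) →L[ℝ] Cn (n + 1)) (v : Fin (n + 1 + n + 1) → Cn (n + 1)) :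
    α.compContinuousLinearMap B v = (B.det : ℂ) * α v := by
  have hre := alternating_real_comp (Complex.reLm.compAlternatingMap α.toAlternatingMap) B v
  have him := alternating_real_comp (Complex.imLm.compAlternatingMap α.toAlternatingMap) B v
  apply Complex.ext
  · simpa [Function.comp_def, ContinuousLinearMap.det] using hre
  · simpa [Function.comp_def, ContinuousLinearMap.det] using him

/-- The real determinant of a complex linear map is the squared modulus of its complex determinant.
So holomorphic coordinate changes preserve orientation, and the absolute value in the change of
variables formula can be dropped. -/
lemma det_restrictScalars_nonneg (B : Cn (n + 1) →L[ℂ] Cn (n + 1)) :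
    0 ≤ (B.restrictScalars ℝ).det := by
  have h : (B.restrictScalars ℝ).det = Algebra.norm ℝ (LinearMap.det (B : Cn (n + 1) →ₗ[ℂ] _)) :=
    LinearMap.det_restrictScalars (R := ℝ) (f := (B : Cn (n + 1) →ₗ[ℂ] Cn (n + 1)))
  rw [h, Algebra.norm_complex_apply]
  exact Complex.normSq_nonneg _

variable {M : Type*} [TopologicalSpace M] [ChartedSpace (Cn (n + 1)) M]

lemma topCoeff_eq_zero {φ : DiffForm (n + 1) M (n + 1 + n + 1)}
    {e : OpenPartialHomeomorph M (Cn (n + 1))} {y : Cn (n + 1)} (h : φ (e.symm y) = 0) :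
    topCoeff φ e y = 0 := by
  simp [topCoeff, inChart, h]

lemma topCoeff_change [IsManifold 𝓘(ℂ, Cn (n + 1)) ω M]
    (φ : DiffForm (n + 1) M (n + 1 + n + 1)) {e e' : OpenPartialHomeomorph M (Cn (n + 1))}
    (he : e ∈ holoCharts (n + 1) M) (he' : e' ∈ holoCharts (n + 1) M) {y : Cn (n + 1)}
    (hy : y ∈ (e.symm.trans e').source) :
    topCoeff φ e y = ((fderiv ℝ (e' ∘ e.symm) y).det : ℂ) * topCoeff φ e' ((e' ∘ e.symm) y) := by
  rw [topCoeff, inChart_eq_pullback φ he he' hy, top_form_comp]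
  rfl

/-- The integral of a form of top degree does not depend on the holomorphic chart. -/
lemma integral_chart_eq [IsManifold 𝓘(ℂ, Cn (n + 1)) ω M]
    {φ : DiffForm (n + 1) M (n + 1 + n + 1)} {e e' : OpenPartialHomeomorph M (Cn (n + 1))}
    (he : e ∈ holoCharts (n + 1) M) (he' : e' ∈ holoCharts (n + 1) M)
    (hφ : tsupport φ ⊆ e.source) (hφ' : tsupport φ ⊆ e'.source) (G : M → ℂ) :
    ∫ y in e.target, G (e.symm y) * topCoeff φ e y =
      ∫ y in e'.target, G (e'.symm y) * topCoeff φ e' y := by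
  have hz : ∀ (c : OpenPartialHomeomorph M (Cn (n + 1))) {U : Set M}, tsupport φ ⊆ U →
      ∀ y, c.symm y ∉ U → G (c.symm y) * topCoeff φ c y = 0 := fun c U hU y hy => by
    rw [topCoeff_eq_zero (image_eq_zero_of_notMem_tsupport fun h => hy (hU h)), mul_zero]
  set f : Cn (n + 1) → Cn (n + 1) := e' ∘ e.symm with hf
  have himg : f '' (e.symm.trans e').source = (e'.symm.trans e).source := by
    ext z
    constructor
    · rintro ⟨y, hy, rfl⟩
      rw [mem_transition_source] at hy ⊢
      refine ⟨e'.map_source hy.2, ?_⟩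
      simp [hf, e'.left_inv hy.2, e.map_target hy.1]
    · intro hz
      rw [mem_transition_source] at hz
      refine ⟨e (e'.symm z), mem_transition_source.2 ⟨e.map_source hz.2, ?_⟩, ?_⟩
      · rw [e.left_inv hz.2]; exact e'.map_target hz.1
      · simp [hf, e.left_inv hz.2, e'.right_inv hz.1]
  -- The support lies in both chart domains, so each integral may be restricted to the overlap,
  -- where the transition map is injective and differentiable.
  rw [setIntegral_eq_of_subset_of_forall_sdiff_eq_zero (s := (e.symm.trans e').source)
      e.open_target.measurableSet (fun y hy => (mem_transition_source.1 hy).1)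
      (fun y hy => hz e hφ' y fun h => hy.2 (mem_transition_source.2 ⟨hy.1, h⟩)),
    setIntegral_eq_of_subset_of_forall_sdiff_eq_zero (s := (e'.symm.trans e).source)
      e'.open_target.measurableSet (fun y hy => (mem_transition_source.1 hy).1)
      (fun y hy => hz e' hφ y fun h => hy.2 (mem_transition_source.2 ⟨hy.1, h⟩)),
    ← himg]
  have hmeas := (e.symm.trans e').open_source.measurableSet
  have hder : ∀ y ∈ (e.symm.trans e').source, DifferentiableAt ℂ f y := fun y hy =>
    (differentiableOn_transition he he').differentiableAt ((e.symm.trans e').open_source.mem_nhds hy)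
  rw [integral_image_eq_integral_abs_det_fderiv_smul (f := f) (f' := fun y => fderiv ℝ f y) volume
    hmeas (fun y hy => ((hder y hy).restrictScalars ℝ).hasFDerivAt.hasFDerivWithinAt)
    (fun y hy z hz h => ?_)]
  · refine setIntegral_congr_fun hmeas fun y hy => ?_
    have hdet : 0 ≤ (fderiv ℝ f y).det := by
      rw [((hder y hy).hasFDerivAt.restrictScalars ℝ).fderiv]
      exact det_restrictScalars_nonneg _
    have hy2 := (mem_transition_source.1 hy).2
    rw [topCoeff_change φ he he' hy, abs_of_nonneg hdet, Complex.real_smul]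
    simp only [hf, Function.comp_apply, e'.left_inv hy2]
    ring
  · rw [mem_transition_source] at hy hz
    exact e.symm.injOn (by simpa using hy.1) (by simpa using hz.1) (e'.injOn hy.2 hz.2 h)

/-- The coefficient of a form in a chart, extended by zero. -/
def extCoeff (φ : DiffForm (n + 1) M (n + 1 + n + 1)) (e : OpenPartialHomeomorph M (Cn (n + 1))) :
    Cn (n + 1) → ℂ := e.target.indicator (topCoeff φ e)

lemma contDiffOn_topCoeff {φ : DiffForm (n + 1) M (n + 1 + n + 1)} (hφ : IsSmoothForm φ)
    {e : OpenPartialHomeomorph M (Cn (n + 1))} (he : e ∈ holoCharts (n + 1) M) :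
    ContDiffOn ℝ ∞ (topCoeff φ e) e.target :=
  (ContinuousAlternatingMap.apply ℝ (Cn (n + 1)) ℂ (realFrame n)).contDiff.comp_contDiffOn (hφ e he)

lemma isCompact_tsupport_of_mem [T2Space M] {k : ℕ} {φ : DiffForm (n + 1) M k}
    (hφ : φ ∈ testForms (n + 1) M k) : IsCompact (tsupport φ) := by
  obtain ⟨-, K, hK, hφK⟩ := hφ
  exact hK.of_isClosed_subset (isClosed_tsupport φ)
    (closure_minimal (fun x hx => by_contra fun h => hx (hφK x h)) hK.isClosed)

lemma tsupport_extCoeff_subset {φ : DiffForm (n + 1) M (n + 1 + n + 1)}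
    {e : OpenPartialHomeomorph M (Cn (n + 1))} {K : Set M} (hK : IsCompact K)
    (hKe : K ⊆ e.source) (hφ : ∀ x ∉ K, φ x = 0) : tsupport (extCoeff φ e) ⊆ e '' K := by
  have hc : IsCompact (e '' K) := hK.image_of_continuousOn (e.continuousOn.mono hKe)
  refine closure_minimal (fun y hy => ?_) hc.isClosed
  by_contra h
  refine hy ?_
  by_cases hyt : y ∈ e.target
  · rw [extCoeff, indicator_of_mem hyt]
    exact topCoeff_eq_zero (hφ _ fun h' => h ⟨_, h', e.right_inv hyt⟩)
  · rw [extCoeff, indicator_of_notMem hyt]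

lemma hasCompactSupport_extCoeff {φ : DiffForm (n + 1) M (n + 1 + n + 1)}
    {e : OpenPartialHomeomorph M (Cn (n + 1))} {K : Set M} (hK : IsCompact K)
    (hKe : K ⊆ e.source) (hφ : ∀ x ∉ K, φ x = 0) : HasCompactSupport (extCoeff φ e) :=
  (hK.image_of_continuousOn (e.continuousOn.mono hKe)).of_isClosed_subset (isClosed_tsupport _)
    (tsupport_extCoeff_subset hK hKe hφ)

/-- Extension by zero is smooth since the support is compactly contained in the image of the chart.
-/
lemma contDiff_extCoeff {φ : DiffForm (n + 1) M (n + 1 + n + 1)} (hs : IsSmoothForm φ)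
    {e : OpenPartialHomeomorph M (Cn (n + 1))} (he : e ∈ holoCharts (n + 1) M) {K : Set M}
    (hK : IsCompact K) (hKe : K ⊆ e.source) (hφ : ∀ x ∉ K, φ x = 0) :
    ContDiff ℝ ∞ (extCoeff φ e) := by
  refine contDiff_iff_contDiffAt.2 fun y => ?_
  by_cases hy : y ∈ e.target
  · refine ((contDiffOn_topCoeff hs he).contDiffAt (e.open_target.mem_nhds hy)).congr_of_eventuallyEq
      ?_
    filter_upwards [e.open_target.mem_nhds hy] with z hz
    rw [extCoeff, indicator_of_mem hz]
  · have h1 : y ∉ tsupport (extCoeff φ e) := fun h => by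
      obtain ⟨x, hx, rfl⟩ := tsupport_extCoeff_subset hK hKe hφ h
      exact hy (e.map_source (hKe hx))
    exact contDiffAt_const.congr_of_eventuallyEq (notMem_tsupport_iff_eventuallyEq.1 h1)

lemma extCoeff_add (φ ψ : DiffForm (n + 1) M (n + 1 + n + 1))
    (e : OpenPartialHomeomorph M (Cn (n + 1))) :
    extCoeff (φ + ψ) e = fun y => extCoeff φ e y + extCoeff ψ e y := by
  funext y
  by_cases hy : y ∈ e.target <;> simp [extCoeff, hy, topCoeff, inChart_add]

lemma extCoeff_smul (c : ℂ) (φ : DiffForm (n + 1) M (n + 1 + n + 1))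
    (e : OpenPartialHomeomorph M (Cn (n + 1))) :
    extCoeff (c • φ) e = fun y => c * extCoeff φ e y := by
  funext y
  by_cases hy : y ∈ e.target <;> simp [extCoeff, hy, topCoeff, inChart_smul]

/-- The product of a function with a form. -/
def mulForm {k : ℕ} (χ : M → ℝ) (φ : DiffForm (n + 1) M k) : DiffForm (n + 1) M k :=
  fun x => (χ x : ℂ) • φ x

lemma mulForm_add {k : ℕ} (χ : M → ℝ) (φ ψ : DiffForm (n + 1) M k) :
    mulForm χ (φ + ψ) = mulForm χ φ + mulForm χ ψ := by
  funext x; ext v; simp [mulForm]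

lemma mulForm_smul {k : ℕ} (χ : M → ℝ) (c : ℂ) (φ : DiffForm (n + 1) M k) :
    mulForm χ (c • φ) = c • mulForm χ φ := by
  funext x; simp only [mulForm, Pi.smul_apply]; rw [smul_comm]

lemma inChart_mulForm {k : ℕ} (χ : M → ℝ) (φ : DiffForm (n + 1) M k)
    (e : OpenPartialHomeomorph M (Cn (n + 1))) (y : Cn (n + 1)) :
    inChart (mulForm χ φ) e y = (χ (e.symm y) : ℂ) • inChart φ e y := by
  ext v; simp [inChart, mulForm]

lemma topCoeff_mulForm (χ : M → ℝ) (φ : DiffForm (n + 1) M (n + 1 + n + 1))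
    (e : OpenPartialHomeomorph M (Cn (n + 1))) (y : Cn (n + 1)) :
    topCoeff (mulForm χ φ) e y = (χ (e.symm y) : ℂ) * topCoeff φ e y := by
  simp [topCoeff, inChart_mulForm]

lemma tsupport_mulForm_subset_left {k : ℕ} (χ : M → ℝ) (φ : DiffForm (n + 1) M k) :
    tsupport (mulForm χ φ) ⊆ tsupport χ :=
  closure_mono fun x hx h => hx (by ext v; simp [mulForm, h])

lemma tsupport_mulForm_subset_right {k : ℕ} (χ : M → ℝ) (φ : DiffForm (n + 1) M k) :
    tsupport (mulForm χ φ) ⊆ tsupport φ :=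
  closure_mono fun x hx h => hx (by ext v; simp [mulForm, h])

lemma mulForm_mem [IsManifold 𝓘(ℂ, Cn (n + 1)) ω M] {k : ℕ} {χ : M → ℝ}
    (hχ : ContMDiff 𝓘(ℝ, Cn (n + 1)) 𝓘(ℝ, ℝ) ∞ χ)
    {φ : DiffForm (n + 1) M k} (hφ : φ ∈ testForms (n + 1) M k) :
    mulForm χ φ ∈ testForms (n + 1) M k := by
  obtain ⟨hs, K, hK, hφK⟩ := hφ
  refine ⟨fun e he => ?_, K, hK, fun x hx => by ext v; simp [mulForm, hφK x hx]⟩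
  have h1 : ContDiffOn ℝ ∞ (χ ∘ e.symm) e.target := by
    simpa using contDiffOn_comp_symm (U := univ) hχ.contMDiffOn he
  have h2 : inChart (mulForm χ φ) e = fun y => (χ (e.symm y) : ℂ) • inChart φ e y :=
    funext fun y => inChart_mulForm χ φ e y
  rw [h2]
  exact (Complex.ofRealCLM.contDiff.comp_contDiffOn h1).smul (hs e he)

/-- In a fixed chart, the coefficients of `χ φ_ν` tend to zero if the forms `φ_ν` do. -/
lemma SmoothlyTendstoZero.extCoeff_mulForm [IsManifold 𝓘(ℂ, Cn (n + 1)) ω M] {χ : M → ℝ}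
    (hχ : ContMDiff 𝓘(ℝ, Cn (n + 1)) 𝓘(ℝ, ℝ) ∞ χ)
    {φ : ℕ → DiffForm (n + 1) M (n + 1 + n + 1)} (hs : ∀ ν, IsSmoothForm (φ ν))
    (hφ : TendstoZero φ) {e : OpenPartialHomeomorph M (Cn (n + 1))}
    (he : e ∈ holoCharts (n + 1) M) {L : Set (Cn (n + 1))} (hL : IsCompact L)
    (hLe : L ⊆ e.target) : SmoothlyTendstoZero L (fun ν => extCoeff (mulForm χ (φ ν)) e) := by
  have h1 : SmoothlyTendstoZero L (fun ν => inChart (φ ν) e) := hφ.2 e he L hLe hL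
  have h2 : SmoothlyTendstoZero L (fun ν => topCoeff (φ ν) e) :=
    h1.clm_comp e.open_target hLe (fun ν => hs ν e he)
      (ContinuousAlternatingMap.apply ℝ (Cn (n + 1)) ℂ (realFrame n))
  have h3 : ContDiffOn ℝ ∞ (χ ∘ e.symm) e.target := by
    simpa using contDiffOn_comp_symm (U := univ) hχ.contMDiffOn he
  have h4 := h2.mul e.open_target hLe hL (fun ν => contDiffOn_topCoeff (hs ν) he)
    (a := fun y => ((χ (e.symm y) : ℝ) : ℂ)) (Complex.ofRealCLM.contDiff.comp_contDiffOn h3)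
  refine h4.congr e.open_target hLe fun ν y hy => ?_
  rw [extCoeff, indicator_of_mem hy, topCoeff_mulForm]

end TopForms

/-! ### Local defining functions in arbitrary charts. -/

section DefiningFunctions

variable {d : ℕ} {M : Type*} [TopologicalSpace M]

lemma nonpos_of_mem_closure {D U : Set M} {r : M → ℝ} (hU : IsOpen U) (hr : ContinuousOn r U)
    (hD : ∀ x ∈ U, x ∈ D ↔ r x < 0) {q : M} (hq : q ∈ U) (hqD : q ∈ closure D) : r q ≤ 0 := by
  by_contra! h
  have h1 : ∀ᶠ x in 𝓝 q, 0 < r x := (hr.continuousAt (hU.mem_nhds hq)).eventually_const_lt h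
  obtain ⟨x, ⟨hx1, hx2⟩, hx3⟩ := mem_closure_iff_nhds.1 hqD _ (h1.and (hU.mem_nhds hq))
  exact absurd ((hD x hx2).1 hx3) (not_lt.2 (le_of_lt hx1))

lemma eq_zero_of_mem_frontier {D U : Set M} {r : M → ℝ} (hU : IsOpen U) (hr : ContinuousOn r U)
    (hDo : IsOpen D) (hD : ∀ x ∈ U, x ∈ D ↔ r x < 0) {q : M} (hq : q ∈ U)
    (hqD : q ∈ frontier D) : r q = 0 := by
  refine le_antisymm (nonpos_of_mem_closure hU hr hD hq hqD.1) ?_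
  by_contra! h
  rw [hDo.frontier_eq] at hqD
  exact hqD.2 ((hD q hq).2 h)

variable [ChartedSpace (Cn d) M] [IsManifold 𝓘(ℂ, Cn d) ω M]

/-- What a local defining function looks like in an arbitrary holomorphic chart. -/
lemma IsLocalDefiningFunction.inChart {D : Set M} {p : M} {r : M → ℝ}
    (h : IsLocalDefiningFunction d D p r) (hD : IsOpen D) (hp : p ∈ frontier D)
    {e : OpenPartialHomeomorph M (Cn d)} (he : e ∈ holoCharts d M) (hpe : p ∈ e.source) :
    ContDiffAt ℝ ∞ (r ∘ e.symm) (e p) ∧ (r ∘ e.symm) (e p) = 0 ∧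
    (∀ᶠ z in 𝓝 (e p), e.symm z ∈ D ↔ (r ∘ e.symm) z < 0) ∧ fderiv ℝ (r ∘ e.symm) (e p) ≠ 0 := by
  obtain ⟨⟨U, hU, hpU, hr, hUD⟩, hne⟩ := h
  have key : ∀ e ∈ holoCharts d M, p ∈ e.source → ContDiffAt ℝ ∞ (r ∘ e.symm) (e p) ∧
      e.target ∩ e.symm ⁻¹' U ∈ 𝓝 (e p) := fun e he hpe => by
    have hm : e.target ∩ e.symm ⁻¹' U ∈ 𝓝 (e p) :=
      (e.isOpen_inter_preimage_symm hU).mem_nhds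
        ⟨e.map_source hpe, by rwa [mem_preimage, e.left_inv hpe]⟩
    exact ⟨(contDiffOn_comp_symm hr he).contDiffAt hm, hm⟩
  obtain ⟨hcd, hm⟩ := key e he hpe
  refine ⟨hcd, ?_, ?_, ?_⟩
  · simpa [e.left_inv hpe] using eq_zero_of_mem_frontier hU hr.continuousOn hD hUD hpU hp
  · filter_upwards [hm] with z hz using hUD _ hz.2
  · exact differentiableAt_comp_symm_change (IsManifold.chart_mem_maximalAtlas p) he
      (mem_chart_source _ p) hpe hne (hcd.differentiableAt (by simp))

/-- The left side quantifies over all defining functions. Their differentials at `p` have the same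
sign on every vector by `fderiv_pos_of_same_sign`, hence the same kernel, so one of them suffices.
-/
lemma complexTangentSpace_eq {D : Set M} {p : M} {r : M → ℝ}
    (h : IsLocalDefiningFunction d D p r) (hD : IsOpen D) (hp : p ∈ frontier D) :
    complexTangentSpace d D p =
      complexKernel (fderiv ℝ (r ∘ (chartAt (Cn d) p).symm) (chartAt (Cn d) p p)) := by
  have hc : chartAt (Cn d) p ∈ holoCharts d M := IsManifold.chart_mem_maximalAtlas p
  obtain ⟨a1, a2, a3, a4⟩ := h.inChart hD hp hc (mem_chart_source _ p)
  ext w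
  refine ⟨fun hw c => hw r h c, fun hw r' hr' c => ?_⟩
  obtain ⟨b1, b2, b3, b4⟩ := hr'.inChart hD hp hc (mem_chart_source _ p)
  have hpos : ∀ x, 0 < fderiv ℝ (r' ∘ (chartAt (Cn d) p).symm) (chartAt (Cn d) p p) x →
      0 < fderiv ℝ (r ∘ (chartAt (Cn d) p).symm) (chartAt (Cn d) p p) x := fun x hx =>
    fderiv_pos_of_same_sign (a1.differentiableAt (by simp)) (b1.differentiableAt (by simp)) a2 b2
      (by filter_upwards [a3, b3] with z h1 h2 using h1.symm.trans h2) a4 hx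
  have h0 : fderiv ℝ (r ∘ (chartAt (Cn d) p).symm) (chartAt (Cn d) p p) (c • w) = 0 := hw c
  by_contra hne
  rcases lt_or_gt_of_ne hne with h1 | h1
  · have h2 := hpos (-(c • w)) (by rw [map_neg]; linarith)
    rw [map_neg, h0] at h2
    simp at h2
  · exact absurd h0 (hpos _ h1).ne'

end DefiningFunctions

/-! ### The domain near a point, in a corner model. -/

section LocalCorner

variable {d N : ℕ} {M : Type*} [TopologicalSpace M]

/-- A description of the domain `⋂ D j` by a corner model in the chart `e`. -/
structure LocalCorner (D : Fin N → Set M) (e : OpenPartialHomeomorph M (Cn d)) where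
  S : Finset (Fin N)
  m : CornerModel d S
  W_subset : m.W ⊆ e.target
  mem_iff : ∀ (j : S), ∀ y ∈ m.W, e.symm y ∈ D j ↔ m.r j y < 0
  mem_of_notMem : ∀ j ∉ S, ∀ y ∈ m.W, e.symm y ∈ D j

/-- The coordinate neighbourhood of a local description. -/
def LocalCorner.dom {D : Fin N → Set M} {e : OpenPartialHomeomorph M (Cn d)}
    (P : LocalCorner D e) : Set M := e.source ∩ e ⁻¹' P.m.W

lemma LocalCorner.isOpen_dom {D : Fin N → Set M} {e : OpenPartialHomeomorph M (Cn d)}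
    (P : LocalCorner D e) : IsOpen P.dom := e.isOpen_inter_preimage P.m.isOpen_W

variable [ChartedSpace (Cn d) M] [IsManifold 𝓘(ℂ, Cn d) ω M]

/-- The corner is formed by the faces through `p`, with dual vectors supplied by genericity. The
neighbourhood is so small that each remaining `D j` either contains it or has closure disjoint from
it. The point is arbitrary, not only in the closure of `Ω`, because the uniqueness argument needs
outward vectors everywhere. -/
lemma exists_local_description {D : Fin N → Set M} {Ω : Set M}
    (hΩ : IsDomainWithGenericCorners d D Ω) (p : M) :
    ∃ (S : Finset (Fin N)) (m : CornerModel d S) (v : Cn d), (∀ j, j ∈ S ↔ p ∈ frontier (D j)) ∧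
      chartAt (Cn d) p p ∈ m.W ∧ m.W ⊆ (chartAt (Cn d) p).target ∧
      (∀ (j : S), ∀ y ∈ m.W, (chartAt (Cn d) p).symm y ∈ D j ↔ m.r j y < 0) ∧
      (∀ j ∉ S, (∀ y ∈ m.W, (chartAt (Cn d) p).symm y ∈ D j) ∨
        ∀ y ∈ m.W, (chartAt (Cn d) p).symm y ∉ closure (D j)) ∧
      ∀ y ∈ m.W, ∀ j, (chartAt (Cn d) p).symm y ∈ frontier (D j) →
        PointsOutward d (D j) (chartAt (Cn d) p) v ((chartAt (Cn d) p).symm y) := by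
  classical
  set e := chartAt (Cn d) p with hedef
  have he : e ∈ holoCharts d M := IsManifold.chart_mem_maximalAtlas p
  have hpe : p ∈ e.source := mem_chart_source _ p
  have hDo : ∀ j, IsOpen (D j) := fun j => (hΩ.isSmoothDomain j).isOpen
  let S : Finset (Fin N) := Finset.univ.filter fun j => p ∈ frontier (D j)
  have hS : ∀ j, j ∈ S ↔ p ∈ frontier (D j) := fun j => by simp [S]
  have hloc : ∀ j, ∃ (O : Set M) (r : M → ℝ), IsOpen O ∧ p ∈ O ∧
      (p ∈ frontier (D j) → IsLocalDefiningFunction d (D j) p r ∧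
        ContMDiffOn 𝓘(ℝ, Cn d) 𝓘(ℝ, ℝ) ∞ r O ∧ ∀ x ∈ O, x ∈ D j ↔ r x < 0) ∧
      (p ∉ frontier (D j) → O ⊆ D j ∨ O ⊆ (closure (D j))ᶜ) := by
    intro j
    by_cases hj : p ∈ frontier (D j)
    · obtain ⟨r, hr⟩ := (hΩ.isSmoothDomain j).smooth p hj
      obtain ⟨U, hU, hpU, h1, h2⟩ := hr.1
      exact ⟨U, r, hU, hpU, fun _ => ⟨hr, h1, h2⟩, fun h => absurd hj h⟩
    · by_cases hj' : p ∈ D j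
      · exact ⟨D j, 0, hDo j, hj', fun h => absurd h hj, fun _ => Or.inl Subset.rfl⟩
      · refine ⟨(closure (D j))ᶜ, 0, isClosed_closure.isOpen_compl, fun h => hj ?_,
          fun h => absurd h hj, fun _ => Or.inr Subset.rfl⟩
        rw [(hDo j).frontier_eq]
        exact ⟨h, hj'⟩
  choose O r hO hpO hfr hnf using hloc
  have hOo : IsOpen (⋂ j, O j) := isOpen_iInter_of_finite hO
  set s : Set (Cn d) := e.target ∩ e.symm ⁻¹' ⋂ j, O j with hs
  have hso : IsOpen s := e.isOpen_inter_preimage_symm hOo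
  have hps : e p ∈ s := ⟨e.map_source hpe, by
    rw [mem_preimage, e.left_inv hpe]; exact mem_iInter.2 hpO⟩
  have hsO : ∀ y ∈ s, ∀ j, e.symm y ∈ O j := fun y hy j => mem_iInter.1 hy.2 j
  have hsm : ∀ j : S, ContDiffOn ℝ ∞ (r j ∘ e.symm) s := fun j =>
    (contDiffOn_comp_symm (hfr j ((hS j).1 j.2)).2.1 he).mono fun y hy => ⟨hy.1, hsO y hy j⟩
  have hgen := hΩ.generic S p fun j hj => (hS j).1 hj
  have hker : (⨅ j ∈ S, complexTangentSpace d (D j) p : Submodule ℂ (Cn d)) =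
      ⨅ j : S, complexKernel (fderiv ℝ (r j ∘ e.symm) (e p)) := by
    rw [iInf_subtype']
    congr 1; funext j
    exact complexTangentSpace_eq (hfr j ((hS j).1 j.2)).1 (hDo j) ((hS j).1 j.2)
  rw [hker, ← Fintype.card_coe] at hgen
  obtain ⟨w, hw⟩ := exists_dual_vectors (fun j : S => fderiv ℝ (r j ∘ e.symm) (e p)) hgen
  -- By duality each differential of a face through `p` takes the value `1` on this sum. The set
  -- `s'` is a neighbourhood on which these values remain positive.
  set v : Cn d := ∑ l, w l with hv
  set s' : Set (Cn d) := s ∩ ⋂ j : S, (s ∩ (fun y => fderiv ℝ (r j ∘ e.symm) y v) ⁻¹' Ioi 0)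
    with hs'
  have hs'o : IsOpen s' := hso.inter (isOpen_iInter_of_finite fun j =>
    (((hsm j).continuousOn_fderiv_of_isOpen hso (by simp)).clm_apply
      continuousOn_const).isOpen_inter_preimage hso isOpen_Ioi)
  have hps' : e p ∈ s' := by
    refine ⟨hps, mem_iInter.2 fun j => ⟨hps, ?_⟩⟩
    have h1 : fderiv ℝ (r j ∘ e.symm) (e p) v = 1 := by
      rw [hv, map_sum]
      simp only [fun l => (hw j l).1, Finset.sum_ite_eq, Finset.mem_univ, if_true]
    simp [h1]
  obtain ⟨m, hpW, hWs, hmr⟩ := exists_cornerModel hs'o hps'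
    (ρ := fun j : S => r j ∘ e.symm) (fun j => (hsm j).mono inter_subset_left) hw
  have hoff : ∀ j ∉ S, (∀ y ∈ m.W, e.symm y ∈ D j) ∨ ∀ y ∈ m.W, e.symm y ∉ closure (D j) := by
    intro j hj
    rcases hnf j fun h => hj ((hS j).2 h) with h | h
    · exact Or.inl fun y hy => h (hsO y (hWs hy).1 j)
    · exact Or.inr fun y hy => h (hsO y (hWs hy).1 j)
  refine ⟨S, m, v, hS, hpW, fun y hy => (hWs hy).1.1, fun j y hy => ?_, hoff, fun y hy j hj => ?_⟩
  · rw [hmr j hy]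
    exact (hfr j ((hS j).1 j.2)).2.2 _ (hsO y (hWs hy).1 j)
  · by_cases hjS : j ∈ S
    · have hys := (hWs hy).1
      have hq : e.symm y ∈ e.source := e.map_target hys.1
      have hpos : 0 < fderiv ℝ (r j ∘ e.symm) y v := (mem_iInter.1 (hWs hy).2 ⟨j, hjS⟩).2
      have hval : e (e.symm y) = y := e.right_inv hys.1
      obtain ⟨-, hcm, hD⟩ := hfr j ((hS j).1 hjS)
      refine ⟨r j, ⟨⟨O j, hO j, hsO y hys j, hcm, hD⟩, ?_⟩, by rwa [hval]⟩
      refine differentiableAt_comp_symm_change he (IsManifold.chart_mem_maximalAtlas _) hq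
        (mem_chart_source _ _) ?_ ?_
      · rw [hval]; intro h; rw [h] at hpos; simp at hpos
      · have hc : chartAt (Cn d) (e.symm y) ∈ holoCharts d M :=
          IsManifold.chart_mem_maximalAtlas _
        refine ((contDiffOn_comp_symm hcm hc).contDiffAt (IsOpen.mem_nhds
          (OpenPartialHomeomorph.isOpen_inter_preimage_symm _ (hO j)) ?_)).differentiableAt
          (by simp)
        refine ⟨mem_chart_target _ _, ?_⟩
        rw [mem_preimage, (chartAt (Cn d) (e.symm y)).left_inv (mem_chart_source _ _)]
        exact hsO y hys j
    · exfalso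
      rcases hoff j hjS with h | h
      · rw [(hDo j).frontier_eq] at hj
        exact hj.2 (h y hy)
      · exact h y hy hj.1

/-- Near each point there is a vector that points outward from all `D j`. -/
lemma exists_outward {D : Fin N → Set M} {Ω : Set M} (hΩ : IsDomainWithGenericCorners d D Ω)
    (p : M) : ∃ (U : Set M) (v : Cn d), IsOpen U ∧ p ∈ U ∧ U ⊆ (chartAt (Cn d) p).source ∧
      ∀ q ∈ U, ∀ j, q ∈ frontier (D j) → PointsOutward d (D j) (chartAt (Cn d) p) v q := by
  obtain ⟨S, m, v, -, hpW, -, -, -, hv⟩ := exists_local_description hΩ p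
  refine ⟨_, v, (chartAt (Cn d) p).isOpen_inter_preimage m.isOpen_W,
    ⟨mem_chart_source _ p, hpW⟩, inter_subset_left, fun q hq j hj => ?_⟩
  have h := (chartAt (Cn d) p).left_inv hq.1
  have h1 := hv _ hq.2 j
  rw [h] at h1
  exact h1 hj

/-- A point of the closure of `Ω` lies in the closure of every `D j`, which excludes the disjoint
alternative for the faces that miss it. -/
lemma exists_localCorner {D : Fin N → Set M} {Ω : Set M} (hΩ : IsDomainWithGenericCorners d D Ω)
    {p : M} (hp : p ∈ closure Ω) :
    ∃ P : LocalCorner D (chartAt (Cn d) p), p ∈ P.dom ∧ ∀ j, j ∈ P.S ↔ p ∈ frontier (D j) := by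
  obtain ⟨S, m, v, hS, hpW, h1, h2, h3, -⟩ := exists_local_description hΩ p
  refine ⟨⟨S, m, h1, h2, fun j hj => (h3 j hj).resolve_right fun h => h _ hpW ?_⟩,
    ⟨mem_chart_source _ p, hpW⟩, hS⟩
  rw [(chartAt (Cn d) p).left_inv (mem_chart_source _ p)]
  rw [hΩ.eq_iInter] at hp
  exact closure_mono (iInter_subset _ j) hp

end LocalCorner

namespace LocalCorner

variable {d N : ℕ} {M : Type*} [TopologicalSpace M] {D : Fin N → Set M}
  {e : OpenPartialHomeomorph M (Cn d)} (P : LocalCorner D e)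

lemma mem_iInter_iff {y : Cn d} (hy : y ∈ P.m.W) : e.symm y ∈ ⋂ j, D j ↔ y ∈ P.m.region := by
  rw [mem_iInter]
  refine ⟨fun h j => (P.mem_iff j y hy).1 (h j), fun h j => ?_⟩
  by_cases hj : j ∈ P.S
  · exact (P.mem_iff ⟨j, hj⟩ y hy).2 (h ⟨j, hj⟩)
  · exact P.mem_of_notMem j hj y hy

lemma r_nonpos {q : M} (hq : q ∈ P.dom) (hqD : q ∈ closure (⋂ j, D j)) (j : P.S) :
    P.m.r j (e q) ≤ 0 := by
  refine nonpos_of_mem_closure (r := fun x => P.m.r j (e x)) P.isOpen_dom ?_ (fun x hx => ?_) hq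
    (closure_mono (iInter_subset _ (j : Fin N)) hqD)
  · exact (P.m.contDiff_r j).continuous.comp_continuousOn (e.continuousOn.mono inter_subset_left)
  · have := P.mem_iff j (e x) hx.2
    rwa [e.left_inv hx.1] at this

/-- Restriction to a smaller neighbourhood. -/
def restrict {V : Set M} (hV : IsOpen V) : LocalCorner D e where
  S := P.S
  m := { P.m with
    W := P.m.W ∩ (e.target ∩ e.symm ⁻¹' V)
    isOpen_W := P.m.isOpen_W.inter (e.isOpen_inter_preimage_symm hV)
    dual := fun y hy => P.m.dual y hy.1 }
  W_subset := fun _ hy => hy.2.1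
  mem_iff := fun j y hy => P.mem_iff j y hy.1
  mem_of_notMem := fun j hj y hy => P.mem_of_notMem j hj y hy.1

/-- A function of polynomial growth, multiplied with powers of the defining functions. -/
def weight (f : M → ℂ) (K : ℕ) : Cn d → ℂ :=
  (P.m.region ∩ P.m.W).indicator fun y => f (e.symm y) * ∏ j, (P.m.r j y : ℂ) ^ K

/-- The growth of `f` is controlled, on the whole neighbourhood, by the defining functions. -/
def Controls (f : M → ℂ) (K : ℕ) (C : ℝ) : Prop :=
  ∀ y ∈ P.m.region ∩ P.m.W, ‖f (e.symm y)‖ * ∏ j, |P.m.r j y| ^ K ≤ C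

end LocalCorner

/-! ### Polynomial growth measured by the defining functions. -/

section Growth

variable {d N : ℕ} {M : Type*} [MetricSpace M] [ChartedSpace (Cn d) M]
  [IsManifold 𝓘(ℂ, Cn d) ω M]

lemma isOpen_of_genericCorners {D : Fin N → Set M} {Ω : Set M}
    (hΩ : IsDomainWithGenericCorners d D Ω) : IsOpen Ω := by
  rw [hΩ.eq_iInter]
  exact isOpen_iInter_of_finite fun j => (hΩ.isSmoothDomain j).isOpen

/-- A boundary point of `Ω` near `p` lies on some face `r j = 0`. Since `r j` is Lipschitz, `|r j (e
q)|` is at most a constant times the distance from `q` to it, and the other factors are less than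
`1`. -/
lemma exists_bound_of_frontier {D : Fin N → Set M} {Ω : Set M}
    (hΩ : IsDomainWithGenericCorners d D Ω) {p : M} (hp : p ∈ frontier Ω)
    {e : OpenPartialHomeomorph M (Cn d)}
    (he : ∃ U ∈ 𝓝 p, ∃ K : ℝ, ∀ x ∈ U, ∀ y ∈ U, dist (e x) (e y) ≤ K * dist x y)
    (P : LocalCorner D e) (hpP : p ∈ P.dom) (hS : ∀ j, j ∈ P.S → p ∈ frontier (D j)) :
    ∃ V, IsOpen V ∧ p ∈ V ∧ ∃ A > 0, ∀ q ∈ V, q ∈ Ω →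
      ∏ j, |P.m.r j (e q)| ≤ A * Metric.infDist q (frontier Ω) := by
  have hΩo := isOpen_of_genericCorners hΩ
  obtain ⟨U, hU, K, hK⟩ := he
  have hlip : ∀ j, ∃ L : NNReal, ∃ t ∈ 𝓝 (e p), LipschitzOnWith L (P.m.r j) t := fun j =>
    ((P.m.contDiff_r j).contDiffAt.of_le (by simp)).exists_lipschitzOnWith
  choose L t ht hLt using hlip
  have hec : ContinuousAt e p := e.continuousAt hpP.1
  have hzero : ∀ j, P.m.r j (e p) = 0 := fun j => by
    refine eq_zero_of_mem_frontier (r := fun x => P.m.r j (e x)) P.isOpen_dom ?_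
      (hΩ.isSmoothDomain j).isOpen (fun x hx => ?_) hpP (hS j j.2)
    · exact (P.m.contDiff_r j).continuous.comp_continuousOn (e.continuousOn.mono inter_subset_left)
    · have := P.mem_iff j (e x) hx.2
      rwa [e.left_inv hx.1] at this
  have hev : ∀ᶠ q in 𝓝 p, q ∈ U ∧ q ∈ P.dom ∧ (∀ j, e q ∈ t j) ∧ ∀ j, |P.m.r j (e q)| < 1 := by
    refine (eventually_mem_set.2 hU).and ((P.isOpen_dom.eventually_mem hpP).and
      ((eventually_all.2 fun j => hec.eventually_mem (ht j)).and (eventually_all.2 fun j => ?_)))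
    have h1 : ContinuousAt (fun q => |P.m.r j (e q)|) p :=
      ((P.m.contDiff_r j).continuous.continuousAt.comp hec).abs
    exact h1.eventually_lt_const (by simp [hzero])
  obtain ⟨ρ, hρ, hball⟩ := Metric.eventually_nhds_iff_ball.1 hev
  -- The sum of Lipschitz constants handles boundary points within `ρ / 2` of `q`, which lie in the
  -- ball of radius `ρ`. The term `2 / ρ` handles all farther ones, as the product is at most `1`.
  refine ⟨Metric.ball p (ρ / 2), Metric.isOpen_ball, Metric.mem_ball_self (by positivity),
    (∑ j, (L j : ℝ)) * |K| + 2 / ρ, by positivity, fun q hq hqΩ => ?_⟩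
  set A : ℝ := (∑ j, (L j : ℝ)) * |K| + 2 / ρ with hA
  have hApos : 0 < A := by positivity
  obtain ⟨q1, q2, q3, q4⟩ := hball q (Metric.ball_subset_ball (by linarith) hq)
  have hprod1 : ∏ j, |P.m.r j (e q)| ≤ 1 :=
    Finset.prod_le_one (fun _ _ => abs_nonneg _) fun j _ => (q4 j).le
  rw [← div_le_iff₀' hApos]
  refine (Metric.le_infDist ⟨p, hp⟩).2 fun {q'} hq' => ?_
  rw [div_le_iff₀' hApos]
  by_cases hd : dist q q' < ρ / 2
  · have hq'b : q' ∈ Metric.ball p ρ := by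
      rw [Metric.mem_ball] at hq ⊢
      calc dist q' p ≤ dist q' q + dist q p := dist_triangle _ _ _
        _ < ρ / 2 + ρ / 2 := by rw [dist_comm q' q]; linarith
        _ = ρ := by ring
    obtain ⟨b1, b2, b3, b4⟩ := hball q' hq'b
    rw [hΩo.frontier_eq] at hq'
    have hnot : e q' ∉ P.m.region := fun h => hq'.2 (by
      have := (P.mem_iInter_iff b2.2).2 h
      rwa [e.left_inv b2.1, ← hΩ.eq_iInter] at this)
    obtain ⟨j, hj⟩ : ∃ j, 0 ≤ P.m.r j (e q') := by
      by_contra! hcon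
      exact hnot hcon
    have hj0 : P.m.r j (e q') = 0 :=
      le_antisymm (P.r_nonpos b2 (by rw [← hΩ.eq_iInter]; exact hq'.1) j) hj
    calc ∏ i, |P.m.r i (e q)| = |P.m.r j (e q)| * ∏ i ∈ Finset.univ.erase j, |P.m.r i (e q)| :=
          (Finset.mul_prod_erase _ _ (Finset.mem_univ j)).symm
      _ ≤ |P.m.r j (e q)| * 1 := mul_le_mul_of_nonneg_left
          (Finset.prod_le_one (fun _ _ => abs_nonneg _) fun i _ => (q4 i).le) (abs_nonneg _)
      _ = dist (P.m.r j (e q)) (P.m.r j (e q')) := by rw [hj0, Real.dist_0_eq_abs, mul_one]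
      _ ≤ L j * dist (e q) (e q') := (hLt j).dist_le_mul _ (q3 j) _ (b3 j)
      _ ≤ L j * (|K| * dist q q') := by
          refine mul_le_mul_of_nonneg_left ((hK q q1 q' b1).trans ?_) (L j).2
          exact mul_le_mul_of_nonneg_right (le_abs_self K) dist_nonneg
      _ ≤ (∑ j, (L j : ℝ)) * (|K| * dist q q') := by
          refine mul_le_mul_of_nonneg_right ?_ (by positivity)
          exact Finset.single_le_sum (f := fun j => (L j : ℝ)) (fun i _ => (L i).2)
            (Finset.mem_univ j)
      _ ≤ A * dist q q' := by
          rw [hA, add_mul, mul_assoc]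
          exact le_add_of_nonneg_right (by positivity)
  · push Not at hd
    calc _ ≤ (1 : ℝ) := hprod1
      _ = 2 / ρ * (ρ / 2) := by field_simp
      _ ≤ A * dist q q' := by
          refine mul_le_mul ?_ hd (by positivity) hApos.le
          rw [hA]
          exact le_add_of_nonneg_left (by positivity)

/-- At a point of `Ω` continuity bounds `f`, and the exponent `0` is enough. At a boundary point the
exponent of growth of `f` works by `exists_bound_of_frontier`. The corner is then restricted to the
neighbourhood on which the estimate holds. -/
lemma LocalCorner.exists_controls {D : Fin N → Set M} {Ω : Set M}
    (hΩ : IsDomainWithGenericCorners d D Ω) {f : M → ℂ}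
    (hf : HolomorphicOfPolynomialGrowth d Ω f) {p : M} (hp : p ∈ closure Ω)
    {e : OpenPartialHomeomorph M (Cn d)}
    (he : ∃ U ∈ 𝓝 p, ∃ K : ℝ, ∀ x ∈ U, ∀ y ∈ U, dist (e x) (e y) ≤ K * dist x y)
    (P : LocalCorner D e) (hpP : p ∈ P.dom) (hS : ∀ j, j ∈ P.S → p ∈ frontier (D j)) :
    ∃ P : LocalCorner D e, p ∈ P.dom ∧ ∃ K C, P.Controls f K C := by
  have hΩo := isOpen_of_genericCorners hΩ
  suffices ∃ V, IsOpen V ∧ p ∈ V ∧ ∃ (K : ℕ) (C : ℝ), ∀ q ∈ V, q ∈ P.dom → q ∈ Ω →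
      ‖f q‖ * ∏ j, |P.m.r j (e q)| ^ K ≤ C by
    obtain ⟨V, hV, hpV, K, C, hC⟩ := this
    refine ⟨P.restrict hV, ⟨hpP.1, hpP.2, e.map_source hpP.1, ?_⟩, K, C, fun y hy => ?_⟩
    · rwa [mem_preimage, e.left_inv hpP.1]
    · obtain ⟨h1, h2, h3, h4⟩ := hy
      have h5 := hC (e.symm y) h4 ⟨e.map_target h3, by rwa [mem_preimage, e.right_inv h3]⟩
        (by rw [hΩ.eq_iInter]; exact (P.mem_iInter_iff h2).2 h1)
      rwa [e.right_inv h3] at h5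
  by_cases hpΩ : p ∈ Ω
  · have hfc : ContinuousAt f p := (hf.1.continuousOn).continuousAt (hΩo.mem_nhds hpΩ)
    have hc : ContinuousAt (fun q => ‖f q‖ * ∏ j, |P.m.r j (e q)| ^ 0) p := by
      simpa using hfc.norm
    obtain ⟨V, hV1, hV2, hV3⟩ := mem_nhds_iff.1 (hc.eventually_lt_const (lt_add_one _))
    exact ⟨V, hV2, hV3, 0, _, fun q hq _ _ => le_of_lt (hV1 hq)⟩
  · obtain ⟨C, k, hC⟩ := hf.2
    have hpf : p ∈ frontier Ω := by rw [hΩo.frontier_eq]; exact ⟨hp, hpΩ⟩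
    obtain ⟨V, hV, hpV, A, hA, hVA⟩ := exists_bound_of_frontier hΩ hpf he P hpP hS
    refine ⟨V, hV, hpV, k, A ^ k * C, fun q hq _ hqΩ => ?_⟩
    rw [Finset.prod_pow]
    calc _ ≤ ‖f q‖ * (A * Metric.infDist q (frontier Ω)) ^ k := by
          refine mul_le_mul_of_nonneg_left ?_ (norm_nonneg _)
          exact pow_le_pow_left₀ (Finset.prod_nonneg fun _ _ => abs_nonneg _) (hVA q hq hqΩ) k
      _ = A ^ k * (‖f q‖ * Metric.infDist q (frontier Ω) ^ k) := by rw [mul_pow]; ring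
      _ ≤ A ^ k * C := mul_le_mul_of_nonneg_left (hC q hqΩ) (by positivity)

lemma exists_controls (hM : IsLocallyEuclideanMetric d M)
    {D : Fin N → Set M} {Ω : Set M} (hΩ : IsDomainWithGenericCorners d D Ω) {f : M → ℂ}
    (hf : HolomorphicOfPolynomialGrowth d Ω f) {p : M} (hp : p ∈ closure Ω) :
    ∃ P : LocalCorner D (chartAt (Cn d) p), p ∈ P.dom ∧ ∃ K C, P.Controls f K C := by
  obtain ⟨P, hpP, hS⟩ := exists_localCorner hΩ hp
  obtain ⟨U, hU, K, hK⟩ := hM p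
  exact P.exists_controls hΩ hf hp ⟨U, hU, K, fun x hx y hy => (hK x hx y hy).1⟩ hpP
    fun j => (hS j).1

end Growth

/-! ### The regularized local functional. -/

namespace LocalCorner

variable {d N : ℕ} {M : Type*} [TopologicalSpace M] [ChartedSpace (Cn d) M]
  [IsManifold 𝓘(ℂ, Cn d) ω M] {D : Fin N → Set M} {e : OpenPartialHomeomorph M (Cn d)}
  {P : LocalCorner D e} {f : M → ℂ} {K : ℕ} {C : ℝ}

lemma differentiableOn_region (P : LocalCorner D e) (he : e ∈ holoCharts d M)
    (hf : MDifferentiableOn 𝓘(ℂ, Cn d) 𝓘(ℂ, ℂ) f (⋂ j, D j)) :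
    DifferentiableOn ℂ (fun y => f (e.symm y)) (P.m.region ∩ P.m.W) :=
  (differentiableOn_comp_symm hf he).mono fun _ hy =>
    ⟨P.W_subset hy.2, (P.mem_iInter_iff hy.2).2 hy.1⟩

lemma norm_weight_le (hC : P.Controls f K C) (y : Cn d) : ‖P.weight f K y‖ ≤ |C| := by
  by_cases hy : y ∈ P.m.region ∩ P.m.W
  · rw [weight, indicator_of_mem hy, norm_mul, norm_prod]
    simp only [norm_pow, Complex.norm_real, Real.norm_eq_abs]
    exact (hC y hy).trans (le_abs_self C)
  · rw [weight, indicator_of_notMem hy, norm_zero]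
    exact abs_nonneg C

lemma aestronglyMeasurable_weight (he : e ∈ holoCharts d M)
    (hf : MDifferentiableOn 𝓘(ℂ, Cn d) 𝓘(ℂ, ℂ) f (⋂ j, D j)) :
    AEStronglyMeasurable (P.weight f K) volume := by
  have hm : MeasurableSet (P.m.region ∩ P.m.W) :=
    (P.m.isOpen_region.inter P.m.isOpen_W).measurableSet
  refine (aestronglyMeasurable_indicator_iff hm).2 (ContinuousOn.aestronglyMeasurable ?_ hm)
  refine (P.differentiableOn_region he hf).continuousOn.mul (Continuous.continuousOn ?_)
  exact continuous_finsetProd _ fun j _ =>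
    (Complex.continuous_ofReal.comp (P.m.contDiff_r j).continuous).pow K

lemma integrable_weight_mul (he : e ∈ holoCharts d M)
    (hf : MDifferentiableOn 𝓘(ℂ, Cn d) 𝓘(ℂ, ℂ) f (⋂ j, D j)) (hC : P.Controls f K C)
    {g : Cn d → ℂ} (hg : Continuous g) (hgc : HasCompactSupport g) :
    Integrable fun y => P.weight f K y * g y :=
  integrable_of_bounded_on_tsupport (P.aestronglyMeasurable_weight he hf) hg hgc
    fun y _ => P.norm_weight_le hC y

/-- The weight is bounded and the supports stay in a set of finite volume, so uniform convergence is
enough. -/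
lemma tendsto_integral_weight_mul (hC : P.Controls f K C)
    {g : ℕ → Cn d → ℂ} {L : Set (Cn d)} (hL : IsCompact L)
    (hgL : ∀ ν, tsupport (g ν) ⊆ L) (hg0 : TendstoUniformlyOn g 0 atTop L) :
    Tendsto (fun ν => ∫ y, P.weight f K y * g ν y) atTop (𝓝 0) := by
  rw [Metric.tendsto_atTop]
  intro ε hε
  rw [Metric.tendstoUniformlyOn_iff] at hg0
  set B : ℝ := (|C| + 1) * (volume.real L + 1) with hB
  have hBpos : 0 < B := by positivity
  obtain ⟨ν₀, hν₀⟩ := eventually_atTop.1 (hg0 (ε / B) (by positivity))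
  refine ⟨ν₀, fun ν hν => ?_⟩
  rw [dist_zero_right]
  have h1 : ∫ y, P.weight f K y * g ν y = ∫ y in L, P.weight f K y * g ν y := by
    rw [setIntegral_eq_integral_of_forall_compl_eq_zero]
    intro y hy
    rw [image_eq_zero_of_notMem_tsupport fun h => hy (hgL ν h), mul_zero]
  rw [h1]
  calc _ ≤ |C| * (ε / B) * volume.real L := by
        refine norm_setIntegral_le_of_norm_le_const hL.measure_lt_top fun y hy => ?_
        rw [norm_mul]
        have h2 := hν₀ ν hν y hy
        rw [Pi.zero_apply, dist_zero_left] at h2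
        exact mul_le_mul (P.norm_weight_le hC y) h2.le (norm_nonneg _) (abs_nonneg _)
    _ = ε * (|C| * volume.real L / B) := by ring
    _ < ε * 1 := by
        refine mul_lt_mul_of_pos_left ?_ hε
        rw [div_lt_one hBpos, hB]
        have : 0 ≤ volume.real L := measureReal_nonneg
        nlinarith [abs_nonneg C]
    _ = ε := mul_one ε

/-- The functional given by a weight and an operator as in `CornerModel.exists_operator`
is integration against `f` if `f` is bounded on the support. -/
lemma integral_weight_eq_of_bounded (he : e ∈ holoCharts d M)
    (hf : MDifferentiableOn 𝓘(ℂ, Cn d) 𝓘(ℂ, ℂ) f (⋂ j, D j))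
    {Q : (Cn d → ℂ) → Cn d → ℂ} (hQ : IsSmoothLocalOperator Q)
    (hQi : ∀ u h : Cn d → ℂ, ContDiff ℝ ∞ u → HasCompactSupport u →
      tsupport u ⊆ P.m.W → P.m.IsAdmissible u h →
      ∫ y in P.m.region, h y * u y =
        ∫ y in P.m.region, h y * ((∏ i, (P.m.r i y : ℂ) ^ K) * Q u y))
    {u : Cn d → ℂ} (hu : ContDiff ℝ ∞ u) (huc : HasCompactSupport u) (huW : tsupport u ⊆ P.m.W)
    {B : ℝ} (hB : ∀ y ∈ P.m.region ∩ tsupport u, ‖f (e.symm y)‖ ≤ B) :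
    ∫ y, P.weight f K y * Q u y = ∫ y in P.m.region, f (e.symm y) * u y := by
  rw [hQi u (fun y => f (e.symm y)) hu huc huW ⟨⟨_, P.m.isOpen_region.inter P.m.isOpen_W,
    P.differentiableOn_region he hf, inter_subset_inter_right _ huW⟩, B, hB⟩,
    ← integral_indicator P.m.isOpen_region.measurableSet]
  congr 1; funext y
  by_cases hy : y ∈ P.m.region
  · rw [indicator_of_mem hy]
    by_cases hyW : y ∈ P.m.W
    · rw [weight, indicator_of_mem (mem_inter hy hyW), mul_assoc]
    · rw [image_eq_zero_of_notMem_tsupport fun h => hyW (huW (hQ.tsupport_subset u h))]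
      simp
  · rw [indicator_of_notMem hy, weight, indicator_of_notMem fun h => hy h.1, zero_mul]

/-- The functional given by a weight and an operator as in `CornerModel.exists_operator`
is the limit of the integrals against admissible functions that approximate `f`. -/
lemma tendsto_integral_of_admissible
    {Q : (Cn d → ℂ) → Cn d → ℂ} (hQ : IsSmoothLocalOperator Q)
    (hQi : ∀ u h : Cn d → ℂ, ContDiff ℝ ∞ u → HasCompactSupport u →
      tsupport u ⊆ P.m.W → P.m.IsAdmissible u h →
      ∫ y in P.m.region, h y * u y =
        ∫ y in P.m.region, h y * ((∏ i, (P.m.r i y : ℂ) ^ K) * Q u y))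
    {u : Cn d → ℂ} (hu : ContDiff ℝ ∞ u) (huc : HasCompactSupport u) (huW : tsupport u ⊆ P.m.W)
    {l : Filter ℝ} [l.IsCountablyGenerated] {h : ℝ → Cn d → ℂ} {B : ℝ}
    (hadm : ∀ᶠ ε in l, P.m.IsAdmissible u (h ε))
    (hB : ∀ᶠ ε in l, ∀ y ∈ P.m.region ∩ tsupport u, ‖h ε y‖ * ∏ j, |P.m.r j y| ^ K ≤ B)
    (hlim : ∀ y ∈ P.m.region ∩ tsupport u, Tendsto (fun ε => h ε y) l (𝓝 (f (e.symm y)))) :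
    Tendsto (fun ε => ∫ y in P.m.region, h ε y * u y) l
      (𝓝 (∫ y, P.weight f K y * Q u y)) := by
  have hQs := hQ.tsupport_subset u
  have hQc : HasCompactSupport (Q u) := huc.mono' ((subset_tsupport _).trans hQs)
  have hQz : ∀ y ∉ tsupport u, Q u y = 0 := fun y hy =>
    image_eq_zero_of_notMem_tsupport fun h => hy (hQs h)
  have hprod : Continuous fun y => ∏ i, (P.m.r i y : ℂ) ^ K :=
    continuous_finsetProd _ fun j _ =>
      (Complex.continuous_ofReal.comp (P.m.contDiff_r j).continuous).pow K
  have hQcont : Continuous (Q u) := (hQ.contDiff hu).continuous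
  -- The identity is applied before the limit: the `h ε` have no uniform bound near the faces, but
  -- with the powers of the `r i` they are dominated by a multiple of `Q u`.
  have heq : (fun ε => ∫ y in P.m.region, h ε y * u y) =ᶠ[l]
      fun ε => ∫ y in P.m.region, h ε y * ((∏ i, (P.m.r i y : ℂ) ^ K) * Q u y) := by
    filter_upwards [hadm] with ε hε using hQi u (h ε) hu huc huW hε
  have hval : ∫ y, P.weight f K y * Q u y =
      ∫ y in P.m.region, f (e.symm y) * ((∏ i, (P.m.r i y : ℂ) ^ K) * Q u y) := by
    rw [← integral_indicator P.m.isOpen_region.measurableSet]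
    congr 1; funext y
    by_cases hy : y ∈ P.m.region
    · rw [indicator_of_mem hy]
      by_cases hyW : y ∈ P.m.W
      · rw [weight, indicator_of_mem (mem_inter hy hyW), mul_assoc]
      · rw [hQz y fun h => hyW (huW h)]; simp
    · rw [indicator_of_notMem hy, weight, indicator_of_notMem fun h => hy h.1, zero_mul]
  rw [hval]
  refine Tendsto.congr' heq.symm ?_
  refine tendsto_integral_filter_of_dominated_convergence (fun y => |B| * ‖Q u y‖) ?_ ?_ ?_ ?_
  · filter_upwards [hadm] with ε hε
    exact (hε.integrableOn (hprod.mul hQcont) hQc.mul_left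
      (tsupport_mul_subset_right.trans hQs)).aestronglyMeasurable
  · filter_upwards [hB] with ε hε
    refine (ae_restrict_iff' P.m.isOpen_region.measurableSet).2 (Eventually.of_forall fun y hy => ?_)
    by_cases hyu : y ∈ tsupport u
    · have h1 := hε y ⟨hy, hyu⟩
      rw [norm_mul, norm_mul, norm_prod, ← mul_assoc]
      simp only [norm_pow, Complex.norm_real, Real.norm_eq_abs]
      exact mul_le_mul_of_nonneg_right (h1.trans (le_abs_self B)) (norm_nonneg _)
    · simp [hQz y hyu]
  · exact ((hQcont.integrable_of_hasCompactSupport hQc).norm.const_mul _).integrableOn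
  · refine (ae_restrict_iff' P.m.isOpen_region.measurableSet).2 (Eventually.of_forall fun y hy => ?_)
    by_cases hyu : y ∈ tsupport u
    · exact (hlim y ⟨hy, hyu⟩).mul_const _
    · simpa [hQz y hyu] using tendsto_const_nhds

end LocalCorner

/-! ### Shifts along outward vectors; the boundary is a null set. -/

namespace LocalCorner

section Shift

variable {d N : ℕ} {M : Type*} [TopologicalSpace M] [ChartedSpace (Cn d) M]
  [IsManifold 𝓘(ℂ, Cn d) ω M] {D : Fin N → Set M} {c e : OpenPartialHomeomorph M (Cn d)}

lemma contDiffAt_r_comp (P : LocalCorner D c) (hc : c ∈ holoCharts d M) (he : e ∈ holoCharts d M)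
    {q : M} (hq : q ∈ P.dom) (hqe : q ∈ e.source) (j : P.S) :
    ContDiffAt ℝ ∞ ((fun x => P.m.r j (c x)) ∘ e.symm) (e q) := by
  refine (P.m.contDiff_r j).contDiffAt.comp (e q)
    ((contDiffOn_transition he hc).contDiffAt ((e.symm.trans c).open_source.mem_nhds ?_))
  exact mem_transition_source.2 ⟨e.map_source hqe, by rw [e.left_inv hqe]; exact hq.1⟩

/-- Outwardness is given by some defining function at `q`, whereas the estimates use the face
function of the model. Both define `D j` near `q`, so `fderiv_pos_of_same_sign` transfers the sign.
-/
lemma fderiv_r_comp_pos (P : LocalCorner D c) (hc : c ∈ holoCharts d M)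
    (he : e ∈ holoCharts d M) (hD : ∀ j, IsOpen (D j)) {q : M} (hq : q ∈ P.dom)
    (hqe : q ∈ e.source) {v : Cn d} (j : P.S) (hqD : q ∈ closure (D j))
    (h0 : P.m.r j (c q) = 0)
    (hv : q ∈ frontier (D j) → PointsOutward d (D j) e v q) :
    0 < fderiv ℝ ((fun x => P.m.r j (c x)) ∘ e.symm) (e q) v := by
  have hcq : c.symm (c q) = q := c.left_inv hq.1
  have hqf : q ∈ frontier (D j) := by
    rw [(hD j).frontier_eq]
    refine ⟨hqD, fun h => ?_⟩
    have := (P.mem_iff j (c q) hq.2).1 (by rwa [hcq])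
    linarith
  obtain ⟨r', hr', hpos⟩ := hv hqf
  obtain ⟨b1, b2, b3, -⟩ := hr'.inChart (hD j) hqf he hqe
  have hcd := P.contDiffAt_r_comp hc he hq hqe j
  refine fderiv_pos_of_same_sign (hcd.differentiableAt (by simp)) (b1.differentiableAt (by simp))
    (by simpa [e.left_inv hqe] using h0) b2 ?_ ?_ hpos
  · have hm : e.target ∩ e.symm ⁻¹' P.dom ∈ 𝓝 (e q) :=
      (e.isOpen_inter_preimage_symm P.isOpen_dom).mem_nhds
        ⟨e.map_source hqe, by rwa [mem_preimage, e.left_inv hqe]⟩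
    filter_upwards [hm, b3] with z hz hz3
    have h1 := P.mem_iff j (c (e.symm z)) hz.2.2
    rw [c.left_inv hz.2.1] at h1
    exact h1.symm.trans hz3
  · refine differentiableAt_comp_symm_change hc he hq.1 hqe ?_ (hcd.differentiableAt (by simp))
    have h1 : (fun x => P.m.r j (c x)) ∘ c.symm =ᶠ[𝓝 (c q)] P.m.r j := by
      filter_upwards [c.open_target.mem_nhds (c.map_source hq.1)] with z hz
      simp [c.right_inv hz]
    rw [h1.fderiv_eq]
    exact P.m.fderiv_r_ne_zero hq.2 j

/-- Shifting against an outward vector moves the closure of the domain into the domain, away from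
each face by a definite proportion. -/
lemma eventually_shift (P : LocalCorner D c) (hc : c ∈ holoCharts d M)
    (he : e ∈ holoCharts d M) (hD : ∀ j, IsOpen (D j)) {K : Set M} (hK : IsCompact K)
    (hKP : K ⊆ P.dom) (hKe : K ⊆ e.source) {v : Cn d}
    (hv : ∀ j, ∀ p ∈ frontier (D j) ∩ K, PointsOutward d (D j) e v p) :
    ∀ᶠ ε : ℝ in 𝓝[>] 0, ∀ q ∈ closure (⋂ j, D j) ∩ K,
      e q - ε • v ∈ e.target ∧ e.symm (e q - ε • v) ∈ P.dom ∧
      e.symm (e q - ε • v) ∈ ⋂ j, D j ∧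
      ∀ j, P.m.r j (c (e.symm (e q - ε • v))) ≤ P.m.r j (c q) / 2 := by
  have hcomp : IsCompact (closure (⋂ j, D j) ∩ K) := hK.inter_left isClosed_closure
  -- The statement near one point, jointly in `ε` and the base point.
  have key : ∀ q₀ ∈ closure (⋂ j, D j) ∩ K, ∀ᶠ s : ℝ × M in 𝓝[>] 0 ×ˢ 𝓝 q₀,
      s.2 ∈ closure (⋂ j, D j) →
      e s.2 - s.1 • v ∈ e.target ∧ e.symm (e s.2 - s.1 • v) ∈ P.dom ∧
      e.symm (e s.2 - s.1 • v) ∈ ⋂ j, D j ∧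
      ∀ j, P.m.r j (c (e.symm (e s.2 - s.1 • v))) ≤ P.m.r j (c s.2) / 2 := by
    intro q₀ hq₀
    have hqP := hKP hq₀.2
    have hqe := hKe hq₀.2
    have hte : Tendsto (fun s : ℝ × M => e s.2) (𝓝[>] 0 ×ˢ 𝓝 q₀) (𝓝 (e q₀)) :=
      (e.continuousAt hqe).tendsto.comp tendsto_snd
    have htp : Tendsto (fun s : ℝ × M => (e s.2, s.1)) (𝓝[>] 0 ×ˢ 𝓝 q₀)
        (𝓝 (e q₀) ×ˢ 𝓝[>] 0) := hte.prodMk tendsto_fst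
    have hts : Tendsto (fun s : ℝ × M => e s.2 - s.1 • v) (𝓝[>] 0 ×ˢ 𝓝 q₀) (𝓝 (e q₀)) := by
      have h1 : Tendsto (fun s : ℝ × M => s.1) (𝓝[>] 0 ×ˢ 𝓝 q₀) (𝓝 0) :=
        tendsto_fst.mono_right nhdsWithin_le_nhds
      simpa using hte.sub (h1.smul_const v)
    have hm : e.target ∩ e.symm ⁻¹' P.dom ∈ 𝓝 (e q₀) :=
      (e.isOpen_inter_preimage_symm P.isOpen_dom).mem_nhds
        ⟨e.map_source hqe, by rwa [mem_preimage, e.left_inv hqe]⟩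
    have hr : ∀ᶠ s : ℝ × M in 𝓝[>] 0 ×ˢ 𝓝 q₀, ∀ j : P.S,
        ((fun x => P.m.r j (c x)) ∘ e.symm) (e s.2) ≤ 0 →
        ((fun x => P.m.r j (c x)) ∘ e.symm) (e s.2 - s.1 • v) < 0 ∧
        ((fun x => P.m.r j (c x)) ∘ e.symm) (e s.2 - s.1 • v) ≤
          ((fun x => P.m.r j (c x)) ∘ e.symm) (e s.2) / 2 := by
      refine eventually_all.2 fun j => htp.eventually
        (eventually_le_half_of_outward (P.contDiffAt_r_comp hc he hqP hqe j) ?_ fun h0 => ?_)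
      · simpa [e.left_inv hqe] using P.r_nonpos hqP hq₀.1 j
      · exact P.fderiv_r_comp_pos hc he hD hqP hqe j (closure_mono (iInter_subset _ _) hq₀.1)
          (by simpa [e.left_inv hqe] using h0) fun h => hv j q₀ ⟨h, hq₀.2⟩
    have hdom : ∀ᶠ s : ℝ × M in 𝓝[>] 0 ×ˢ 𝓝 q₀, s.2 ∈ P.dom ∩ e.source :=
      tendsto_snd.eventually ((P.isOpen_dom.inter e.open_source).mem_nhds ⟨hqP, hqe⟩)
    filter_upwards [hts.eventually hm, hr, hdom] with s h1 h2 h3 h4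
    have h5 : ∀ j : P.S, _ := fun j => h2 j (by
      simpa [e.left_inv h3.2] using P.r_nonpos h3.1 h4 j)
    simp only [Function.comp_apply, e.left_inv h3.2] at h5
    refine ⟨h1.1, h1.2, ?_, fun j => (h5 j).2⟩
    have h6 := (P.mem_iInter_iff h1.2.2).2 fun j => (h5 j).1
    rwa [c.left_inv h1.2.1] at h6
  -- Compactness makes the range of `ε` uniform over the set.
  have h := hcomp.mem_prod_nhdsSet_of_forall key
  have h2 : ∀ᶠ ε : ℝ in 𝓝[>] 0, ∀ᶠ q in 𝓝ˢ (closure (⋂ j, D j) ∩ K), _ := Eventually.curry h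
  filter_upwards [h2] with ε hε q hq
  exact hε.self_of_nhdsSet q hq hq.1

/-- A point of the closure outside the domain lies on a face of a local model. Faces are null in the
chart of the model, and differentiable transition maps send null sets to null sets. -/
lemma volume_frontier_eq_zero (hcov : ∀ p ∈ closure (⋂ j, D j), ∃ c ∈ holoCharts d M,
    ∃ P : LocalCorner D c, p ∈ P.dom) (he : e ∈ holoCharts d M) :
    volume (e.target ∩ e.symm ⁻¹' (closure (⋂ j, D j) \ ⋂ j, D j)) = 0 := by
  refine measure_null_of_locally_null _ fun y hy => ?_
  obtain ⟨c, hc, P, hP⟩ := hcov _ hy.2.1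
  refine ⟨_, mem_nhdsWithin.2 ⟨_, e.isOpen_inter_preimage_symm P.isOpen_dom, ⟨hy.1, hP⟩,
    Subset.rfl⟩, ?_⟩
  set Z : Set (Cn d) := (c.symm.trans e).source ∩ ⋃ j, {z ∈ P.m.W | P.m.r j z = 0} with hZ
  have hZ0 : volume Z = 0 := measure_mono_null inter_subset_right
    (measure_iUnion_null fun j => P.m.volume_face_eq_zero j)
  refine measure_mono_null ?_ (addHaar_image_eq_zero_of_differentiableOn_of_addHaar_eq_zero volume
    (f := e ∘ c.symm) (s := Z) ?_ hZ0)
  · rintro z ⟨⟨hz1, hz2⟩, -, hz3, hz4⟩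
    refine ⟨c (e.symm z), ⟨mem_transition_source.2 ⟨c.map_source hz2.1, ?_⟩, ?_⟩, ?_⟩
    · rw [c.left_inv hz2.1]; exact e.map_target hz1
    · have hnot : c (e.symm z) ∉ P.m.region := fun h => hz4 (by
        have := (P.mem_iInter_iff hz2.2).2 h
        rwa [c.left_inv hz2.1] at this)
      obtain ⟨j, hj⟩ : ∃ j, 0 ≤ P.m.r j (c (e.symm z)) := by
        by_contra! hcon
        exact hnot hcon
      exact mem_iUnion.2 ⟨j, hz2.2, le_antisymm (P.r_nonpos hz2 hz3 j) hj⟩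
    · simp [c.left_inv hz2.1, e.right_inv hz1]
  · exact ((differentiableOn_transition hc he).restrictScalars ℝ).mono inter_subset_left

end Shift

/-! ### Passage from integrals on the domain to integrals on the model region. -/

section Transfer

variable {n N : ℕ} {M : Type*} [TopologicalSpace M] [ChartedSpace (Cn (n + 1)) M]
  [IsManifold 𝓘(ℂ, Cn (n + 1)) ω M] {D : Fin N → Set M}
  {c e : OpenPartialHomeomorph M (Cn (n + 1))}

lemma tsupport_extCoeff_subset_W (P : LocalCorner D c) {φ : DiffForm (n + 1) M (n + 1 + n + 1)}
    (hφc : IsCompact (tsupport φ)) (hφ : tsupport φ ⊆ P.dom) :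
    tsupport (extCoeff φ c) ⊆ P.m.W := by
  intro y hy
  obtain ⟨x, hx, rfl⟩ := tsupport_extCoeff_subset hφc (hφ.trans inter_subset_left)
    (fun x hx => image_eq_zero_of_notMem_tsupport hx) hy
  exact (hφ hx).2

/-- The integral over the domain of a form with small support, computed in the region of a corner
model. -/
lemma integral_eq_integral_region (P : LocalCorner D c) (hc : c ∈ holoCharts (n + 1) M)
    (he : e ∈ holoCharts (n + 1) M) (hD : ∀ j, IsOpen (D j))
    {φ : DiffForm (n + 1) M (n + 1 + n + 1)} (hφc : IsCompact (tsupport φ))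
    (hφP : tsupport φ ⊆ P.dom) (hφe : tsupport φ ⊆ e.source) (G : M → ℂ) :
    ∫ y in e.target ∩ e.symm ⁻¹' (⋂ j, D j), G (e.symm y) * topCoeff φ e y =
      ∫ y in P.m.region, G (c.symm y) * extCoeff φ c y := by
  have hΩo : IsOpen (⋂ j, D j) := isOpen_iInter_of_finite hD
  -- The domain is absorbed into the integrand as an indicator, so that chart independence applies.
  have h1 := integral_chart_eq he hc hφe (hφP.trans inter_subset_left)
    ((⋂ j, D j).indicator G)
  have h2 : ∫ y in e.target ∩ e.symm ⁻¹' (⋂ j, D j), G (e.symm y) * topCoeff φ e y =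
      ∫ y in e.target, (⋂ j, D j).indicator G (e.symm y) * topCoeff φ e y := by
    rw [← integral_indicator (e.isOpen_inter_preimage_symm hΩo).measurableSet,
      ← integral_indicator e.open_target.measurableSet]
    congr 1; funext y
    by_cases hy : y ∈ e.target
    · by_cases hyΩ : e.symm y ∈ ⋂ j, D j
      · rw [indicator_of_mem (show y ∈ _ ∩ _ from ⟨hy, hyΩ⟩), indicator_of_mem hy,
          indicator_of_mem hyΩ]
      · rw [indicator_of_notMem fun h => hyΩ h.2, indicator_of_mem hy, indicator_of_notMem hyΩ,
          zero_mul]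
    · rw [indicator_of_notMem fun h => hy h.1, indicator_of_notMem hy]
  rw [h2, h1, ← integral_indicator P.m.isOpen_region.measurableSet,
    ← integral_indicator c.open_target.measurableSet]
  congr 1; funext y
  by_cases hyW : y ∈ P.m.W
  · have hyt := P.W_subset hyW
    rw [indicator_of_mem hyt]
    by_cases hyr : y ∈ P.m.region
    · rw [indicator_of_mem hyr, indicator_of_mem ((P.mem_iInter_iff hyW).2 hyr), extCoeff,
        indicator_of_mem hyt]
    · rw [indicator_of_notMem hyr, indicator_of_notMem fun h => hyr ((P.mem_iInter_iff hyW).1 h),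
        zero_mul]
  · have h0 : extCoeff φ c y = 0 := image_eq_zero_of_notMem_tsupport fun h =>
      hyW (P.tsupport_extCoeff_subset_W hφc hφP h)
    have h3 : P.m.region.indicator (fun y => G (c.symm y) * extCoeff φ c y) y = 0 := by
      by_cases hyr : y ∈ P.m.region
      · rw [indicator_of_mem hyr, h0, mul_zero]
      · rw [indicator_of_notMem hyr]
    rw [h3]
    by_cases hyt : y ∈ c.target
    · rw [indicator_of_mem hyt]
      rw [extCoeff, indicator_of_mem hyt] at h0
      rw [h0, mul_zero]
    · rw [indicator_of_notMem hyt]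

end Transfer

end LocalCorner

/-- `H` is controlled only where `g` can be nonzero; extending it by zero off `A ∩ A'` leaves the
product on `A` unchanged and gives measurability. -/
lemma integrableOn_mul_of_bounded {d : ℕ} {A A' : Set (Cn d)} (hA : MeasurableSet A)
    (hA' : MeasurableSet A') {H g : Cn d → ℂ} (hH : ContinuousOn H A') (hg : Continuous g)
    (hgc : HasCompactSupport g) (hsub : A ∩ tsupport g ⊆ A') {C : ℝ}
    (hC : ∀ y ∈ A ∩ tsupport g, ‖H y‖ ≤ C) : IntegrableOn (fun y => H y * g y) A := by
  rw [← integrable_indicator_iff hA]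
  have hm := hA.inter hA'
  have h1 : A.indicator (fun y => H y * g y) = fun y => (A ∩ A').indicator H y * g y := by
    funext y
    by_cases hy : y ∈ A
    · by_cases hyA : y ∈ A'
      · rw [indicator_of_mem hy, indicator_of_mem (mem_inter hy hyA)]
      · rw [indicator_of_mem hy, image_eq_zero_of_notMem_tsupport fun h' => hyA (hsub ⟨hy, h'⟩)]
        simp
    · rw [indicator_of_notMem hy, indicator_of_notMem fun h' => hy h'.1, zero_mul]
  rw [h1]
  refine integrable_of_bounded_on_tsupport (C := |C|) ?_ hg hgc fun y hy => ?_
  · exact (aestronglyMeasurable_indicator_iff hm).2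
      ((hH.mono inter_subset_right).aestronglyMeasurable hm)
  · by_cases hy' : y ∈ A ∩ A'
    · rw [indicator_of_mem hy']
      exact (hC y ⟨hy'.1, hy⟩).trans (le_abs_self _)
    · rw [indicator_of_notMem hy', norm_zero]; exact abs_nonneg _

-- Finite atlases of corner models.

universe u

/-- A finite family of local descriptions of a domain that covers its closure, with a partition
of unity and operators that raise the order of vanishing at the boundary as much as the growth
of `f` requires. -/
structure CornerAtlas {n N : ℕ} {M : Type u} [TopologicalSpace M] [ChartedSpace (Cn (n + 1)) M]
    (D : Fin N → Set M) (f : M → ℂ) where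
  ι : Type u
  [fintype : Fintype ι]
  c : ι → OpenPartialHomeomorph M (Cn (n + 1))
  c_mem : ∀ i, c i ∈ holoCharts (n + 1) M
  P : ∀ i, LocalCorner D (c i)
  K : ι → ℕ
  C : ι → ℝ
  controls : ∀ i, (P i).Controls f (K i) (C i)
  Q : ι → (Cn (n + 1) → ℂ) → Cn (n + 1) → ℂ
  isOperator : ∀ i, IsSmoothLocalOperator (Q i)
  integral_eq : ∀ i, ∀ u h : Cn (n + 1) → ℂ, ContDiff ℝ ∞ u → HasCompactSupport u →
    tsupport u ⊆ (P i).m.W → (P i).m.IsAdmissible u h →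
    ∫ y in (P i).m.region, h y * u y =
      ∫ y in (P i).m.region, h y * ((∏ j, ((P i).m.r j y : ℂ) ^ K i) * Q i u y)
  χ : ι → M → ℝ
  contMDiff_χ : ∀ i, ContMDiff 𝓘(ℝ, Cn (n + 1)) 𝓘(ℝ, ℝ) ∞ (χ i)
  tsupport_χ : ∀ i, tsupport (χ i) ⊆ (P i).dom
  sum_χ : ∀ x ∈ closure (⋂ j, D j), ∑ i, χ i x = 1

attribute [instance] CornerAtlas.fintype

section Existence

variable {n N : ℕ} {M : Type u} [MetricSpace M] [SigmaCompactSpace M]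
  [ChartedSpace (Cn (n + 1)) M] [IsManifold 𝓘(ℂ, Cn (n + 1)) ω M]

lemma exists_partition {ι : Type*} [Fintype ι] {s : Set M} (hs : IsClosed s) (U : ι → Set M)
    (hU : ∀ i, IsOpen (U i)) (hsU : s ⊆ ⋃ i, U i) : ∃ χ : ι → M → ℝ,
      (∀ i, ContMDiff 𝓘(ℝ, Cn (n + 1)) 𝓘(ℝ, ℝ) ∞ (χ i)) ∧ (∀ i, tsupport (χ i) ⊆ U i) ∧
      ∀ x ∈ s, ∑ i, χ i x = 1 := by
  have : IsManifold 𝓘(ℝ, Cn (n + 1)) ∞ M := isManifold_real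
  obtain ⟨χ, hχ⟩ := SmoothPartitionOfUnity.exists_isSubordinate 𝓘(ℝ, Cn (n + 1)) hs U hU hsU
  refine ⟨fun i => χ i, fun i => (χ i).contMDiff, hχ, fun x hx => ?_⟩
  rw [← finsum_eq_sum_of_fintype]
  exact χ.sum_eq_one hx

lemma nonempty_cornerAtlas (hM : IsLocallyEuclideanMetric (n + 1) M)
    {D : Fin N → Set M} {Ω : Set M} (hΩ : IsDomainWithGenericCorners (n + 1) D Ω) {f : M → ℂ}
    (hf : HolomorphicOfPolynomialGrowth (n + 1) Ω f) : Nonempty (CornerAtlas (n := n) D f) := by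
  have hloc : ∀ p : closure Ω, ∃ P : LocalCorner D (chartAt (Cn (n + 1)) (p : M)),
      (p : M) ∈ P.dom ∧ ∃ K C, P.Controls f K C := fun p => exists_controls hM hΩ hf p.2
  choose P hpP K C hC using hloc
  obtain ⟨t, ht⟩ := hΩ.isCompact_closure.elim_nhds_subcover' (fun p hp => (P ⟨p, hp⟩).dom)
    fun p hp => (P ⟨p, hp⟩).isOpen_dom.mem_nhds (hpP ⟨p, hp⟩)
  have hcov : closure Ω ⊆ ⋃ i : t, (P i).dom := fun x hx => by
    obtain ⟨i, hi, hxi⟩ := mem_iUnion₂.1 (ht hx)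
    exact mem_iUnion.2 ⟨⟨i, hi⟩, hxi⟩
  obtain ⟨χ, h1, h2, h3⟩ := exists_partition (n := n) isClosed_closure
    (fun i : t => (P i).dom) (fun i => (P i).isOpen_dom) hcov
  choose Q hQ hQi using fun i : t => (P i).m.exists_operator (K i)
  exact ⟨{
    ι := t
    c := fun i => chartAt (Cn (n + 1)) (i : closure Ω).1
    c_mem := fun i => IsManifold.chart_mem_maximalAtlas _
    P := fun i => P i
    K := fun i => K i
    C := fun i => C i
    controls := fun i => hC i
    Q := Q
    isOperator := hQ
    integral_eq := hQi
    χ := χ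
    contMDiff_χ := h1
    tsupport_χ := h2
    sum_χ := fun x hx => h3 x (by rwa [hΩ.eq_iInter]) }⟩

end Existence

/-! ### The extension, its values for bounded functions, and the limit formula. -/

namespace CornerAtlas

variable {n N : ℕ} {M : Type u} [TopologicalSpace M] [T2Space M] [ChartedSpace (Cn (n + 1)) M]
  [IsManifold 𝓘(ℂ, Cn (n + 1)) ω M] {D : Fin N → Set M} {f : M → ℂ}
  (A : CornerAtlas (n := n) D f)

/-- The localization of a form with the partition of unity. -/
def piece (i : A.ι) (φ : DiffForm (n + 1) M (n + 1 + n + 1)) :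
    DiffForm (n + 1) M (n + 1 + n + 1) := mulForm (A.χ i) φ

/-- The coefficient of the localization of a form. -/
def coeff (i : A.ι) (φ : DiffForm (n + 1) M (n + 1 + n + 1)) : Cn (n + 1) → ℂ :=
  extCoeff (A.piece i φ) (A.c i)

variable {A} {φ : DiffForm (n + 1) M (n + 1 + n + 1)}

lemma piece_mem (hφ : φ ∈ testForms (n + 1) M (n + 1 + n + 1)) (i : A.ι) :
    A.piece i φ ∈ testForms (n + 1) M (n + 1 + n + 1) := mulForm_mem (A.contMDiff_χ i) hφ

lemma isCompact_tsupport_piece (hφ : φ ∈ testForms (n + 1) M (n + 1 + n + 1)) (i : A.ι) :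
    IsCompact (tsupport (A.piece i φ)) := isCompact_tsupport_of_mem (A.piece_mem hφ i)

lemma tsupport_piece_subset_dom (i : A.ι) : tsupport (A.piece i φ) ⊆ (A.P i).dom :=
  (tsupport_mulForm_subset_left _ _).trans (A.tsupport_χ i)

lemma tsupport_piece_subset (i : A.ι) : tsupport (A.piece i φ) ⊆ tsupport φ :=
  tsupport_mulForm_subset_right _ _

lemma contDiff_coeff (hφ : φ ∈ testForms (n + 1) M (n + 1 + n + 1)) (i : A.ι) :
    ContDiff ℝ ∞ (A.coeff i φ) :=
  contDiff_extCoeff (A.piece_mem hφ i).1 (A.c_mem i) (A.isCompact_tsupport_piece hφ i)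
    ((A.tsupport_piece_subset_dom i).trans inter_subset_left)
    fun _ hx => image_eq_zero_of_notMem_tsupport hx

lemma hasCompactSupport_coeff (hφ : φ ∈ testForms (n + 1) M (n + 1 + n + 1)) (i : A.ι) :
    HasCompactSupport (A.coeff i φ) :=
  hasCompactSupport_extCoeff (A.isCompact_tsupport_piece hφ i)
    ((A.tsupport_piece_subset_dom i).trans inter_subset_left)
    fun _ hx => image_eq_zero_of_notMem_tsupport hx

lemma tsupport_coeff_subset (hφ : φ ∈ testForms (n + 1) M (n + 1 + n + 1)) (i : A.ι) :
    tsupport (A.coeff i φ) ⊆ A.c i '' tsupport (A.piece i φ) :=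
  tsupport_extCoeff_subset (A.isCompact_tsupport_piece hφ i)
    ((A.tsupport_piece_subset_dom i).trans inter_subset_left)
    fun _ hx => image_eq_zero_of_notMem_tsupport hx

lemma tsupport_coeff_subset_W (hφ : φ ∈ testForms (n + 1) M (n + 1 + n + 1)) (i : A.ι) :
    tsupport (A.coeff i φ) ⊆ (A.P i).m.W :=
  (A.P i).tsupport_extCoeff_subset_W (A.isCompact_tsupport_piece hφ i)
    (A.tsupport_piece_subset_dom i)

/-- A point of the region in the support of a local coefficient comes from a point of the
domain in the support of the form. -/
lemma exists_of_mem_region (hφ : φ ∈ testForms (n + 1) M (n + 1 + n + 1)) (i : A.ι)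
    {y : Cn (n + 1)} (hy : y ∈ (A.P i).m.region ∩ tsupport (A.coeff i φ)) :
    ∃ q ∈ tsupport (A.piece i φ), q ∈ ⋂ j, D j ∧ A.c i q = y ∧ (A.c i).symm y = q := by
  obtain ⟨q, hq, rfl⟩ := A.tsupport_coeff_subset hφ i hy.2
  have hqd := A.tsupport_piece_subset_dom i hq
  have h1 := (A.P i).mem_iInter_iff hqd.2 |>.2 hy.1
  rw [(A.c i).left_inv hqd.1] at h1
  exact ⟨q, hq, h1, rfl, (A.c i).left_inv hqd.1⟩

/-- The distribution that canonically extends `f`. -/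
def extension (A : CornerAtlas (n := n) D f)
    (hf : MDifferentiableOn 𝓘(ℂ, Cn (n + 1)) 𝓘(ℂ, ℂ) f (⋂ j, D j)) : Distribution0 n M where
  toLinearMap :=
    { toFun := fun φ => ∑ i, ∫ y, (A.P i).weight f (A.K i) y * A.Q i (A.coeff i φ.1) y
      map_add' := by
        intro φ ψ
        rw [← Finset.sum_add_distrib]
        refine Finset.sum_congr rfl fun i _ => ?_
        have h1 : A.coeff i (φ + ψ).1 = fun y => A.coeff i φ.1 y + A.coeff i ψ.1 y := by
          simp only [coeff, piece, Submodule.coe_add, mulForm_add, extCoeff_add]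
        have hi : ∀ φ : testForms (n + 1) M (n + 1 + n + 1), Integrable fun y =>
            (A.P i).weight f (A.K i) y * A.Q i (A.coeff i φ.1) y := fun φ =>
          LocalCorner.integrable_weight_mul (A.c_mem i) hf (A.controls i)
            ((A.isOperator i).contDiff (A.contDiff_coeff φ.2 i)).continuous
            ((A.hasCompactSupport_coeff φ.2 i).mono'
              ((subset_tsupport _).trans ((A.isOperator i).tsupport_subset _)))
        rw [h1, (A.isOperator i).map_add (A.contDiff_coeff φ.2 i) (A.contDiff_coeff ψ.2 i),
          ← integral_add (hi φ) (hi ψ)]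
        congr 1; funext y; ring
      map_smul' := by
        intro a φ
        rw [RingHom.id_apply, smul_eq_mul, Finset.mul_sum]
        refine Finset.sum_congr rfl fun i _ => ?_
        have h1 : A.coeff i (a • φ).1 = fun y => a * A.coeff i φ.1 y := by
          simp only [coeff, piece, Submodule.coe_smul, mulForm_smul, extCoeff_smul]
        rw [h1, (A.isOperator i).map_const_mul a (A.contDiff_coeff φ.2 i), ← integral_const_mul]
        congr 1; funext y; ring }
  seqContinuous := by
    intro φ hφ
    obtain ⟨K₀, hK₀, hφK⟩ := hφ.1
    suffices h : Tendsto
        (fun ν => ∑ i, ∫ y, (A.P i).weight f (A.K i) y * A.Q i (A.coeff i (φ ν).1) y) atTop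
        (𝓝 (∑ _i : A.ι, (0 : ℂ))) by
      rwa [Finset.sum_const_zero] at h
    refine tendsto_finsetSum _ fun i _ => ?_
    -- One compact set in the chart domain that contains the supports of all localized forms of the
    -- sequence.
    have hK : IsCompact (tsupport (A.χ i) ∩ K₀) := hK₀.inter_left (isClosed_tsupport _)
    have hKs : tsupport (A.χ i) ∩ K₀ ⊆ (A.c i).source :=
      inter_subset_left.trans ((A.tsupport_χ i).trans inter_subset_left)
    have hL := hK.image_of_continuousOn ((A.c i).continuousOn.mono hKs)
    have hsup : ∀ ν, tsupport (A.coeff i (φ ν).1) ⊆ A.c i '' (tsupport (A.χ i) ∩ K₀) := by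
      intro ν
      refine tsupport_extCoeff_subset hK hKs fun x hx => ?_
      by_cases h : x ∈ tsupport (A.χ i)
      · ext w; simp [piece, mulForm, hφK ν x fun h' => hx ⟨h, h'⟩]
      · ext w; simp [piece, mulForm, image_eq_zero_of_notMem_tsupport h]
    have hconv := (A.isOperator i).tendsto hL (fun ν => A.contDiff_coeff (φ ν).2 i)
      (SmoothlyTendstoZero.extCoeff_mulForm (A.contMDiff_χ i) (fun ν => (φ ν).2.1) hφ (A.c_mem i)
        hL (by rintro _ ⟨x, hx, rfl⟩; exact (A.c i).map_source (hKs hx)))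
    refine LocalCorner.tendsto_integral_weight_mul (A.controls i) hL
      (fun ν => ((A.isOperator i).tsupport_subset _).trans (hsup ν)) ?_
    rw [Metric.tendstoUniformlyOn_iff]
    intro ε hε
    filter_upwards [smoothlyTendstoZero_iff.1 hconv 0 ε hε] with ν hν y hy
    have := hν y hy
    rwa [norm_iteratedFDeriv_zero, ← dist_zero_left] at this

lemma sum_topCoeff_piece {e : OpenPartialHomeomorph M (Cn (n + 1))} {y : Cn (n + 1)}
    (hy : e.symm y ∈ closure (⋂ j, D j)) :
    ∑ i, topCoeff (A.piece i φ) e y = topCoeff φ e y := by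
  simp only [piece, topCoeff_mulForm, ← Finset.sum_mul]
  rw [← Complex.ofReal_sum, A.sum_χ _ hy, Complex.ofReal_one, one_mul]

/-- Decomposition of an integral over the domain with the partition of unity. -/
lemma integral_eq_sum (hD : ∀ j, IsOpen (D j))
    (hφ : φ ∈ testForms (n + 1) M (n + 1 + n + 1))
    {e : OpenPartialHomeomorph M (Cn (n + 1))} (he : e ∈ holoCharts (n + 1) M)
    (hφe : tsupport φ ⊆ e.source) {H : Cn (n + 1) → ℂ} {O : Set (Cn (n + 1))} (hO : IsOpen O)
    (hH : ContinuousOn H O)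
    (hsub : ∀ i, ∀ q ∈ tsupport (A.piece i φ), q ∈ ⋂ j, D j → e q ∈ O)
    {B : A.ι → ℝ} (hB : ∀ i, ∀ q ∈ tsupport (A.piece i φ), q ∈ ⋂ j, D j → ‖H (e q)‖ ≤ B i) :
    ∫ y in e.target ∩ e.symm ⁻¹' (⋂ j, D j), H y * topCoeff φ e y =
      ∑ i, ∫ y in (A.P i).m.region, H (e ((A.c i).symm y)) * A.coeff i φ y := by
  have hΩm : MeasurableSet (e.target ∩ e.symm ⁻¹' (⋂ j, D j)) :=
    (e.isOpen_inter_preimage_symm (isOpen_iInter_of_finite hD)).measurableSet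
  have hsupp : ∀ i, tsupport (A.piece i φ) ⊆ e.source := fun i =>
    (A.tsupport_piece_subset i).trans hφe
  have hz : ∀ i, ∀ x ∉ tsupport (A.piece i φ), A.piece i φ x = 0 := fun i x hx =>
    image_eq_zero_of_notMem_tsupport hx
  have hpt : ∀ i, ∀ y ∈ (e.target ∩ e.symm ⁻¹' (⋂ j, D j)) ∩ tsupport (extCoeff (A.piece i φ) e),
      ∃ q ∈ tsupport (A.piece i φ), q ∈ ⋂ j, D j ∧ e q = y := fun i y hy => by
    obtain ⟨q, hq, rfl⟩ := tsupport_extCoeff_subset (A.isCompact_tsupport_piece hφ i) (hsupp i)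
      (hz i) hy.2
    have := hy.1.2
    rw [mem_preimage, e.left_inv (hsupp i hq)] at this
    exact ⟨q, hq, this, rfl⟩
  have hint : ∀ i, IntegrableOn (fun y => H y * topCoeff (A.piece i φ) e y)
      (e.target ∩ e.symm ⁻¹' (⋂ j, D j)) := fun i => by
    have h1 := integrableOn_mul_of_bounded hΩm hO.measurableSet hH
      (contDiff_extCoeff (A.piece_mem hφ i).1 he (A.isCompact_tsupport_piece hφ i) (hsupp i)
        (hz i)).continuous
      (hasCompactSupport_extCoeff (A.isCompact_tsupport_piece hφ i) (hsupp i) (hz i))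
      (fun y hy => by obtain ⟨q, h1, h2, rfl⟩ := hpt i y hy; exact hsub i q h1 h2) (C := B i)
      (fun y hy => by obtain ⟨q, h1, h2, rfl⟩ := hpt i y hy; exact hB i q h1 h2)
    refine h1.congr_fun (fun y hy => ?_) hΩm
    simp only [extCoeff, indicator_of_mem hy.1]
  calc _ = ∫ y in e.target ∩ e.symm ⁻¹' (⋂ j, D j), ∑ i, H y * topCoeff (A.piece i φ) e y := by
        refine setIntegral_congr_fun hΩm fun y hy => ?_
        simp only [← Finset.mul_sum]
        rw [A.sum_topCoeff_piece (subset_closure hy.2)]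
    _ = ∑ i, ∫ y in e.target ∩ e.symm ⁻¹' (⋂ j, D j), H y * topCoeff (A.piece i φ) e y :=
        integral_finsetSum _ fun i _ => hint i
    _ = _ := by
        refine Finset.sum_congr rfl fun i _ => ?_
        rw [coeff, ← (A.P i).integral_eq_integral_region (A.c_mem i) he hD
          (A.isCompact_tsupport_piece hφ i) (A.tsupport_piece_subset_dom i) (hsupp i)
          (fun x => H (e x))]
        refine setIntegral_congr_fun hΩm fun y hy => ?_
        simp only [e.right_inv hy.1]

/-- A function bounded on the part of the support in the domain is itself admissible, so the
identity for `Q` can be undone and the local integrals reassembled. -/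
lemma extension_eq_of_bounded (hD : ∀ j, IsOpen (D j))
    (hf : MDifferentiableOn 𝓘(ℂ, Cn (n + 1)) 𝓘(ℂ, ℂ) f (⋂ j, D j))
    (φ : testForms (n + 1) M (n + 1 + n + 1))
    {e : OpenPartialHomeomorph M (Cn (n + 1))} (he : e ∈ holoCharts (n + 1) M)
    (hφe : tsupport φ.1 ⊆ e.source) {B : ℝ}
    (hB : ∀ q ∈ tsupport φ.1, q ∈ ⋂ j, D j → ‖f q‖ ≤ B) :
    (A.extension hf).toLinearMap φ =
      ∫ y in e.target ∩ e.symm ⁻¹' (⋂ j, D j), f (e.symm y) * topCoeff φ.1 e y := by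
  have hΩo : IsOpen (⋂ j, D j) := isOpen_iInter_of_finite hD
  have hsupp : ∀ i, tsupport (A.piece i φ.1) ⊆ e.source := fun i =>
    (A.tsupport_piece_subset i).trans hφe
  rw [A.integral_eq_sum hD φ.2 he hφe (H := fun y => f (e.symm y))
    (e.isOpen_inter_preimage_symm hΩo)
    (differentiableOn_comp_symm hf he).continuousOn (B := fun _ => B)
    (fun i q hq hqΩ => ⟨e.map_source (hsupp i hq), by
      rwa [mem_preimage, e.left_inv (hsupp i hq)]⟩)
    (fun i q hq hqΩ => by
      simpa [e.left_inv (hsupp i hq)] using hB q (A.tsupport_piece_subset i hq) hqΩ)]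
  refine Finset.sum_congr rfl fun i _ => ?_
  have hpt := fun y hy => A.exists_of_mem_region (y := y) φ.2 i hy
  rw [LocalCorner.integral_weight_eq_of_bounded (A.c_mem i) hf (A.isOperator i) (A.integral_eq i)
    (A.contDiff_coeff φ.2 i) (A.hasCompactSupport_coeff φ.2 i) (A.tsupport_coeff_subset_W φ.2 i)
    (B := B) (fun y hy => by
      obtain ⟨q, h1, h2, -, h4⟩ := hpt y hy
      rw [h4]; exact hB q (A.tsupport_piece_subset i h1) h2)]
  refine setIntegral_congr_fun (A.P i).m.isOpen_region.measurableSet fun y hy => ?_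
  by_cases hyu : y ∈ tsupport (A.coeff i φ.1)
  · obtain ⟨q, h1, h2, -, h4⟩ := hpt y ⟨hy, hyu⟩
    simp [h4, e.left_inv (hsupp i h1)]
  · simp [image_eq_zero_of_notMem_tsupport hyu]

/-- For small `ε` the shifted functions are admissible and converge pointwise to `f`. The definite
proportion in `eventually_shift` bounds them uniformly after weighting, so
`tendsto_integral_of_admissible` gives the limit of each local integral. -/
lemma tendsto_extension (hD : ∀ j, IsOpen (D j))
    (hf : MDifferentiableOn 𝓘(ℂ, Cn (n + 1)) 𝓘(ℂ, ℂ) f (⋂ j, D j))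
    (φ : testForms (n + 1) M (n + 1 + n + 1))
    {e : OpenPartialHomeomorph M (Cn (n + 1))} (he : e ∈ holoCharts (n + 1) M)
    (hφe : tsupport φ.1 ⊆ e.source) {v : Cn (n + 1)}
    (hv : ∀ j, ∀ p ∈ frontier (D j) ∩ tsupport φ.1, PointsOutward (n + 1) (D j) e v p) :
    Tendsto (fun ε : ℝ => ∫ y in e.target ∩ e.symm ⁻¹' (⋂ j, D j),
      f (e.symm (y - ε • v)) * topCoeff φ.1 e y) (𝓝[>] 0)
      (𝓝 ((A.extension hf).toLinearMap φ)) := by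
  have hΩo : IsOpen (⋂ j, D j) := isOpen_iInter_of_finite hD
  have hsupp : ∀ i, tsupport (A.piece i φ.1) ⊆ e.source := fun i =>
    (A.tsupport_piece_subset i).trans hφe
  have hfe : DifferentiableOn ℂ (f ∘ e.symm) (e.target ∩ e.symm ⁻¹' (⋂ j, D j)) :=
    differentiableOn_comp_symm hf he
  have hOe : IsOpen (e.target ∩ e.symm ⁻¹' (⋂ j, D j)) := e.isOpen_inter_preimage_symm hΩo
  have hshift := fun i => (A.P i).eventually_shift (A.c_mem i) he hD
    (A.isCompact_tsupport_piece φ.2 i) (A.tsupport_piece_subset_dom i) (hsupp i)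
    fun j p hp => hv j p ⟨hp.1, A.tsupport_piece_subset i hp.2⟩
  -- This bound depends on `ε`; it serves admissibility and integrability only, not domination.
  have hbound : ∀ i, ∀ᶠ ε : ℝ in 𝓝[>] 0, ∃ B, ∀ q ∈ tsupport (A.piece i φ.1), q ∈ ⋂ j, D j →
      ‖f (e.symm (e q - ε • v))‖ ≤ B := fun i => by
    filter_upwards [hshift i] with ε hε
    have hK : IsCompact (closure (⋂ j, D j) ∩ tsupport (A.piece i φ.1)) :=
      (A.isCompact_tsupport_piece φ.2 i).inter_left isClosed_closure
    have hc : ContinuousOn (fun q => f (e.symm (e q - ε • v)))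
        (closure (⋂ j, D j) ∩ tsupport (A.piece i φ.1)) :=
      hfe.continuousOn.comp (((e.continuousOn.mono (hsupp i)).mono inter_subset_right).sub
        continuousOn_const) fun q hq => ⟨(hε q hq).1, (hε q hq).2.2.1⟩
    obtain ⟨B, hB⟩ := hK.exists_bound_of_continuousOn hc
    exact ⟨B, fun q hq hqΩ => hB q ⟨subset_closure hqΩ, hq⟩⟩
  have hlim : ∀ i, Tendsto (fun ε : ℝ => ∫ y in (A.P i).m.region,
      f (e.symm (e ((A.c i).symm y) - ε • v)) * A.coeff i φ.1 y) (𝓝[>] 0)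
      (𝓝 (∫ y, (A.P i).weight f (A.K i) y * A.Q i (A.coeff i φ.1) y)) := by
    intro i
    have hpt := fun y hy => A.exists_of_mem_region (y := y) φ.2 i hy
    refine LocalCorner.tendsto_integral_of_admissible (A.isOperator i) (A.integral_eq i)
      (A.contDiff_coeff φ.2 i) (A.hasCompactSupport_coeff φ.2 i) (A.tsupport_coeff_subset_W φ.2 i)
      (h := fun ε y => f (e.symm (e ((A.c i).symm y) - ε • v)))
      -- Each `|r j|` is at most twice its value at the shifted point, which costs a factor `2 ^ K`
      -- per face.
      (B := (∏ _j : (A.P i).S, (2 : ℝ) ^ A.K i) * A.C i) ?_ ?_ ?_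
    · filter_upwards [hshift i, hbound i] with ε hε hεB
      obtain ⟨B, hB⟩ := hεB
      have htr := differentiableOn_transition (A.c_mem i) he
      have htr' : DifferentiableOn ℂ (fun y => (e ∘ (A.c i).symm) y - ε • v)
          ((A.c i).symm.trans e).source := htr.sub_const _
      refine ⟨⟨_, htr'.continuousOn.isOpen_inter_preimage
        ((A.c i).symm.trans e).open_source hOe, ?_, fun y hy => ?_⟩, B, fun y hy => ?_⟩
      · exact hfe.comp (htr'.mono inter_subset_left) fun y hy => hy.2
      · obtain ⟨q, h1, h2, rfl, h4⟩ := hpt y hy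
        have h5 := hε q ⟨subset_closure h2, h1⟩
        refine ⟨mem_transition_source.2
          ⟨(A.c i).map_source (A.tsupport_piece_subset_dom i h1).1, ?_⟩, ?_⟩
        · rw [h4]; exact hsupp i h1
        · rw [mem_preimage, Function.comp_apply, h4]
          exact ⟨h5.1, h5.2.2.1⟩
      · obtain ⟨q, h1, h2, -, h4⟩ := hpt y hy
        rw [h4]; exact hB q h1 h2
    · filter_upwards [hshift i] with ε hε y hy
      obtain ⟨q, h1, h2, rfl, h4⟩ := hpt y hy
      obtain ⟨-, s2, s3, s4⟩ := hε q ⟨subset_closure h2, h1⟩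
      set q' := e.symm (e q - ε • v) with hq'
      have hreg : A.c i q' ∈ (A.P i).m.region := by
        rw [← (A.P i).mem_iInter_iff s2.2, (A.c i).left_inv s2.1]; exact s3
      have hcon := A.controls i (A.c i q') ⟨hreg, s2.2⟩
      rw [(A.c i).left_inv s2.1] at hcon
      rw [h4, ← hq']
      calc _ ≤ ‖f q'‖ * ∏ j, ((2 : ℝ) ^ A.K i * |(A.P i).m.r j (A.c i q')| ^ A.K i) := by
            refine mul_le_mul_of_nonneg_left (Finset.prod_le_prod
              (fun _ _ => by positivity) fun j _ => ?_) (norm_nonneg _)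
            rw [← mul_pow]
            refine pow_le_pow_left₀ (abs_nonneg _) ?_ _
            rw [abs_of_neg (hy.1 j), abs_of_neg (hreg j)]
            linarith [s4 j]
        _ = (∏ _j : (A.P i).S, (2 : ℝ) ^ A.K i) *
              (‖f q'‖ * ∏ j, |(A.P i).m.r j (A.c i q')| ^ A.K i) := by
            rw [Finset.prod_mul_distrib]; ring
        _ ≤ _ := mul_le_mul_of_nonneg_left hcon (Finset.prod_nonneg fun _ _ => by positivity)
    · intro y hy
      obtain ⟨q, h1, h2, rfl, h4⟩ := hpt y hy
      have hqe := hsupp i h1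
      have hc : ContinuousAt (f ∘ e.symm) (e q) :=
        hfe.continuousOn.continuousAt (hOe.mem_nhds ⟨e.map_source hqe, by
          rwa [mem_preimage, e.left_inv hqe]⟩)
      have ht : Tendsto (fun ε : ℝ => e q - ε • v) (𝓝[>] 0) (𝓝 (e q)) := by
        have h5 : Continuous fun ε : ℝ => e q - ε • v := by fun_prop
        simpa using (h5.tendsto 0).mono_left nhdsWithin_le_nhds
      have h6 := hc.tendsto.comp ht
      simp only [Function.comp_apply, e.left_inv hqe] at h6
      simp only [h4]
      exact h6
  refine (tendsto_finsetSum Finset.univ fun i _ => hlim i).congr' ?_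
  filter_upwards [eventually_all.2 hshift, eventually_all.2 hbound] with ε hε hεB
  choose B hB using hεB
  have hcs : Continuous fun y : Cn (n + 1) => y - ε • v := by fun_prop
  exact (A.integral_eq_sum hD φ.2 he hφe (H := fun y => f (e.symm (y - ε • v)))
    (hOe.preimage hcs) (hfe.continuousOn.comp hcs.continuousOn fun y hy => hy)
    (fun i q hq hqΩ => ⟨(hε i q ⟨subset_closure hqΩ, hq⟩).1,
      (hε i q ⟨subset_closure hqΩ, hq⟩).2.2.1⟩) hB).symm

end CornerAtlas

/-! ### Uniqueness, vanishing on forms that vanish on the domain, and existence. -/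

section Uniqueness

variable {n N : ℕ} {M : Type u} [MetricSpace M] [SigmaCompactSpace M]
  [ChartedSpace (Cn (n + 1)) M] [IsManifold 𝓘(ℂ, Cn (n + 1)) ω M]

/-- Each test form is a sum of forms to which the limit formula applies. -/
lemma exists_decomposition {D : Fin N → Set M} {Ω : Set M}
    (hΩ : IsDomainWithGenericCorners (n + 1) D Ω) (φ : testForms (n + 1) M (n + 1 + n + 1)) :
    ∃ (t : Finset M) (ψ : t → testForms (n + 1) M (n + 1 + n + 1)) (v : t → Cn (n + 1)),
      φ = ∑ i, ψ i ∧ ∀ i, tsupport (ψ i).1 ⊆ (chartAt (Cn (n + 1)) (i : M)).source ∧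
      (∀ j, ∀ p ∈ frontier (D j) ∩ tsupport (ψ i).1,
        PointsOutward (n + 1) (D j) (chartAt (Cn (n + 1)) (i : M)) (v i) p) ∧
      ∀ x, φ.1 x = 0 → (ψ i).1 x = 0 := by
  choose U v hU hpU hUs hUv using exists_outward hΩ
  have hK := isCompact_tsupport_of_mem φ.2
  obtain ⟨t, -, ht⟩ := hK.elim_nhds_subcover U fun p _ => (hU p).mem_nhds (hpU p)
  have hcov : tsupport φ.1 ⊆ ⋃ i : t, U i := fun x hx => by
    obtain ⟨i, hi, hxi⟩ := mem_iUnion₂.1 (ht hx)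
    exact mem_iUnion.2 ⟨⟨i, hi⟩, hxi⟩
  obtain ⟨χ, h1, h2, h3⟩ := exists_partition (n := n) hK.isClosed (fun i : t => U i)
    (fun i => hU i) hcov
  have hsub : ∀ i, tsupport (mulForm (χ i) φ.1) ⊆ U i := fun i =>
    (tsupport_mulForm_subset_left _ _).trans (h2 i)
  refine ⟨t, fun i => ⟨mulForm (χ i) φ.1, mulForm_mem (h1 i) φ.2⟩, fun i => v i, ?_,
    fun i => ⟨(hsub i).trans (hUs i), fun j p hp => hUv i p (hsub i hp.2) j hp.1, fun x hx => ?_⟩⟩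
  · apply Subtype.ext
    funext x
    ext w
    rw [Submodule.coe_sum, Finset.sum_apply, ContinuousAlternatingMap.sum_apply]
    simp only [mulForm, ContinuousAlternatingMap.smul_apply, smul_eq_mul, ← Finset.sum_mul]
    by_cases hx : x ∈ tsupport φ.1
    · rw [← Complex.ofReal_sum, h3 x hx, Complex.ofReal_one, one_mul]
    · rw [image_eq_zero_of_notMem_tsupport hx]; simp
  · ext w; simp [mulForm, hx]

/-- The limit formula alone determines the values on the pieces of the decomposition. -/
lemma IsCanonicalExtension.unique {D : Fin N → Set M} {Ω : Set M}
    (hΩ : IsDomainWithGenericCorners (n + 1) D Ω) {f : M → ℂ} {T T' : Distribution0 n M}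
    (hT : IsCanonicalExtension D Ω f T) (hT' : IsCanonicalExtension D Ω f T') : T = T' := by
  have h : T.toLinearMap = T'.toLinearMap := by
    ext φ
    obtain ⟨t, ψ, v, hφ, hψ⟩ := exists_decomposition hΩ φ
    rw [hφ, map_sum, map_sum]
    refine Finset.sum_congr rfl fun i _ => ?_
    obtain ⟨a, b, -⟩ := hψ i
    exact tendsto_nhds_unique
      (hT.tendsto _ (IsManifold.chart_mem_maximalAtlas _) (ψ i) (v i) a b)
      (hT'.tendsto _ (IsManifold.chart_mem_maximalAtlas _) (ψ i) (v i) a b)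
  cases T
  cases T'
  congr

/-- The pieces of the decomposition inherit the zeros of the form, so the integrals in the limit
formula vanish for every `ε`; the shift acts only on `f`. -/
lemma IsCanonicalExtension.eq_zero {D : Fin N → Set M} {Ω : Set M}
    (hΩ : IsDomainWithGenericCorners (n + 1) D Ω) {f : M → ℂ} {T : Distribution0 n M}
    (hT : IsCanonicalExtension D Ω f T) {φ : testForms (n + 1) M (n + 1 + n + 1)}
    (hφ0 : ∀ x ∈ Ω, φ.1 x = 0) : T.toLinearMap φ = 0 := by
  obtain ⟨t, ψ, v, hφ, hψ⟩ := exists_decomposition hΩ φ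
  rw [hφ, map_sum]
  refine Finset.sum_eq_zero fun i _ => ?_
  obtain ⟨a, b, c⟩ := hψ i
  refine tendsto_nhds_unique
    (hT.tendsto _ (IsManifold.chart_mem_maximalAtlas _) (ψ i) (v i) a b)
    (tendsto_const_nhds.congr fun ε => ?_)
  symm
  refine setIntegral_eq_zero_of_forall_eq_zero fun y hy => ?_
  rw [topCoeff_eq_zero (c _ (hφ0 _ hy.2)), mul_zero]

/-- In the first and third properties `f` is bounded on the relevant set: by continuity on a compact
support inside the domain, or because `g` is continuous on a compact closure. -/
lemma CornerAtlas.isCanonicalExtension {D : Fin N → Set M} {Ω : Set M}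
    (hΩ : IsDomainWithGenericCorners (n + 1) D Ω) {f : M → ℂ}
    (A : CornerAtlas (n := n) D f)
    (hf : MDifferentiableOn 𝓘(ℂ, Cn (n + 1)) 𝓘(ℂ, ℂ) f (⋂ j, D j)) :
    IsCanonicalExtension D Ω f (A.extension hf) := by
  have hD : ∀ j, IsOpen (D j) := fun j => (hΩ.isSmoothDomain j).isOpen
  have hΩc := hΩ.isCompact_closure
  have hΩe := hΩ.eq_iInter
  subst hΩe
  have hΩo : IsOpen (⋂ j, D j) := isOpen_iInter_of_finite hD
  refine ⟨fun e he φ hφ => ?_, fun e he φ v hφ hv => A.tendsto_extension hD hf φ he hφ hv,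
    fun g hg hgf e he φ hφ => ?_⟩
  · have hcomp := isCompact_tsupport_of_mem φ.2
    obtain ⟨B, hB⟩ := hcomp.exists_bound_of_continuousOn
      (hf.continuousOn.mono (hφ.trans inter_subset_left))
    rw [A.extension_eq_of_bounded hD hf φ he (hφ.trans inter_subset_right)
      (fun q hq _ => hB q hq)]
    symm
    refine setIntegral_eq_of_subset_of_forall_sdiff_eq_zero e.open_target.measurableSet
      inter_subset_left fun y hy => ?_
    rw [topCoeff_eq_zero (image_eq_zero_of_notMem_tsupport fun h => hy.2 ⟨hy.1, (hφ h).1⟩),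
      mul_zero]
  · obtain ⟨B, hB⟩ := hΩc.exists_bound_of_continuousOn hg
    rw [A.extension_eq_of_bounded hD hf φ he hφ (B := B)
      fun q _ hq => by rw [← hgf hq]; exact hB q (subset_closure hq)]
    -- The formula for bounded functions integrates over the domain, the property over its closure;
    -- the difference is negligible.
    have hnull : volume (e.target ∩ e.symm ⁻¹' (closure (⋂ j, D j) \ ⋂ j, D j)) = 0 :=
      LocalCorner.volume_frontier_eq_zero (fun p hp => by
        obtain ⟨P, hP, -⟩ := exists_localCorner hΩ hp
        exact ⟨_, IsManifold.chart_mem_maximalAtlas p, P, hP⟩) he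
    have hae : (e.target ∩ e.symm ⁻¹' (⋂ j, D j) : Set (Cn (n + 1))) =ᵐ[volume]
        (e.target ∩ e.symm ⁻¹' closure (⋂ j, D j) : Set (Cn (n + 1))) := by
      have hsub : (e.target ∩ e.symm ⁻¹' (⋂ j, D j) : Set (Cn (n + 1))) ⊆
          e.target ∩ e.symm ⁻¹' closure (⋂ j, D j) :=
        inter_subset_inter_right _ (preimage_mono subset_closure)
      refine hsub.eventuallyLE.antisymm ?_
      refine ae_le_set.2 (measure_mono_null ?_ hnull)
      rintro y ⟨⟨h1, h2⟩, h3⟩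
      exact ⟨h1, h2, fun h => h3 ⟨h1, h⟩⟩
    rw [← setIntegral_congr_set hae]
    refine setIntegral_congr_fun (e.isOpen_inter_preimage_symm hΩo).measurableSet fun y hy => ?_
    simp only [hgf hy.2]

end Uniqueness

end

end BoundaryCurrents

theorem proposition2 {n N : ℕ} {M : Type*} [MetricSpace M] [SigmaCompactSpace M]
    [ChartedSpace (BoundaryCurrents.Cn (n + 1)) M]
    [IsManifold 𝓘(ℂ, BoundaryCurrents.Cn (n + 1)) ω M]
    (hM : BoundaryCurrents.IsLocallyEuclideanMetric (n + 1) M)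
    (D : Fin N → Set M) (Ω : Set M)
    (hΩ : BoundaryCurrents.IsDomainWithGenericCorners (n + 1) D Ω)
    (f : M → ℂ) (hf : BoundaryCurrents.HolomorphicOfPolynomialGrowth (n + 1) Ω f) :
    (∃! T : BoundaryCurrents.Distribution0 n M,
      BoundaryCurrents.IsCanonicalExtension D Ω f T) ∧
    ∀ T : BoundaryCurrents.Distribution0 n M, BoundaryCurrents.IsCanonicalExtension D Ω f T →
      BoundaryCurrents.WeinstockCondition Ω (BoundaryCurrents.boundaryCurrent T) := by
  have hf' : MDifferentiableOn 𝓘(ℂ, BoundaryCurrents.Cn (n + 1)) 𝓘(ℂ, ℂ) f (⋂ j, D j) := by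
    have h := hf.1
    rwa [hΩ.eq_iInter] at h
  obtain ⟨A⟩ := BoundaryCurrents.nonempty_cornerAtlas hM hΩ hf
  refine ⟨⟨A.extension hf', A.isCanonicalExtension hΩ hf', fun T hT =>
    hT.unique hΩ (A.isCanonicalExtension hΩ hf')⟩, fun T hT ψ hψ => ?_⟩
  have h : (BoundaryCurrents.boundaryCurrent T).toLinearMap ψ =
      T.toLinearMap (BoundaryCurrents.dbar n M ψ) := by
    -- The sign of `bc f = -∂̄(ce f)` cancels the sign in the definition of `∂̄` on currents.
    simp [BoundaryCurrents.boundaryCurrent, BoundaryCurrents.dbarCurrent]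
  rw [h]
  exact hT.eq_zero hΩ fun x hx => hψ x (subset_closure hx)
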